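/- **Conventions.** $\mathcal F f(\xi)=\int_{\mathbb R^d}e^{-2\pi i x\cdot\xi}f(x)\,dx$, $T_xf(t)=f(t-x)$, $M_\xi f(t)=e^{2\pi i t\cdot\xi}f(t)$, extended to $\mathcal S'(\mathbb R^d)$ by duality. A *polynomially bounded weight* on $\mathbb R^d$ is a measurable $\eta:\mathbb R^d\to(0,\infty)$ for which there are $C,\tau>0$ with $\eta(x+y)\le C\eta(x)(1+|y|)^\tau$ for all $x,y$. A *TMIB space* on $\mathbb R^d$ is a complex Banach space $E$ with continuous and dense inclusions $\mathcal S(\mathbb R^d)\subseteq E\subseteq\mathcal S'(\mathbb R^d)$, such that $T_xE\subseteq E$ and $M_\xi E\subseteq E$ for all $x,\xi\in\mathbb R^d$, and such that for some $C,\tau>0$ the operator norms $\omega_E(x)=\|T_x\|_{E\to E}$ and $\nu_E(\xi)=\|M_{-\xi}\|_{E\to E}$ are at most $C(1+|x|)^\tau$ and $C(1+|\xi|)^\tau$ respectively. *Amalgam spaces.* Fix a smooth $\phi$ with $0\le\phi\le1$, compact support in $(-1,1)^d$ and $\sum_{\mathbf k\in\mathbb Z^d}\phi_{\mathbf k}=1$,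 where $\phi_{\mathbf k}=T_{\mathbf k}\phi$. For a TMIB space $E$, a polynomially bounded weight $\eta$ and $1\le p\le\infty$, $W(E,L^p_\eta)$ is the space of all $f\in E_{\mathrm{loc}}=\{f\in\mathcal D'(\mathbb R^d): \chi f\in E\ \ \forall\chi\in\mathcal D(\mathbb R^d)\}$ with $$\|f\|_{W(E,L^p_\eta)}=\Big\|\,\eta\sum_{\mathbf k\in\mathbb Z^d}\|f\phi_{\mathbf k}\|_E\,\mathbf 1_{\mathbf k+[-1,1]^d}\Big\|_{L^p(\mathbb R^d)}<\infty,$$ and $W(E,L^\infty_{\eta,0})$ is the subspace of those $f\in W(E,L^\infty_\eta)$ for which the function inside this norm vanishes at infinity: for every $\varepsilon>0$ its essential supremum outside some compact set is at most $\varepsilon$. For a space $A\subseteq\mathcal S'(\mathbb R^d)$, $\mathcal FA=\{\mathcal Ff: f\in A\}$ carries the norm $\|\mathcal Ff\|_{\mathcal FA}=\|f\|_A$. *Modulation spaces.* Let $A\hat\otimes_\pi B$ be the completed projective tensor product of two TMIB spaces on $\mathbb R^d$, regarded as a space of tempered distributions on $\mathbb R^{2d}=\mathbb R^d_x\times\mathbb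 R^d_\xi$. Fix $g\in\mathcal S(\mathbb R^d)\setminus\{0\}$ and let $V_gf(x,\xi)=\langle f,\overline{M_\xi T_xg}\rangle$ be the short-time Fourier transform. For $X=A\hat\otimes_\pi B$, put $\mathcal M[X]=\{f\in\mathcal S'(\mathbb R^d): V_gf\in X\}$ with norm $\|f\|_{\mathcal M[X]}=\|V_gf\|_X$. **Theorem.** Let $E$ and $F$ be TMIB spaces on $\mathbb R^d$ with $\omega_F(x)=1$ for all $x\in\mathbb R^d$, and let $\eta_1,\eta_2$ be polynomially bounded weights on $\mathbb R^d$. Then $W(E,L^1_{\eta_1\eta_2})$ is equal, with equivalent norms, to each of the following spaces: 1. $\mathcal M\big[W(F,L^{p_1}_{\eta_1})\,\hat\otimes_\pi\,\mathcal FW(E,L^{p_2}_{\eta_2})\big]$ for all $p_1,p_2\in[1,\infty)$ with $\frac1{p_1}+\frac1{p_2}\ge1$; 2. $\mathcal M\big[W(F,L^{\infty}_{\eta_1,0})\,\hat\otimes_\pi\,\mathcal FW(E,L^{1}_{\eta_2})\big]$; 3. $\mathcal M\big[W(F,L^{1}_{\eta_1})\,\hat\otimes_\pi\,\mathcal FW(E,L^{\infty}_{\eta_2,0})\big]$.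 -/

import Mathlib

open scoped SchwartzMap Distributions ENNReal NNReal FourierTransform TensorProduct Topology
open MeasureTheory Filter

namespace AmalgamMod

noncomputable section

/-! ### Euclidean space, test functions, distributions -/

/-- `ℝ^d` with its Euclidean norm. -/
abbrev Space (d : ℕ) : Type := EuclideanSpace ℝ (Fin d)

/-- The complex tempered distributions on `ℝ^d`. -/
abbrev Tempered (d : ℕ) : Type := 𝓢'(Space d, ℂ)

/-- The real-valued test functions on `ℝ^d`. -/
abbrev Test (d : ℕ) : Type := 𝓓((⊤ : TopologicalSpace.Opens (Space d)), ℝ)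

/-- The complex-valued distributions on `ℝ^d` (tested on real test functions). -/
abbrev Distr (d : ℕ) : Type := 𝓓'((⊤ : TopologicalSpace.Opens (Space d)), ℂ)

/-- The product of two test functions. -/
def testMul {d : ℕ} (χ ψ : Test d) : Test d where
  toFun x := χ x * ψ x
  contDiff' := χ.contDiff.mul ψ.contDiff
  hasCompactSupport' := χ.hasCompactSupport.mul_right
  tsupport_subset' := by simp

/-- The translate `T_x χ = χ(· - x)` of a test function. -/
def testTranslate {d : ℕ} (x : Space d) (χ : Test d) : Test d where
  toFun t := χ (t - x)
  contDiff' := χ.contDiff.comp (contDiff_id.sub contDiff_const)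
  hasCompactSupport' := χ.hasCompactSupport.comp_homeomorph (Homeomorph.subRight x)
  tsupport_subset' := by simp

/-- A test function, regarded as a Schwartz function. -/
def testToSchwartz {d : ℕ} (ψ : Test d) : 𝓢(Space d, ℂ) :=
  HasCompactSupport.toSchwartzMap (f := fun x => (ψ x : ℂ))
    (ψ.hasCompactSupport.comp_left Complex.ofReal_zero)
    (Complex.ofRealCLM.contDiff.comp ψ.contDiff)

theorem testToSchwartz_apply {d : ℕ} (ψ : Test d) (x : Space d) :
    testToSchwartz ψ x = (ψ x : ℂ) := rfl

theorem testToSchwartz_add {d : ℕ} (ψ χ : Test d) :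
    testToSchwartz (ψ + χ) = testToSchwartz ψ + testToSchwartz χ := by
  ext x
  simp [testToSchwartz_apply]

theorem testToSchwartz_smul {d : ℕ} (c : ℝ) (ψ : Test d) :
    testToSchwartz (c • ψ) = c • testToSchwartz ψ := by
  ext x
  simp [testToSchwartz_apply]

theorem continuous_testToSchwartz_comp {d : ℕ} (K : TopologicalSpace.Compacts (Space d))
    (hK : (K : Set (Space d)) ⊆ (⊤ : TopologicalSpace.Opens (Space d))) :
    Continuous (testToSchwartz ∘ TestFunction.ofSupportedIn (n := ⊤) (F := ℝ) hK) := by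
  let L : 𝓓_{K}(Space d, ℝ) →ₗ[ℝ] 𝓢(Space d, ℂ) :=
    { toFun := testToSchwartz ∘ TestFunction.ofSupportedIn hK
      map_add' := fun f g => by
        ext x
        simp [testToSchwartz_apply]
      map_smul' := fun c f => by
        ext x
        simp [testToSchwartz_apply] }
  change Continuous L
  refine WithSeminorms.continuous_of_isBounded
    (ContDiffMapSupportedIn.withSeminorms ℝ (Space d) ℝ ⊤ K)
    (schwartz_withSeminorms ℝ (Space d) ℂ) L ?_
  rintro ⟨k, n⟩
  obtain ⟨R, hR0, hR⟩ := K.isCompact.isBounded.exists_pos_norm_le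
  refine ⟨{n}, ⟨R ^ k, by positivity⟩, fun f => ?_⟩
  refine SchwartzMap.seminorm_le_bound ℝ k n (L f) ?_ fun x => ?_
  · exact apply_nonneg _ _
  · have h1 : iteratedFDeriv ℝ n (L f) x
        = Complex.ofRealCLM.compContinuousMultilinearMap (iteratedFDeriv ℝ n f x) :=
      ContinuousLinearMap.iteratedFDeriv_comp_left (f := (f : Space d → ℝ)) Complex.ofRealCLM
        f.contDiff.contDiffAt (mod_cast le_top)
    have h2 : ‖iteratedFDeriv ℝ n (L f) x‖ ≤ ‖iteratedFDeriv ℝ n f x‖ := by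
      rw [h1]
      refine (ContinuousLinearMap.norm_compContinuousMultilinearMap_le _ _).trans ?_
      simp
    by_cases hx : x ∈ K
    · simp only [Finset.sup_singleton]
      refine mul_le_mul (pow_le_pow_left₀ (norm_nonneg _) (hR x hx) k) (h2.trans ?_)
        (norm_nonneg _) (pow_nonneg hR0.le k)
      exact ContDiffMapSupportedIn.norm_iteratedFDeriv_apply_le_seminorm_top ℝ
    · have h0 : ‖iteratedFDeriv ℝ n (L f) x‖ ≤ 0 := by
        refine h2.trans ?_
        rw [f.iteratedFDeriv_zero_on_compl hx]
        simp
      have h3 : ‖iteratedFDeriv ℝ n (L f) x‖ = 0 := le_antisymm h0 (norm_nonneg _)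
      rw [h3, mul_zero]
      exact apply_nonneg _ _

/-- The continuous inclusion of the test functions in the Schwartz functions. -/
def testToSchwartzCLM {d : ℕ} : Test d →L[ℝ] 𝓢(Space d, ℂ) :=
  TestFunction.mkCLM ℝ testToSchwartz testToSchwartz_add testToSchwartz_smul
    continuous_testToSchwartz_comp

/-- The restriction map from tempered distributions to distributions. -/
def restrict {d : ℕ} : Tempered d →ₗ[ℂ] Distr d where
  toFun f :=
    { toFun := fun ψ => f (testToSchwartz ψ)
      map_add' := fun a b => by rw [testToSchwartz_add, map_add]
      map_smul' := fun c a => by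
        rw [testToSchwartz_smul, show c • testToSchwartz a = (c : ℂ) • testToSchwartz a by
          ext x; simp, map_smul]
        simp
      cont := (map_continuous f).comp testToSchwartzCLM.continuous }
  map_add' _ _ := rfl
  map_smul' _ _ := rfl

theorem restrict_apply {d : ℕ} (f : Tempered d) (ψ : Test d) :
    restrict f ψ = f (testToSchwartz ψ) := rfl

/-! ### Translation, modulation, short-time Fourier transform -/

/-- The character `t ↦ exp (2πi t·ξ)`. -/
def character {d : ℕ} (ξ : Space d) (t : Space d) : ℂ :=
  Complex.exp (2 * Real.pi * Complex.I * (inner ℝ t ξ : ℝ))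

theorem hasTemperateGrowth_character {d : ℕ} (ξ : Space d) :
    (character ξ).HasTemperateGrowth := by
  have h : (fun x : ℝ => Complex.exp (Complex.I * x)).HasTemperateGrowth := by
    refine ⟨Complex.contDiff_exp.comp (contDiff_const.mul Complex.ofRealCLM.contDiff), fun n => ⟨0, 1, fun x => ?_⟩⟩
    rw [norm_iteratedFDeriv_eq_norm_iteratedDeriv]
    have : iteratedDeriv n (fun x : ℝ => Complex.exp (Complex.I * x))
        = fun x : ℝ => Complex.I ^ n * Complex.exp (Complex.I * x) := by
      induction n with
      | zero => simp
      | succ n ih =>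
        rw [iteratedDeriv_succ, ih]
        ext x
        have h1 : HasDerivAt (fun x : ℝ => Complex.I * (x : ℂ)) Complex.I x := by
          simpa using (Complex.ofRealCLM.hasDerivAt (x := x)).const_mul Complex.I
        have h2 := (h1.cexp).const_mul (Complex.I ^ n)
        rw [h2.deriv]
        ring
    rw [this]
    simp [Complex.norm_exp]
  have h2 : (fun t : Space d => 2 * Real.pi * inner ℝ t ξ).HasTemperateGrowth :=
    (Function.HasTemperateGrowth.const (2 * Real.pi)).mul
      (Function.hasTemperateGrowth_inner_left ξ)
  have h3 := h.comp h2
  convert h3 using 1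
  ext t
  simp only [character, Function.comp]
  congr 1
  push_cast
  ring

/-- The translation `T_x φ = φ(· - x)` on Schwartz functions. -/
def schwartzTranslate {d : ℕ} (x : Space d) : 𝓢(Space d, ℂ) →L[ℂ] 𝓢(Space d, ℂ) :=
  SchwartzMap.compSubConstCLM ℂ x

/-- The modulation `M_ξ φ = exp (2πi (·)·ξ) φ` on Schwartz functions. -/
def schwartzModulate {d : ℕ} (ξ : Space d) : 𝓢(Space d, ℂ) →L[ℂ] 𝓢(Space d, ℂ) :=
  SchwartzMap.smulLeftCLM ℂ (character ξ)

theorem schwartzModulate_apply {d : ℕ} (ξ : Space d) (φ : 𝓢(Space d, ℂ)) (t : Space d) :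
    schwartzModulate ξ φ t = character ξ t * φ t :=
  SchwartzMap.smulLeftCLM_apply_apply (hasTemperateGrowth_character ξ) φ t

/-- The translation `T_x` on tempered distributions: `⟨T_x f, φ⟩ = ⟨f, T_{-x} φ⟩`. -/
def translate {d : ℕ} (x : Space d) : Tempered d →L[ℂ] Tempered d :=
  PointwiseConvergenceCLM.precomp _ (schwartzTranslate (-x))

/-- The modulation `M_ξ` on tempered distributions: `⟨M_ξ f, φ⟩ = ⟨f, M_ξ φ⟩`. -/
def modulate {d : ℕ} (ξ : Space d) : Tempered d →L[ℂ] Tempered d :=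
  PointwiseConvergenceCLM.precomp _ (schwartzModulate ξ)

/-- The complex conjugate of a Schwartz function. -/
def schwartzConj {d : ℕ} (φ : 𝓢(Space d, ℂ)) : 𝓢(Space d, ℂ) :=
  φ.postcompCLM (Complex.conjCLE : ℂ →L[ℝ] ℂ)

theorem schwartzConj_apply {d : ℕ} (φ : 𝓢(Space d, ℂ)) (t : Space d) :
    schwartzConj φ t = (starRingEnd ℂ) (φ t) := rfl

/-- The short-time Fourier transform with window `g`,
`V_g f (x, ξ) = ⟨f, conj (M_ξ T_x g)⟩`, a function on `ℝ^d × ℝ^d`. -/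
def stft {d : ℕ} (g : 𝓢(Space d, ℂ)) (f : Tempered d) (z : Space d × Space d) : ℂ :=
  f (schwartzConj (schwartzModulate z.2 (schwartzTranslate z.1 g)))

/-- The tempered distributions on `ℝ^{2d} = ℝ^d × ℝ^d`. -/
abbrev Tempered2 (d : ℕ) : Type := 𝓢'(Space d × Space d, ℂ)

/-- The tempered distribution `v` on `ℝ^{2d}` is given by the function `h`. -/
def IsGivenBy {d : ℕ} (v : Tempered2 d) (h : Space d × Space d → ℂ) : Prop :=
  ∀ Φ : 𝓢(Space d × Space d, ℂ),
    Integrable (fun z => h z * Φ z) ∧ v Φ = ∫ z, h z * Φ z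

/-- The tensor product `(φ ⊗ ψ)(x, ξ) = φ x * ψ ξ` of two Schwartz functions. -/
def schwartzTensor {d : ℕ} (φ ψ : 𝓢(Space d, ℂ)) : 𝓢(Space d × Space d, ℂ) where
  toFun z := φ z.1 * ψ z.2
  smooth' := ((φ.smooth ⊤).comp contDiff_fst).mul ((ψ.smooth ⊤).comp contDiff_snd)
  decay' k n := by
    choose A hA using fun j => φ.decay k j
    choose A' hA' using fun j => φ.decay 0 j
    choose B hB using fun j => ψ.decay k j
    choose B' hB' using fun j => ψ.decay 0 j
    have hfst : ∀ (j : ℕ) (z : Space d × Space d),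
        ‖iteratedFDeriv ℝ j (fun z : Space d × Space d => φ z.1) z‖
          ≤ ‖iteratedFDeriv ℝ j φ z.1‖ := by
      intro j z
      have h := ContinuousLinearMap.iteratedFDeriv_comp_right
        (ContinuousLinearMap.fst ℝ (Space d) (Space d)) (φ.smooth ⊤) z (i := j)
        (mod_cast le_top)
      change ‖iteratedFDeriv ℝ j (φ ∘ ContinuousLinearMap.fst ℝ (Space d) (Space d)) z‖ ≤ _
      rw [h]
      refine (ContinuousMultilinearMap.norm_compContinuousLinearMap_le _ _).trans ?_
      refine mul_le_of_le_one_right (norm_nonneg _) ?_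
      exact Finset.prod_le_one (fun _ _ => norm_nonneg _)
        (fun _ _ => ContinuousLinearMap.norm_fst_le ℝ _ _)
    have hsnd : ∀ (j : ℕ) (z : Space d × Space d),
        ‖iteratedFDeriv ℝ j (fun z : Space d × Space d => ψ z.2) z‖
          ≤ ‖iteratedFDeriv ℝ j ψ z.2‖ := by
      intro j z
      have h := ContinuousLinearMap.iteratedFDeriv_comp_right
        (ContinuousLinearMap.snd ℝ (Space d) (Space d)) (ψ.smooth ⊤) z (i := j)
        (mod_cast le_top)
      change ‖iteratedFDeriv ℝ j (ψ ∘ ContinuousLinearMap.snd ℝ (Space d) (Space d)) z‖ ≤ _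
      rw [h]
      refine (ContinuousMultilinearMap.norm_compContinuousLinearMap_le _ _).trans ?_
      refine mul_le_of_le_one_right (norm_nonneg _) ?_
      exact Finset.prod_le_one (fun _ _ => norm_nonneg _)
        (fun _ _ => ContinuousLinearMap.norm_snd_le ℝ _ _)
    refine ⟨∑ i ∈ Finset.range (n + 1), (n.choose i : ℝ) *
      (A i * B' (n - i) + A' i * B (n - i)), fun z => ?_⟩
    have h := norm_iteratedFDeriv_mul_le (𝕜 := ℝ) (N := (⊤ : ℕ∞)) (n := n)
      ((φ.smooth ⊤).comp (contDiff_fst (E := Space d) (F := Space d)))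
      ((ψ.smooth ⊤).comp (contDiff_snd (E := Space d) (F := Space d))) z (mod_cast le_top)
    refine (mul_le_mul_of_nonneg_left h (by positivity)).trans ?_
    rw [Finset.mul_sum]
    refine Finset.sum_le_sum fun i _ => ?_
    have hz : ‖z‖ ^ k ≤ ‖z.1‖ ^ k + ‖z.2‖ ^ k := by
      rcases max_choice ‖z.1‖ ‖z.2‖ with h | h
      · rw [Prod.norm_def, h]
        exact le_add_of_nonneg_right (by positivity)
      · rw [Prod.norm_def, h]
        exact le_add_of_nonneg_left (by positivity)
    have a1 := (hA i).2 z.1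
    have a2 := (hA' i).2 z.1
    have b1 := (hB (n - i)).2 z.2
    have b2 := (hB' (n - i)).2 z.2
    simp only [pow_zero, one_mul] at a2 b2
    calc ‖z‖ ^ k * ((n.choose i : ℝ) *
          ‖iteratedFDeriv ℝ i (fun z : Space d × Space d => φ z.1) z‖ *
          ‖iteratedFDeriv ℝ (n - i) (fun z : Space d × Space d => ψ z.2) z‖)
        ≤ (‖z.1‖ ^ k + ‖z.2‖ ^ k) * ((n.choose i : ℝ) *
          ‖iteratedFDeriv ℝ i φ z.1‖ * ‖iteratedFDeriv ℝ (n - i) ψ z.2‖) := by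
          gcongr
          · exact hfst i z
          · exact hsnd (n - i) z
      _ = (n.choose i : ℝ) *
          ((‖z.1‖ ^ k * ‖iteratedFDeriv ℝ i φ z.1‖) * ‖iteratedFDeriv ℝ (n - i) ψ z.2‖
            + ‖iteratedFDeriv ℝ i φ z.1‖ * (‖z.2‖ ^ k * ‖iteratedFDeriv ℝ (n - i) ψ z.2‖)) := by
          ring
      _ ≤ _ := by
          gcongr
          · exact (by positivity : (0 : ℝ) ≤ _).trans a1
          · exact (norm_nonneg _).trans a2

/-! ### Translation-modulation invariant Banach spaces of distributions -/

/-- The norm of the operator that `S` induces on the normed space `E` embedded in the tempered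
distributions by `ι`. -/
def inducedOpNorm {d : ℕ} {E : Type*} [NormedAddCommGroup E] [NormedSpace ℂ E]
    (ι : E →L[ℂ] Tempered d) (S : Tempered d →L[ℂ] Tempered d) : ℝ≥0∞ :=
  ⨅ (C : ℝ≥0) (_ : ∀ e e' : E, ι e' = S (ι e) → ‖e'‖ ≤ C * ‖e‖), (C : ℝ≥0∞)

/-- `ω_E x`, the norm of `T_x` on `E`. -/
def translationNorm {d : ℕ} {E : Type*} [NormedAddCommGroup E] [NormedSpace ℂ E]
    (ι : E →L[ℂ] Tempered d) (x : Space d) : ℝ≥0∞ :=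
  inducedOpNorm ι (translate x)

/-- `ν_E ξ`, the norm of `M_{-ξ}` on `E`. -/
def modulationNorm {d : ℕ} {E : Type*} [NormedAddCommGroup E] [NormedSpace ℂ E]
    (ι : E →L[ℂ] Tempered d) (ξ : Space d) : ℝ≥0∞ :=
  inducedOpNorm ι (modulate (-ξ))

/-- The Banach space `E`, regarded by means of `ι` as a space of tempered distributions, is a
translation-modulation invariant Banach space of distributions (TMIB space). -/
structure IsTMIB {d : ℕ} {E : Type*} [NormedAddCommGroup E] [NormedSpace ℂ E] [CompleteSpace E]
    (ι : E →L[ℂ] Tempered d) : Prop where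
  injective : Function.Injective ι
  denseRange : DenseRange ι
  schwartz : ∃ j : 𝓢(Space d, ℂ) →L[ℂ] E,
    (∀ φ, ι (j φ) = SchwartzMap.toTemperedDistributionCLM (Space d) ℂ volume φ) ∧ DenseRange j
  translate_mem : ∀ (x : Space d) (e : E), ∃ e' : E, ι e' = translate x (ι e)
  modulate_mem : ∀ (ξ : Space d) (e : E), ∃ e' : E, ι e' = modulate ξ (ι e)
  growth : ∃ τ C : ℝ, 0 < τ ∧ 0 < C ∧
    (∀ x : Space d, translationNorm ι x ≤ ENNReal.ofReal (C * (1 + ‖x‖) ^ τ)) ∧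
    (∀ ξ : Space d, modulationNorm ι ξ ≤ ENNReal.ofReal (C * (1 + ‖ξ‖) ^ τ))

/-! ### Extended seminorms

A normed space of distributions is presented by the function that sends a distribution to its norm,
with the value `∞` outside the space. -/

/-- An extended seminorm on a complex vector space. -/
structure ExtSeminorm (X : Type*) [AddCommGroup X] [Module ℂ X] where
  /-- The value of the extended seminorm. -/
  toFun : X → ℝ≥0∞
  map_zero : toFun 0 = 0
  add_le : ∀ x y, toFun (x + y) ≤ toFun x + toFun y
  smul_le : ∀ (c : ℂ) (x : X), toFun (c • x) ≤ ‖c‖ₑ * toFun x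

namespace ExtSeminorm

variable {X Y : Type*} [AddCommGroup X] [Module ℂ X] [AddCommGroup Y] [Module ℂ Y]

/-- Pulling back an extended seminorm along a linear map. -/
def comap (N : ExtSeminorm Y) (L : X →ₗ[ℂ] Y) : ExtSeminorm X where
  toFun x := N.toFun (L x)
  map_zero := by rw [_root_.map_zero, N.map_zero]
  add_le x y := by rw [map_add]; exact N.add_le _ _
  smul_le c x := by rw [map_smul]; exact N.smul_le _ _

/-- The subspace on which an extended seminorm is finite. -/
def carrier (N : ExtSeminorm X) : Submodule ℂ X where
  carrier := {x | N.toFun x < ∞}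
  add_mem' {x y} hx hy := (N.add_le x y).trans_lt (ENNReal.add_lt_top.2 ⟨hx, hy⟩)
  zero_mem' := by simp [N.map_zero]
  smul_mem' c x hx := (N.smul_le c x).trans_lt (ENNReal.mul_lt_top (by simp) hx)

/-- The subspace on which an extended seminorm is finite, as a type of its own, whose topology is
that of the seminorm. -/
def FiniteSpace (N : ExtSeminorm X) : Type _ := N.carrier

instance (N : ExtSeminorm X) : AddCommGroup N.FiniteSpace :=
  inferInstanceAs (AddCommGroup N.carrier)

instance (N : ExtSeminorm X) : Module ℂ N.FiniteSpace :=
  inferInstanceAs (Module ℂ N.carrier)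

/-- The inclusion of the space where the extended seminorm is finite. -/
def incl (N : ExtSeminorm X) : N.FiniteSpace →ₗ[ℂ] X := N.carrier.subtype

theorem lt_top (N : ExtSeminorm X) (x : N.FiniteSpace) : N.toFun (N.incl x) < ∞ := x.2

/-- The real-valued seminorm on the space where the extended seminorm is finite. -/
def seminorm (N : ExtSeminorm X) : Seminorm ℂ N.FiniteSpace :=
  Seminorm.ofSMulLE (fun x => (N.toFun (N.incl x)).toReal)
    (by simp [N.map_zero])
    (fun x y => by
      rw [← ENNReal.toReal_add (N.lt_top x).ne (N.lt_top y).ne, map_add]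
      exact ENNReal.toReal_mono (ENNReal.add_lt_top.2 ⟨N.lt_top x, N.lt_top y⟩).ne (N.add_le _ _))
    (fun c x => by
      rw [map_smul, ← toReal_enorm c, ← ENNReal.toReal_mul]
      exact ENNReal.toReal_mono (ENNReal.mul_lt_top (by simp) (N.lt_top x)).ne (N.smul_le _ _))

instance (N : ExtSeminorm X) : SeminormedAddCommGroup N.FiniteSpace :=
  AddGroupSeminorm.toSeminormedAddCommGroup N.seminorm.toAddGroupSeminorm

instance (N : ExtSeminorm X) : NormedSpace ℂ N.FiniteSpace where
  norm_smul_le c x := (map_smul_eq_mul N.seminorm c x).le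

end ExtSeminorm

/-! ### Weights and amalgam spaces -/

/-- A polynomially bounded weight on `ℝ^d`. -/
structure PolyWeight (d : ℕ) where
  /-- The weight function. -/
  toFun : Space d → ℝ
  measurable : Measurable toFun
  pos : ∀ x, 0 < toFun x
  moderate : ∃ C τ : ℝ, 0 < C ∧ 0 < τ ∧
    ∀ x y, toFun (x + y) ≤ C * toFun x * (1 + ‖y‖) ^ τ

/-- The pointwise product of two polynomially bounded weights. -/
def PolyWeight.mul {d : ℕ} (η₁ η₂ : PolyWeight d) : PolyWeight d where
  toFun x := η₁.toFun x * η₂.toFun x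
  measurable := η₁.measurable.mul η₂.measurable
  pos x := mul_pos (η₁.pos x) (η₂.pos x)
  moderate := by
    obtain ⟨C₁, τ₁, hC₁, hτ₁, h₁⟩ := η₁.moderate
    obtain ⟨C₂, τ₂, hC₂, hτ₂, h₂⟩ := η₂.moderate
    refine ⟨C₁ * C₂, τ₁ + τ₂, by positivity, by positivity, fun x y => ?_⟩
    have hy : 0 < 1 + ‖y‖ := by positivity
    rw [Real.rpow_add hy]
    calc η₁.toFun (x + y) * η₂.toFun (x + y)
        ≤ (C₁ * η₁.toFun x * (1 + ‖y‖) ^ τ₁) * (C₂ * η₂.toFun x * (1 + ‖y‖) ^ τ₂) :=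
          mul_le_mul (h₁ x y) (h₂ x y) (η₂.pos _).le ((η₁.pos _).le.trans (h₁ x y))
      _ = _ := by ring

/-- The point of the lattice `ℤ^d` in `ℝ^d` with the given coordinates. -/
def latticePoint {d : ℕ} (k : Fin d → ℤ) : Space d := WithLp.toLp 2 (fun i => (k i : ℝ))

/-- A test function `φ` with `0 ≤ φ ≤ 1` and support in `(-1, 1)^d`, whose translates
`φ_k = T_k φ`, `k ∈ ℤ^d`, are a partition of unity. -/
structure UnityGenerator (d : ℕ) where
  /-- The test function. -/
  toTest : Test d
  nonneg : ∀ x, 0 ≤ toTest x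
  le_one : ∀ x, toTest x ≤ 1
  tsupport_subset : tsupport toTest ⊆ {x | ∀ i, x i ∈ Set.Ioo (-1 : ℝ) 1}
  hasSum : ∀ x, HasSum (fun k : Fin d → ℤ => toTest (x - latticePoint k)) 1

/-- The element `e` of `E` is the product `χ T` of the test function `χ` and the distribution
`T`. -/
def IsProduct {d : ℕ} {E : Type*} [NormedAddCommGroup E] [NormedSpace ℂ E]
    (ι : E →L[ℂ] Tempered d) (χ : Test d) (T : Distr d) (e : E) : Prop :=
  ∀ ψ : Test d, restrict (ι e) ψ = T (testMul χ ψ)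

/-- `E_loc`: the distributions `T` with `χ T ∈ E` for all test functions `χ`. -/
def MemLoc {d : ℕ} {E : Type*} [NormedAddCommGroup E] [NormedSpace ℂ E]
    (ι : E →L[ℂ] Tempered d) (T : Distr d) : Prop :=
  ∀ χ : Test d, ∃ e : E, IsProduct ι χ T e

/-- The norm of `χ T` in `E` (and `∞` if `χ T` is not in `E`). -/
def localNorm {d : ℕ} {E : Type*} [NormedAddCommGroup E] [NormedSpace ℂ E]
    (ι : E →L[ℂ] Tempered d) (χ : Test d) (T : Distr d) : ℝ≥0∞ :=
  ⨅ (e : E) (_ : IsProduct ι χ T e), ‖e‖ₑ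

/-- The cube `k + [-1, 1]^d`. -/
def cube {d : ℕ} (k : Fin d → ℤ) : Set (Space d) :=
  {t | ∀ i, (t - latticePoint k) i ∈ Set.Icc (-1 : ℝ) 1}

/-- The function `∑_k ‖T φ_k‖_E θ_{k + [-1, 1]^d}`, multiplied by the weight `η`. -/
def amalgamFun {d : ℕ} {E : Type*} [NormedAddCommGroup E] [NormedSpace ℂ E]
    (ι : E →L[ℂ] Tempered d) (φ : UnityGenerator d) (η : PolyWeight d) (T : Distr d)
    (t : Space d) : ℝ≥0∞ :=
  (∑' k : Fin d → ℤ,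
    (cube k).indicator (fun _ => localNorm ι (testTranslate (latticePoint k) φ.toTest) T) t) *
    ENNReal.ofReal (η.toFun t)

/-- The global components `L^p`, `1 ≤ p ≤ ∞`, and `L^∞_0` of amalgam spaces. -/
inductive GlobalComponent : Type
  /-- The global component `L^p`. -/
  | lp (p : ℝ≥0∞) (hp : 1 ≤ p) : GlobalComponent
  /-- The global component `L^∞_0`. -/
  | linftyZero : GlobalComponent

/-- The exponent of a global component. -/
def GlobalComponent.exponent : GlobalComponent → ℝ≥0∞
  | lp p _ => p
  | linftyZero => ∞

/-- The condition beyond finiteness of the norm for a function to belong to the global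
component: for `L^∞_0` this is vanishing at infinity. -/
def GlobalComponent.Cond {d : ℕ} : GlobalComponent → (Space d → ℝ≥0∞) → Prop
  | lp _ _, _ => True
  | linftyZero, h => ∀ ε : ℝ≥0∞, 0 < ε → ∃ K : Set (Space d), IsCompact K ∧
      eLpNorm h ∞ (volume.restrict Kᶜ) ≤ ε

theorem GlobalComponent.one_le_exponent (G : GlobalComponent) : 1 ≤ G.exponent := by
  cases G with
  | lp p hp => exact hp
  | linftyZero => exact le_top

/-- Membership in `W(E, L^p_η)` or `W(E, L^∞_{η,0})`, up to finiteness of the norm. -/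
def AmalgamCond {d : ℕ} {E : Type*} [NormedAddCommGroup E] [NormedSpace ℂ E]
    (ι : E →L[ℂ] Tempered d) (φ : UnityGenerator d) (η : PolyWeight d) (G : GlobalComponent)
    (T : Distr d) : Prop :=
  MemLoc ι T ∧ G.Cond (amalgamFun ι φ η T)

section amalgam

variable {d : ℕ} {E : Type*} [NormedAddCommGroup E] [NormedSpace ℂ E]
  (ι : E →L[ℂ] Tempered d) (φ : UnityGenerator d) (η : PolyWeight d) (G : GlobalComponent)

theorem measurableSet_cube (k : Fin d → ℤ) : MeasurableSet (cube k) := by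
  have : cube k = ⋂ i, (fun t : Space d => (t - latticePoint k) i) ⁻¹' Set.Icc (-1 : ℝ) 1 := by
    ext t
    simp [cube]
  rw [this]
  refine MeasurableSet.iInter fun i => measurableSet_Icc.preimage (Continuous.measurable ?_)
  fun_prop

theorem measurable_amalgamFun (T : Distr d) : Measurable (amalgamFun ι φ η T) := by
  refine Measurable.mul (Measurable.tsum fun k => ?_) η.measurable.ennreal_ofReal
  exact measurable_const.indicator (measurableSet_cube k)

theorem IsProduct.add {χ : Test d} {T S : Distr d} {e f : E}
    (he : IsProduct ι χ T e) (hf : IsProduct ι χ S f) : IsProduct ι χ (T + S) (e + f) := by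
  intro ψ
  rw [map_add, map_add]
  exact congrArg₂ (· + ·) (he ψ) (hf ψ)

theorem IsProduct.smul {χ : Test d} {T : Distr d} {e : E} (c : ℂ)
    (he : IsProduct ι χ T e) : IsProduct ι χ (c • T) (c • e) := by
  intro ψ
  rw [map_smul, map_smul]
  exact congrArg (c • ·) (he ψ)

theorem isProduct_zero (χ : Test d) : IsProduct ι χ (0 : Distr d) (0 : E) := by
  intro ψ
  rw [map_zero, map_zero]
  rfl

theorem localNorm_zero (χ : Test d) : localNorm ι χ (0 : Distr d) = 0 := by
  refine le_antisymm ((iInf₂_le (0 : E) (isProduct_zero ι χ)).trans ?_) bot_le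
  simp

theorem localNorm_add_le (χ : Test d) (T S : Distr d) :
    localNorm ι χ (T + S) ≤ localNorm ι χ T + localNorm ι χ S := by
  unfold localNorm
  refine ENNReal.le_iInf_add_iInf fun e f => ENNReal.le_iInf_add_iInf fun he hf => ?_
  exact (iInf₂_le (e + f) (he.add ι hf)).trans (enorm_add_le e f)

theorem localNorm_smul_le (χ : Test d) (c : ℂ) (T : Distr d) :
    localNorm ι χ (c • T) ≤ ‖c‖ₑ * localNorm ι χ T := by
  by_cases hc : c = 0
  · have h : c • T = 0 := by
      rw [hc]
      exact zero_smul ℂ T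
    rw [h, localNorm_zero]
    exact bot_le
  have h0 : ‖c‖ₑ ≠ 0 := by simpa using hc
  unfold localNorm
  rw [ENNReal.mul_iInf_of_ne h0 (by simp)]
  refine le_iInf fun e => ?_
  rw [ENNReal.mul_iInf_of_ne h0 (by simp)]
  refine le_iInf fun he => ?_
  exact (iInf₂_le (c • e) (he.smul ι c)).trans (enorm_smul c e).le

theorem amalgamFun_zero : amalgamFun ι φ η (0 : Distr d) = 0 := by
  ext t
  simp [amalgamFun, localNorm_zero]

theorem amalgamFun_add_le (T S : Distr d) (t : Space d) :
    amalgamFun ι φ η (T + S) t ≤ amalgamFun ι φ η T t + amalgamFun ι φ η S t := by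
  unfold amalgamFun
  rw [← add_mul, ← ENNReal.tsum_add]
  gcongr with k
  by_cases ht : t ∈ cube k
  · simpa [ht] using localNorm_add_le ι _ T S
  · simp [ht]

theorem amalgamFun_smul_le (c : ℂ) (T : Distr d) (t : Space d) :
    amalgamFun ι φ η (c • T) t ≤ ‖c‖ₑ * amalgamFun ι φ η T t := by
  unfold amalgamFun
  rw [← mul_assoc, ← ENNReal.tsum_mul_left]
  gcongr with k
  by_cases ht : t ∈ cube k
  · simpa [ht] using localNorm_smul_le ι _ c T
  · simp [ht]

theorem eLpNorm_amalgamFun_add_le (p : ℝ≥0∞) (hp : 1 ≤ p) (μ : Measure (Space d))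
    (T S : Distr d) : eLpNorm (amalgamFun ι φ η (T + S)) p μ
      ≤ eLpNorm (amalgamFun ι φ η T) p μ + eLpNorm (amalgamFun ι φ η S) p μ :=
  (eLpNorm_mono_enorm fun t => amalgamFun_add_le ι φ η T S t).trans
    (eLpNorm_add_le (measurable_amalgamFun ι φ η T).aestronglyMeasurable
      (measurable_amalgamFun ι φ η S).aestronglyMeasurable hp)

theorem eLpNorm_amalgamFun_smul_le (p : ℝ≥0∞) (μ : Measure (Space d)) (c : ℂ) (T : Distr d) :
    eLpNorm (amalgamFun ι φ η (c • T)) p μ ≤ ‖c‖ₑ * eLpNorm (amalgamFun ι φ η T) p μ := by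
  have h := eLpNorm_le_nnreal_smul_eLpNorm_of_ae_le_mul' (c := ‖c‖₊) (μ := μ)
    (f := amalgamFun ι φ η (c • T)) (g := amalgamFun ι φ η T)
    (Eventually.of_forall fun t => amalgamFun_smul_le ι φ η c T t) p
  exact h

theorem amalgamCond_zero : AmalgamCond ι φ η G (0 : Distr d) := by
  refine ⟨fun χ => ⟨0, isProduct_zero ι χ⟩, ?_⟩
  cases G with
  | lp p hp => trivial
  | linftyZero =>
    intro ε _
    refine ⟨∅, isCompact_empty, ?_⟩
    rw [amalgamFun_zero]
    simp

theorem AmalgamCond.add {T S : Distr d} (hT : AmalgamCond ι φ η G T)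
    (hS : AmalgamCond ι φ η G S) : AmalgamCond ι φ η G (T + S) := by
  refine ⟨fun χ => ?_, ?_⟩
  · obtain ⟨e, he⟩ := hT.1 χ
    obtain ⟨f, hf⟩ := hS.1 χ
    exact ⟨e + f, he.add ι hf⟩
  · cases G with
    | lp p hp => trivial
    | linftyZero =>
      intro ε hε
      obtain ⟨K, hK, h1⟩ := hT.2 (ε / 2) (ENNReal.half_pos hε.ne')
      obtain ⟨L, hL, h2⟩ := hS.2 (ε / 2) (ENNReal.half_pos hε.ne')
      refine ⟨K ∪ L, hK.union hL, ?_⟩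
      refine (eLpNorm_amalgamFun_add_le ι φ η _ le_top _ T S).trans ?_
      rw [← ENNReal.add_halves ε]
      refine add_le_add ((eLpNorm_mono_measure _ ?_).trans h1)
        ((eLpNorm_mono_measure _ ?_).trans h2)
      · exact Measure.restrict_mono (Set.compl_subset_compl.2 Set.subset_union_left) le_rfl
      · exact Measure.restrict_mono (Set.compl_subset_compl.2 Set.subset_union_right) le_rfl

theorem AmalgamCond.smul {T : Distr d} (c : ℂ) (hT : AmalgamCond ι φ η G T) :
    AmalgamCond ι φ η G (c • T) := by
  refine ⟨fun χ => ?_, ?_⟩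
  · obtain ⟨e, he⟩ := hT.1 χ
    exact ⟨c • e, he.smul ι c⟩
  · cases G with
    | lp p hp => trivial
    | linftyZero =>
      intro ε hε
      obtain ⟨K, hK, h⟩ := hT.2 (ε / ‖c‖ₑ) (ENNReal.div_pos hε.ne' (by simp))
      refine ⟨K, hK, (eLpNorm_amalgamFun_smul_le ι φ η _ _ c T).trans ?_⟩
      exact (mul_le_mul_right h _).trans ENNReal.mul_div_le

end amalgam

/-- The amalgam space `W(E, L^p_η)` or `W(E, L^∞_{η,0})`, given by its norm. It is a space of
distributions (not assumed to be tempered). -/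
def amalgam {d : ℕ} {E : Type*} [NormedAddCommGroup E] [NormedSpace ℂ E]
    (ι : E →L[ℂ] Tempered d) (φ : UnityGenerator d) (η : PolyWeight d) (G : GlobalComponent) :
    ExtSeminorm (Distr d) where
  toFun T := ⨅ _ : AmalgamCond ι φ η G T, eLpNorm (amalgamFun ι φ η T) G.exponent volume
  map_zero := by
    refine le_antisymm ((iInf_le _ (amalgamCond_zero ι φ η G)).trans ?_) bot_le
    rw [amalgamFun_zero]
    simp
  add_le T S := by
    refine ENNReal.le_iInf_add_iInf fun hT hS => ?_
    exact (iInf_le _ (hT.add ι φ η G hS)).trans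
      (eLpNorm_amalgamFun_add_le ι φ η _ G.one_le_exponent _ T S)
  smul_le c T := by
    by_cases hc : c = 0
    · have h : c • T = 0 := by
        rw [hc]
        exact zero_smul ℂ T
      rw [h]
      refine (iInf_le _ (amalgamCond_zero ι φ η G)).trans ?_
      rw [amalgamFun_zero]
      simp
    · rw [ENNReal.mul_iInf_of_ne (by simpa using hc) (by simp)]
      refine le_iInf fun hT => ?_
      exact (iInf_le _ (hT.smul ι φ η G c)).trans (eLpNorm_amalgamFun_smul_le ι φ η _ _ c T)

/-- The amalgam space, as a space of tempered distributions. -/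
def temperedAmalgam {d : ℕ} {E : Type*} [NormedAddCommGroup E] [NormedSpace ℂ E]
    (ι : E →L[ℂ] Tempered d) (φ : UnityGenerator d) (η : PolyWeight d) (G : GlobalComponent) :
    ExtSeminorm (Tempered d) :=
  (amalgam ι φ η G).comap restrict

/-- The Fourier image `𝓕 A = {𝓕 f | f ∈ A}` with `‖𝓕 f‖ = ‖f‖`: the norm of `f` in `𝓕 A` is that
of `𝓕⁻ f` in `A`. -/
def fourierImage {d : ℕ} (A : ExtSeminorm (Tempered d)) : ExtSeminorm (Tempered d) :=
  A.comap (FourierTransform.fourierInvₗ ℂ (Tempered d))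

/-! ### Completed projective tensor products and modulation spaces -/

/-- The algebraic tensor product of the two spaces `A 0` and `A 1`, with the projective seminorm,
which is Mathlib's norm on `PiTensorProduct`. -/
abbrev AlgTensor {d : ℕ} (A : Fin 2 → ExtSeminorm (Tempered d)) : Type :=
  ⨂[ℂ] i, (A i).FiniteSpace

/-- The completed projective tensor product of `A 0` and `A 1`. -/
abbrev ProjTensor {d : ℕ} (A : Fin 2 → ExtSeminorm (Tempered d)) : Type :=
  UniformSpace.Completion (AlgTensor A)

/-- The pairing of `a ⊗ b` with `φ ⊗ ψ`, that is `⟨a, φ⟩ ⟨b, ψ⟩`. -/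
def tensorPairing {d : ℕ} (A : Fin 2 → ExtSeminorm (Tempered d))
    (φ : Fin 2 → 𝓢(Space d, ℂ)) : AlgTensor A →ₗ[ℂ] ℂ :=
  PiTensorProduct.lift ((MultilinearMap.mkPiAlgebra ℂ (Fin 2) ℂ).compLinearMap fun i =>
    (PointwiseConvergenceCLM.evalCLM (RingHom.id ℂ) ℂ (φ i)).toLinearMap ∘ₗ (A i).incl)

/-- The element `u` of the completed projective tensor product is sent to the tempered
distribution `v` by the canonical map `A 0 ⊗̂ A 1 → 𝓢'(ℝ^{2d})`, the continuous extension of the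
map that sends `a ⊗ b` to the tensor product of the distributions `a` and `b`. -/
def Represents {d : ℕ} (A : Fin 2 → ExtSeminorm (Tempered d)) (u : ProjTensor A)
    (v : Tempered2 d) : Prop :=
  ∃ w : ℕ → AlgTensor A,
    Tendsto (fun n => (w n : ProjTensor A)) atTop (𝓝 u) ∧
    ∀ φ : Fin 2 → 𝓢(Space d, ℂ),
      Tendsto (fun n => tensorPairing A φ (w n)) atTop (𝓝 (v (schwartzTensor (φ 0) (φ 1))))

/-- The norm of the completed projective tensor product of `A` and `B`, regarded as a space of
tempered distributions on `ℝ^{2d}` by means of the canonical map, with the value `∞` outside of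
that space. (The canonical map is injective for the spaces considered here, so that the infimum is
over at most one element.) -/
def projTensorNorm {d : ℕ} (A B : ExtSeminorm (Tempered d)) (v : Tempered2 d) : ℝ≥0∞ :=
  ⨅ (u : ProjTensor ![A, B]) (_ : Represents ![A, B] u v), ‖u‖ₑ

/-- The norm `‖f‖ = ‖V_g f‖_X` of the modulation space `M[X] = {f ∈ 𝓢' | V_g f ∈ X}` associated
to the space `X` of tempered distributions on `ℝ^{2d}` (given by its norm). -/
def modulationSpaceNorm {d : ℕ} (g : 𝓢(Space d, ℂ)) (X : Tempered2 d → ℝ≥0∞)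
    (f : Tempered d) : ℝ≥0∞ :=
  ⨅ (v : Tempered2 d) (_ : IsGivenBy v (stft g f)), X v

/-- The space of distributions with norm `N` and the space of tempered distributions with norm `M`
are equal, with equivalent norms: the distributions in the former are exactly the restrictions of
the tempered distributions in the latter, and the norms bound each other up to a constant. -/
def EqualWithEquivalentNorms {d : ℕ} (N : ExtSeminorm (Distr d)) (M : Tempered d → ℝ≥0∞) : Prop :=
  (∀ T : Distr d, N.toFun T < ∞ ↔ ∃ f : Tempered d, restrict f = T ∧ M f < ∞) ∧
  ∃ C : ℝ≥0, 0 < C ∧ ∀ f : Tempered d,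
    N.toFun (restrict f) ≤ C * M f ∧ M f ≤ C * N.toFun (restrict f)

end

end AmalgamMod

open AmalgamMod

/-! Let `w` be the conjugate of the window `g`, `L` the period and `ζ_n` the frequencies `freq n`.
The proof rests on one separation of variables. On a ball containing the cube `[-1, 1]^d`, the
convolution of a Schwartz function with `θ` agrees with its product with a cutoff, which has a
Fourier series. For `t` in that cube this gives `∫ w(t - x) θ(x) dx = L^{-d} ∑_n ⟨c_n, θ⟩ exp(2πi
t·ζ_n)`, where the Schwartz functions `c_n = coef w ζ_n` do not depend on `θ` and decay rapidly in
`n` (`hasSum_coef`, `exists_coef_decay`). Combined with the partition of unity `φ_k` and the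
identity `⟨V_g f, θ ⊗ ψ⟩ = ⟨f, (w * θ) 𝓕ψ⟩` (`isGivenBy_stft_apply_tensor`), it turns phase space
integrals into double series over `k` and `n`.

Amalgam space into modulation space: `V_g f = L^{-d} ∑_{k,n} exp(-2πi k·ζ_n) T_k c_n ⊗ 𝓕(M_{ζ_n}(φ_k
f))`. Translations on `F` have norm at most one, so `T_k c_n` has norm `O(η₁(k))` in `W(F, ·)` for
every global component. The second factor is localized near `k` and has norm `O(η₂(k) ‖φ_k f‖_E)` up
to a power of `1 + |ζ_n|`, which the decay of `c_n` absorbs. Hence the projective norm is at most a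
multiple of `∑_k η₁(k) η₂(k) ‖φ_k f‖_E`, a discrete form of the norm of `W(E, L^1_{η₁η₂})`. No
relation between the exponents is needed here (`exists_elementary_tensors`,
`exists_modulationSpaceNorm_le_amalgam`).

Modulation space into amalgam space: choose `γ` with `∫ γ w = 1` and let now `c_n = coef γ ζ_n`. The
same expansion yields a reproducing formula that recovers `φ_k f` from the pairings of `V_g f` with
`T_k c_n ⊗ 𝓕⁻(φ_k M_{ζ_n} θ)` (`hasSum_reproducing`). With `a ⊗ b` in place of `V_g f` it defines
bilinear maps `(a, b) ↦ L^{-d} ∑_n exp(-2πi k·ζ_n) ⟨a, T_k c_n⟩ M_{ζ_n}(φ_k 𝓕⁻b)` with values in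
`E`. By the uniform bound on translations of `F`, `η₁(k) |⟨a, T_k c_n⟩|` is controlled by the
convolution of `η₁(j) ‖φ_j a‖_F` with a summable sequence. Young's and Hölder's inequalities, under
`1/p₁ + 1/p₂ ≥ 1`, then bound the weighted `ℓ^1` sum of the values by `‖a‖ ‖b‖`
(`exists_reconstruction`). The universal property of the projective norm and a limit carry this to
the completion (`exists_cells_of_represents`). The estimate holds for every `u` representing `V_g
f`, so injectivity of the canonical map plays no role.

Global components enter only through sequences: an `L^p` component bounds the `ℓ^p` norm of the
cells, and an `ℓ^1` bound on the cells bounds every amalgam norm and gives the vanishing condition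
of `L^∞_0`. Finally, every element of an amalgam space is tempered (`exists_restrict_eq`). -/

namespace AmalgamMod

noncomputable section

/-! ### An increasing sequence of norms on the Schwartz space -/

section SchwartzNorms

variable {d : ℕ}

/-- The maximum of the Schwartz seminorms of indices at most `N`. -/
def snorm (N : ℕ) : Seminorm ℂ 𝓢(Space d, ℂ) :=
  (Finset.Iic (N, N)).sup (schwartzSeminormFamily ℂ (Space d) ℂ)

theorem one_add_norm_pow_mul_le_snorm {N k n : ℕ} (hk : k ≤ N) (hn : n ≤ N) (θ : 𝓢(Space d, ℂ))
    (x : Space d) :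
    (1 + ‖x‖) ^ k * ‖iteratedFDeriv ℝ n θ x‖ ≤ 2 ^ N * snorm N θ :=
  SchwartzMap.one_add_le_sup_seminorm_apply (𝕜 := ℂ) (m := (N, N)) hk hn θ x

theorem snorm_le_of_forall {N : ℕ} {θ : 𝓢(Space d, ℂ)} {B : ℝ}
    (h : ∀ n ≤ N, ∀ x, (1 + ‖x‖) ^ N * ‖iteratedFDeriv ℝ n θ x‖ ≤ B) : snorm N θ ≤ B := by
  have hB : 0 ≤ B := le_trans (by positivity) (h 0 (Nat.zero_le _) 0)
  refine Seminorm.finset_sup_apply_le hB fun i hi => ?_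
  obtain ⟨h1, h2⟩ : i.1 ≤ N ∧ i.2 ≤ N := by simpa [Prod.le_def] using hi
  refine SchwartzMap.seminorm_le_bound ℂ i.1 i.2 θ hB fun x => ?_
  refine le_trans ?_ (h i.2 h2 x)
  gcongr
  calc ‖x‖ ^ i.1 ≤ (1 + ‖x‖) ^ i.1 := by gcongr; linarith
    _ ≤ (1 + ‖x‖) ^ N := pow_le_pow_right₀ (by linarith [norm_nonneg x]) h1

theorem snorm_mono {M N : ℕ} (h : M ≤ N) (θ : 𝓢(Space d, ℂ)) : snorm M θ ≤ snorm N θ :=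
  Seminorm.le_def.1 (Finset.sup_mono (Finset.Iic_subset_Iic.2 (Prod.mk_le_mk.2 ⟨h, h⟩))) θ

theorem continuous_snorm (N : ℕ) : Continuous (snorm (d := d) N) := by
  refine Finset.sup_induction (p := fun q : Seminorm ℂ 𝓢(Space d, ℂ) => Continuous q)
    continuous_zero (fun a ha b hb => ?_)
    fun i _ => (schwartz_withSeminorms ℂ (Space d) ℂ).continuous_seminorm i
  rw [Seminorm.coe_sup]
  exact ha.sup hb

/-- A continuous seminorm on the Schwartz space is dominated by one of the norms `snorm N`. -/
theorem exists_le_snorm (q : Seminorm ℂ 𝓢(Space d, ℂ)) (hq : Continuous q) :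
    ∃ (N : ℕ) (C : ℝ), 0 < C ∧ ∀ θ, q θ ≤ C * snorm N θ := by
  obtain ⟨s, C, hC, h⟩ := Seminorm.bound_of_continuous (schwartz_withSeminorms ℂ (Space d) ℂ) q hq
  obtain ⟨N, hN⟩ : ∃ N : ℕ, s ⊆ Finset.Iic (N, N) := by
    refine ⟨s.sup (fun i => max i.1 i.2), fun i hi => ?_⟩
    have := Finset.le_sup (f := fun i : ℕ × ℕ => max i.1 i.2) hi
    simp only [Finset.mem_Iic, Prod.le_def]
    exact ⟨(le_max_left _ _).trans this, (le_max_right _ _).trans this⟩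
  refine ⟨N, C, NNReal.coe_pos.2 (pos_iff_ne_zero.2 hC), fun θ => (Seminorm.le_def.1 h θ).trans ?_⟩
  exact mul_le_mul_of_nonneg_left (Seminorm.le_def.1 (Finset.sup_mono hN) θ) C.2

theorem exists_norm_le_snorm {E : Type*} [SeminormedAddCommGroup E] [NormedSpace ℂ E]
    (L : 𝓢(Space d, ℂ) →L[ℂ] E) : ∃ (N : ℕ) (C : ℝ), 0 < C ∧ ∀ θ, ‖L θ‖ ≤ C * snorm N θ :=
  exists_le_snorm ((normSeminorm ℂ E).comp L.toLinearMap) (L.continuous.norm)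

theorem exists_norm_apply_le_snorm (f : Tempered d) :
    ∃ (N : ℕ) (C : ℝ), 0 < C ∧ ∀ θ, ‖f θ‖ ≤ C * snorm N θ :=
  exists_norm_le_snorm (E := ℂ) ⟨f.toLinearMap, map_continuous f⟩

theorem exists_snorm_clm_le (L : 𝓢(Space d, ℂ) →L[ℂ] 𝓢(Space d, ℂ)) (M : ℕ) :
    ∃ (N : ℕ) (C : ℝ), 0 < C ∧ ∀ θ, snorm M (L θ) ≤ C * snorm N θ :=
  exists_le_snorm ((snorm M).comp L.toLinearMap) ((continuous_snorm M).comp L.continuous)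

theorem continuous_of_snorm {Z : Type*} [TopologicalSpace Z] {K : Z → 𝓢(Space d, ℂ)}
    (h : ∀ N z, Tendsto (fun w => snorm N (K w - K z)) (𝓝 z) (𝓝 0)) : Continuous K := by
  refine continuous_iff_continuousAt.2 fun z => ?_
  refine ((schwartz_withSeminorms ℂ (Space d) ℂ).tendsto_nhds _ _).2 fun i ε hε => ?_
  filter_upwards [(h (max i.1 i.2) z).eventually_lt_const hε] with w hw
  refine lt_of_le_of_lt ?_ hw
  exact Seminorm.le_def.1 (Finset.le_sup (f := schwartzSeminormFamily ℂ (Space d) ℂ)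
    (Finset.mem_Iic.2 (Prod.le_def.2 ⟨le_max_left _ _, le_max_right _ _⟩))) _

theorem norm_apply_le_snorm (θ : 𝓢(Space d, ℂ)) (x : Space d) (N : ℕ) :
    (1 + ‖x‖) ^ N * ‖θ x‖ ≤ 2 ^ N * snorm N θ := by
  simpa using one_add_norm_pow_mul_le_snorm (le_refl N) (Nat.zero_le N) θ x

theorem one_add_norm_add_le (x y : Space d) : 1 + ‖x + y‖ ≤ (1 + ‖x‖) * (1 + ‖y‖) := by
  nlinarith [norm_add_le x y, norm_nonneg x, norm_nonneg y,
    mul_nonneg (norm_nonneg x) (norm_nonneg y)]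

theorem schwartzTranslate_apply (y : Space d) (θ : 𝓢(Space d, ℂ)) (x : Space d) :
    schwartzTranslate y θ x = θ (x - y) := rfl

theorem iteratedFDeriv_schwartzTranslate (y : Space d) (θ : 𝓢(Space d, ℂ)) (n : ℕ)
    (x : Space d) :
    iteratedFDeriv ℝ n (schwartzTranslate y θ) x = iteratedFDeriv ℝ n θ (x - y) := by
  change iteratedFDeriv ℝ n (fun z => θ (z - y)) x = _
  rw [iteratedFDeriv_comp_sub]

/-- Peetre's inequality `1 + |x| ≤ (1 + |y|)(1 + |x - y|)` moves the weight onto the translated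
function. -/
theorem snorm_schwartzTranslate_le (N : ℕ) (y : Space d) (θ : 𝓢(Space d, ℂ)) :
    snorm N (schwartzTranslate y θ) ≤ 2 ^ N * (1 + ‖y‖) ^ N * snorm N θ := by
  refine snorm_le_of_forall fun n hn x => ?_
  rw [iteratedFDeriv_schwartzTranslate]
  have h1 : 1 + ‖x‖ ≤ (1 + ‖y‖) * (1 + ‖x - y‖) := by
    simpa using one_add_norm_add_le y (x - y)
  calc (1 + ‖x‖) ^ N * ‖iteratedFDeriv ℝ n θ (x - y)‖
      ≤ ((1 + ‖y‖) * (1 + ‖x - y‖)) ^ N * ‖iteratedFDeriv ℝ n θ (x - y)‖ := by gcongr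
    _ = (1 + ‖y‖) ^ N * ((1 + ‖x - y‖) ^ N * ‖iteratedFDeriv ℝ n θ (x - y)‖) := by
        rw [mul_pow]; ring
    _ ≤ (1 + ‖y‖) ^ N * (2 ^ N * snorm N θ) :=
        mul_le_mul_of_nonneg_left (one_add_norm_pow_mul_le_snorm le_rfl hn θ _) (by positivity)
    _ = _ := by ring

/-- The product of two Schwartz functions. -/
def schwartzMul (a θ : 𝓢(Space d, ℂ)) : 𝓢(Space d, ℂ) := SchwartzMap.smulLeftCLM ℂ a θ

theorem schwartzMul_apply (a θ : 𝓢(Space d, ℂ)) (x : Space d) : schwartzMul a θ x = a x * θ x :=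
  SchwartzMap.smulLeftCLM_apply_apply a.hasTemperateGrowth θ x

/-- Two Schwartz functions drifting apart have a rapidly small product: `1 + |y| ≤ (1 + |x|)(1 + |x
- y|)` charges each power of `1 + |y|` to the decay of both factors. This is the source of all
off-diagonal decay, between cells as well as in the Fourier coefficients. -/
theorem snorm_schwartzMul_translate_le (N K : ℕ) (a θ : 𝓢(Space d, ℂ)) (y : Space d) :
    (1 + ‖y‖) ^ K * snorm N (schwartzMul a (schwartzTranslate y θ)) ≤
      2 ^ N * 4 ^ (N + K) * snorm (N + K) a * snorm (N + K) θ := by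
  have hy : 0 < (1 + ‖y‖) ^ K := by positivity
  rw [mul_comm, ← le_div_iff₀ hy]
  refine snorm_le_of_forall fun n hn x => ?_
  rw [le_div_iff₀ hy]
  have hL := norm_iteratedFDeriv_mul_le (𝕜 := ℝ) (N := (⊤ : ℕ∞)) (n := n) (a.smooth ⊤)
    ((schwartzTranslate y θ).smooth ⊤) x (mod_cast le_top)
  have hfun : (schwartzMul a (schwartzTranslate y θ) : Space d → ℂ)
      = fun x => a x * schwartzTranslate y θ x := by
    ext x; exact schwartzMul_apply _ _ _
  rw [hfun]
  have h1 : 1 + ‖y‖ ≤ (1 + ‖x‖) * (1 + ‖x - y‖) := by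
    have := one_add_norm_add_le x (y - x)
    rwa [add_sub_cancel, norm_sub_rev] at this
  set A := snorm (N + K) a with hA
  set B := snorm (N + K) θ with hB
  have hA0 : 0 ≤ A := apply_nonneg _ _
  have hB0 : 0 ≤ B := apply_nonneg _ _
  calc (1 + ‖x‖) ^ N * ‖iteratedFDeriv ℝ n (fun x => a x * schwartzTranslate y θ x) x‖
        * (1 + ‖y‖) ^ K
      ≤ (1 + ‖x‖) ^ N * (∑ i ∈ Finset.range (n + 1), (n.choose i : ℝ) *
          ‖iteratedFDeriv ℝ i a x‖ * ‖iteratedFDeriv ℝ (n - i) θ (x - y)‖)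
        * ((1 + ‖x‖) * (1 + ‖x - y‖)) ^ K := by
        gcongr
        simpa only [iteratedFDeriv_schwartzTranslate] using hL
    _ = ∑ i ∈ Finset.range (n + 1), (n.choose i : ℝ) *
          (((1 + ‖x‖) ^ (N + K) * ‖iteratedFDeriv ℝ i a x‖) *
          ((1 + ‖x - y‖) ^ K * ‖iteratedFDeriv ℝ (n - i) θ (x - y)‖)) := by
        rw [Finset.mul_sum, Finset.sum_mul]
        refine Finset.sum_congr rfl fun i _ => ?_
        rw [mul_pow, pow_add]
        ring
    _ ≤ ∑ i ∈ Finset.range (n + 1), (n.choose i : ℝ) *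
          ((2 ^ (N + K) * A) * (2 ^ (N + K) * B)) := by
        refine Finset.sum_le_sum fun i hi => ?_
        have hi' : i ≤ n := by simpa [Nat.lt_succ_iff] using hi
        refine mul_le_mul_of_nonneg_left (mul_le_mul
          (one_add_norm_pow_mul_le_snorm le_rfl (by omega) a x)
          (one_add_norm_pow_mul_le_snorm (by omega) (by omega) θ (x - y))
          (by positivity) (by positivity)) (by positivity)
    _ = 2 ^ n * 4 ^ (N + K) * A * B := by
        rw [← Finset.sum_mul]
        have : (∑ i ∈ Finset.range (n + 1), (n.choose i : ℝ)) = 2 ^ n := by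
          exact_mod_cast Nat.sum_range_choose n
        rw [this, show (4 : ℝ) = 2 * 2 by norm_num, mul_pow]
        ring
    _ ≤ 2 ^ N * 4 ^ (N + K) * A * B := by
        gcongr
        norm_num

theorem schwartzTranslate_zero (θ : 𝓢(Space d, ℂ)) : schwartzTranslate 0 θ = θ := by
  ext x; simp [schwartzTranslate_apply]

theorem snorm_schwartzMul_le (N : ℕ) (a θ : 𝓢(Space d, ℂ)) :
    snorm N (schwartzMul a θ) ≤ 2 ^ N * 4 ^ N * snorm N a * snorm N θ := by
  simpa [schwartzTranslate_zero] using snorm_schwartzMul_translate_le N 0 a θ 0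

/-- The mean value inequality on the ball of radius `‖y‖ ≤ 1` costs one more derivative, and the
weights at points of that ball are comparable to the weight at the centre. -/
theorem snorm_schwartzTranslate_sub_le (N : ℕ) (θ : 𝓢(Space d, ℂ)) (y : Space d)
    (hy : ‖y‖ ≤ 1) :
    snorm N (schwartzTranslate y θ - θ) ≤ 2 ^ N * 2 ^ (N + 1) * snorm (N + 1) θ * ‖y‖ := by
  refine snorm_le_of_forall fun n hn x => ?_
  have hfun : iteratedFDeriv ℝ n (⇑(schwartzTranslate y θ - θ)) x
      = iteratedFDeriv ℝ n θ (x - y) - iteratedFDeriv ℝ n θ x := by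
    have : (⇑(schwartzTranslate y θ - θ)) = ⇑(schwartzTranslate y θ) - ⇑θ := by
      ext x; simp
    rw [this, iteratedFDeriv_sub_apply ((schwartzTranslate y θ).contDiffAt n) (θ.contDiffAt n),
      iteratedFDeriv_schwartzTranslate]
  rw [hfun]
  have hx : 0 < (1 + ‖x‖) ^ N := by positivity
  set B := 2 ^ N * 2 ^ (N + 1) * snorm (N + 1) θ with hB
  have hdiff : ∀ z ∈ Metric.closedBall x ‖y‖, DifferentiableAt ℝ (iteratedFDeriv ℝ n θ) z :=
    fun z _ => ((θ.smooth ⊤).differentiable_iteratedFDeriv (mod_cast WithTop.coe_lt_top n)) z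
  have hbd : ∀ z ∈ Metric.closedBall x ‖y‖,
      ‖fderiv ℝ (iteratedFDeriv ℝ n θ) z‖ ≤ B / (1 + ‖x‖) ^ N := by
    intro z hz
    rw [norm_fderiv_iteratedFDeriv, le_div_iff₀ hx]
    have hz' : ‖x - z‖ ≤ 1 := by
      rw [norm_sub_rev, ← dist_eq_norm]; exact (Metric.mem_closedBall.1 hz).trans hy
    have h1 : 1 + ‖x‖ ≤ 2 * (1 + ‖z‖) := by
      have := norm_add_le (x - z) z
      rw [sub_add_cancel] at this
      linarith [norm_nonneg z]
    calc ‖iteratedFDeriv ℝ (n + 1) θ z‖ * (1 + ‖x‖) ^ N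
        ≤ ‖iteratedFDeriv ℝ (n + 1) θ z‖ * (2 * (1 + ‖z‖)) ^ N := by gcongr
      _ = 2 ^ N * ((1 + ‖z‖) ^ N * ‖iteratedFDeriv ℝ (n + 1) θ z‖) := by
          rw [mul_pow]; ring
      _ ≤ 2 ^ N * (2 ^ (N + 1) * snorm (N + 1) θ) :=
          mul_le_mul_of_nonneg_left
            (one_add_norm_pow_mul_le_snorm (by omega) (by omega) θ z) (by positivity)
      _ = B := by rw [hB]; ring
  have hmv := (convex_closedBall x ‖y‖).norm_image_sub_le_of_norm_fderiv_le hdiff hbd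
    (Metric.mem_closedBall_self (norm_nonneg y)) (y := x - y) (by simp)
  calc (1 + ‖x‖) ^ N * ‖iteratedFDeriv ℝ n θ (x - y) - iteratedFDeriv ℝ n θ x‖
      ≤ (1 + ‖x‖) ^ N * (B / (1 + ‖x‖) ^ N * ‖y‖) := by
        gcongr
        simpa using hmv
    _ = B * ‖y‖ := by field_simp

theorem schwartzTranslate_schwartzTranslate (x y : Space d) (θ : 𝓢(Space d, ℂ)) :
    schwartzTranslate x (schwartzTranslate y θ) = schwartzTranslate (x + y) θ := by
  ext t
  simp only [schwartzTranslate_apply]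
  congr 1
  abel

theorem continuous_schwartzTranslate (θ : 𝓢(Space d, ℂ)) :
    Continuous fun y : Space d => schwartzTranslate y θ := by
  refine continuous_of_snorm fun N z => ?_
  set η := schwartzTranslate z θ
  have h0 : Tendsto (fun w : Space d => 2 ^ N * 2 ^ (N + 1) * snorm (N + 1) η * ‖w - z‖) (𝓝 z)
      (𝓝 0) := by
    have : Continuous fun w : Space d => 2 ^ N * 2 ^ (N + 1) * snorm (N + 1) η * ‖w - z‖ := by
      fun_prop
    simpa using this.tendsto z
  refine squeeze_zero' (Eventually.of_forall fun _ => apply_nonneg _ _) ?_ h0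
  filter_upwards [Metric.closedBall_mem_nhds z one_pos] with w hw
  have : schwartzTranslate w θ = schwartzTranslate (w - z) η := by
    rw [schwartzTranslate_schwartzTranslate, sub_add_cancel]
  rw [this]
  exact snorm_schwartzTranslate_sub_le N η _ (by simpa [dist_eq_norm] using hw)

end SchwartzNorms

/-! ### Integrals of families of Schwartz functions -/

section Integration

variable {d : ℕ}

theorem iteratedFDeriv_schwartz_sub (θ θ' : 𝓢(Space d, ℂ)) (n : ℕ) (t : Space d) :
    iteratedFDeriv ℝ n (⇑(θ - θ')) t = iteratedFDeriv ℝ n θ t - iteratedFDeriv ℝ n θ' t := by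
  have : (⇑(θ - θ')) = ⇑θ - ⇑θ' := by
    ext x; simp
  rw [this, iteratedFDeriv_sub_apply (θ.contDiffAt n) (θ'.contDiffAt n)]

theorem norm_iteratedFDeriv_le_snorm {n N : ℕ} (h : n ≤ N) (θ : 𝓢(Space d, ℂ)) (t : Space d) :
    ‖iteratedFDeriv ℝ n θ t‖ ≤ 2 ^ N * snorm N θ := by
  simpa using one_add_norm_pow_mul_le_snorm (Nat.zero_le N) h θ t

theorem continuous_iteratedFDeriv_apply (n : ℕ) (t : Space d) :
    Continuous fun θ : 𝓢(Space d, ℂ) => iteratedFDeriv ℝ n θ t := by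
  refine continuous_iff_continuousAt.2 fun θ => ?_
  refine tendsto_iff_norm_sub_tendsto_zero.2 ?_
  have h0 : Tendsto (fun θ' => 2 ^ n * snorm n (θ' - θ)) (𝓝 θ) (𝓝 0) := by
    have : Continuous fun θ' => 2 ^ n * snorm (d := d) n (θ' - θ) :=
      continuous_const.mul ((continuous_snorm n).comp (continuous_id.sub continuous_const))
    simpa using this.tendsto θ
  refine squeeze_zero (fun _ => norm_nonneg _) (fun θ' => ?_) h0
  rw [← iteratedFDeriv_schwartz_sub]
  exact norm_iteratedFDeriv_le_snorm le_rfl _ _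

variable {Z : Type*} [TopologicalSpace Z] [SecondCountableTopology Z] [MeasurableSpace Z]
  [OpensMeasurableSpace Z] {μ : Measure Z} {K : Z → 𝓢(Space d, ℂ)}

theorem integrable_iteratedFDeriv_apply (hK : Continuous K)
    (hintg : ∀ N, Integrable (fun z => snorm N (K z)) μ) (n : ℕ) (t : Space d) :
    Integrable (fun z => iteratedFDeriv ℝ n (K z) t) μ := by
  refine ((hintg n).const_mul (2 ^ n)).mono'
    ((continuous_iteratedFDeriv_apply n t).comp hK).aestronglyMeasurable
    (Eventually.of_forall fun z => norm_iteratedFDeriv_le_snorm le_rfl _ _)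

/-- Differentiation under the integral sign, one order at a time; the norm `snorm (n + 1)` of the
family is an integrable majorant that is uniform in the point. -/
theorem iteratedFDeriv_integral (hK : Continuous K)
    (hintg : ∀ N, Integrable (fun z => snorm N (K z)) μ) {s : 𝓢(Space d, ℂ)}
    (hs : ∀ t, s t = ∫ z, K z t ∂μ) (n : ℕ) (t : Space d) :
    iteratedFDeriv ℝ n s t = ∫ z, iteratedFDeriv ℝ n (K z) t ∂μ := by
  induction n generalizing t with
  | zero =>
    ext m
    rw [ContinuousMultilinearMap.integral_apply (integrable_iteratedFDeriv_apply hK hintg 0 t)]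
    simp [hs t]
  | succ n ih =>
    have hfun : iteratedFDeriv ℝ n s = fun t => ∫ z, iteratedFDeriv ℝ n (K z) t ∂μ := funext ih
    let e := continuousMultilinearCurryLeftEquiv ℝ (fun _ : Fin (n + 1) => Space d) ℂ
    have hfd : ∀ (θ : 𝓢(Space d, ℂ)) (x : Space d),
        fderiv ℝ (iteratedFDeriv ℝ n θ) x = e (iteratedFDeriv ℝ (n + 1) θ x) := fun θ x => by
      rw [fderiv_iteratedFDeriv]; rfl
    have hI := integrable_iteratedFDeriv_apply hK hintg (n + 1) t
    have hd := hasFDerivAt_integral_of_dominated_of_fderiv_le (𝕜 := ℝ) (μ := μ)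
      (F := fun x z => iteratedFDeriv ℝ n (K z) x)
      (F' := fun x z => fderiv ℝ (iteratedFDeriv ℝ n (K z)) x) (x₀ := t) (s := Set.univ)
      (bound := fun z => 2 ^ (n + 1) * snorm (n + 1) (K z)) Filter.univ_mem
      (Eventually.of_forall fun x =>
        (integrable_iteratedFDeriv_apply hK hintg n x).aestronglyMeasurable)
      (integrable_iteratedFDeriv_apply hK hintg n t)
      (by
        simp only [hfd]
        exact e.continuous.comp_aestronglyMeasurable hI.aestronglyMeasurable)
      (Eventually.of_forall fun z x _ => by
        rw [norm_fderiv_iteratedFDeriv]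
        exact norm_iteratedFDeriv_le_snorm le_rfl _ _)
      ((hintg (n + 1)).const_mul _)
      (Eventually.of_forall fun z x _ =>
        (((K z).smooth ⊤).differentiable_iteratedFDeriv
          (mod_cast WithTop.coe_lt_top n) x).hasFDerivAt)
    have h1 := hd.fderiv
    rw [← hfun, hfd] at h1
    simp only [hfd] at h1
    apply e.injective
    rw [h1]
    exact ContinuousLinearMap.integral_comp_comm (𝕜 := ℝ) (E := Space d [×(n + 1)]→L[ℝ] ℂ)
      (Fₗ := Space d →L[ℝ] Space d [×n]→L[ℝ] ℂ)
      e.toContinuousLinearEquiv.toContinuousLinearMap hI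

/-- A linear form that is dominated by the norm of a linear map factors through it. -/
theorem exists_clm_comp_eq {V Y : Type*} [AddCommGroup V] [Module ℂ V]
    [NormedAddCommGroup Y] [NormedSpace ℂ Y] (j : V →ₗ[ℂ] Y) (hj : Function.Injective j)
    (f : V →ₗ[ℂ] ℂ) (C : ℝ) (h : ∀ v, ‖f v‖ ≤ C * ‖j v‖) :
    ∃ F : Y →L[ℂ] ℂ, ∀ v, F (j v) = f v := by
  let e := LinearEquiv.ofInjective j hj
  have he : ∀ v, ((e v : LinearMap.range j) : Y) = j v := fun v => rfl
  let g : LinearMap.range j →L[ℂ] ℂ := LinearMap.mkContinuous (f ∘ₗ e.symm.toLinearMap) C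
    (fun y => by
      obtain ⟨v, rfl⟩ := e.surjective y
      simpa [he] using h v)
  obtain ⟨F, hF, -⟩ := exists_extension_norm_eq (LinearMap.range j) g
  refine ⟨F, fun v => ?_⟩
  rw [← he, hF]
  simp [g]

/-- The bounded continuous functions with values in the `n`-linear forms. -/
def JetFun (d n : ℕ) : Type :=
  BoundedContinuousFunction (Space d) (Space d [×n]→L[ℝ] ℂ)

instance (d n : ℕ) : NormedAddCommGroup (JetFun d n) :=
  inferInstanceAs (NormedAddCommGroup (BoundedContinuousFunction _ _))

instance (d n : ℕ) : NormedSpace ℂ (JetFun d n) :=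
  inferInstanceAs (NormedSpace ℂ (BoundedContinuousFunction (Space d) (Space d [×n]→L[ℝ] ℂ)))

instance (d n : ℕ) : CompleteSpace (JetFun d n) :=
  inferInstanceAs (CompleteSpace (BoundedContinuousFunction (Space d) (Space d [×n]→L[ℝ] ℂ)))

/-- Evaluation at a point. -/
def jetEval {d n : ℕ} (x : Space d) : JetFun d n →L[ℂ] (Space d [×n]→L[ℝ] ℂ) :=
  BoundedContinuousFunction.evalCLM (α := Space d) (β := Space d [×n]→L[ℝ] ℂ) ℂ x

theorem jetFun_ext {n : ℕ} {u v : JetFun d n} (h : ∀ x, jetEval x u = jetEval x v) : u = v :=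
  BoundedContinuousFunction.ext h

theorem jetFun_norm_le {n : ℕ} {u : JetFun d n} {C : ℝ} (hC : 0 ≤ C)
    (h : ∀ x, ‖jetEval x u‖ ≤ C) : ‖u‖ ≤ C :=
  (BoundedContinuousFunction.norm_le hC).2 h

theorem norm_jetEval_le {n : ℕ} (u : JetFun d n) (x : Space d) : ‖jetEval x u‖ ≤ ‖u‖ :=
  BoundedContinuousFunction.norm_coe_le_norm (α := Space d) (β := Space d [×n]→L[ℝ] ℂ) u x

/-- The derivative of order `n ≤ N` of a Schwartz function, with a weight. -/
def weightedDeriv (N : ℕ) (n : Fin (N + 1)) (θ : 𝓢(Space d, ℂ)) : JetFun d n :=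
  BoundedContinuousFunction.ofNormedAddCommGroup
    (fun x => ((1 + ‖x‖) ^ N : ℝ) • iteratedFDeriv ℝ n θ x)
    ((by fun_prop : Continuous fun x : Space d => ((1 + ‖x‖) ^ N : ℝ)).smul
      ((θ.smooth ⊤).continuous_iteratedFDeriv (mod_cast le_top)))
    (2 ^ N * snorm N θ) (fun x => by
      rw [norm_smul, Real.norm_of_nonneg (by positivity)]
      exact one_add_norm_pow_mul_le_snorm le_rfl (by omega) θ x)

theorem jetEval_weightedDeriv (N : ℕ) (n : Fin (N + 1)) (θ : 𝓢(Space d, ℂ)) (x : Space d) :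
    jetEval x (weightedDeriv N n θ) = ((1 + ‖x‖) ^ N : ℝ) • iteratedFDeriv ℝ n θ x := rfl

/-- The derivatives of order at most `N` of a Schwartz function, with a weight. -/
def weightedJet (N : ℕ) : 𝓢(Space d, ℂ) →ₗ[ℂ] ∀ n : Fin (N + 1), JetFun d n where
  toFun θ n := weightedDeriv N n θ
  map_add' θ θ' := by
    refine funext fun n => jetFun_ext fun x => ?_
    have h : (⇑(θ + θ')) = ⇑θ + ⇑θ' := by ext x; simp
    rw [Pi.add_apply, map_add, jetEval_weightedDeriv, jetEval_weightedDeriv,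
      jetEval_weightedDeriv, h, iteratedFDeriv_add_apply (θ.contDiffAt n) (θ'.contDiffAt n),
      smul_add]
  map_smul' c θ := by
    refine funext fun n => jetFun_ext fun x => ?_
    have h : (⇑(c • θ)) = c • ⇑θ := by ext x; simp
    rw [Pi.smul_apply, map_smul, jetEval_weightedDeriv, jetEval_weightedDeriv, h,
      iteratedFDeriv_const_smul_apply (θ.contDiffAt n), smul_comm, RingHom.id_apply]

theorem jetEval_weightedJet (N : ℕ) (θ : 𝓢(Space d, ℂ)) (n : Fin (N + 1)) (x : Space d) :
    jetEval x (weightedJet N θ n) = ((1 + ‖x‖) ^ N : ℝ) • iteratedFDeriv ℝ n θ x := rfl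

theorem snorm_le_norm_weightedJet (N : ℕ) (θ : 𝓢(Space d, ℂ)) :
    snorm N θ ≤ ‖weightedJet N θ‖ := by
  refine snorm_le_of_forall fun n hn x => ?_
  have h := (norm_jetEval_le (weightedJet N θ ⟨n, by omega⟩) x).trans
    (norm_le_pi_norm (weightedJet N θ) _)
  rwa [jetEval_weightedJet, norm_smul, Real.norm_of_nonneg (by positivity)] at h

theorem norm_weightedJet_le (N : ℕ) (θ : 𝓢(Space d, ℂ)) :
    ‖weightedJet N θ‖ ≤ 2 ^ N * snorm N θ := by
  have h0 : 0 ≤ 2 ^ N * snorm N θ := mul_nonneg (by positivity) (apply_nonneg _ _)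
  refine (pi_norm_le_iff_of_nonneg h0).2 fun n => ?_
  refine jetFun_norm_le h0 fun x => ?_
  rw [jetEval_weightedJet, norm_smul, Real.norm_of_nonneg (by positivity)]
  exact one_add_norm_pow_mul_le_snorm le_rfl (by omega) θ x

theorem weightedJet_injective (N : ℕ) : Function.Injective (weightedJet (d := d) N) := by
  refine (injective_iff_map_eq_zero _).2 fun θ hθ => ?_
  ext x
  have h := (norm_apply_le_snorm θ x N).trans
    (mul_le_mul_of_nonneg_left (snorm_le_norm_weightedJet N θ) (by positivity))
  rw [hθ, norm_zero, mul_zero] at h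
  have h2 : 0 < (1 + ‖x‖) ^ N := by positivity
  have h3 : ‖θ x‖ ≤ 0 := by
    by_contra h4
    exact absurd h (not_le.2 (mul_pos h2 (not_le.1 h4)))
  simpa using h3

theorem continuous_weightedJet (N : ℕ) : Continuous (weightedJet (d := d) N) := by
  refine continuous_iff_continuousAt.2 fun θ => tendsto_iff_norm_sub_tendsto_zero.2 ?_
  have h0 : Tendsto (fun θ' => 2 ^ N * snorm N (θ' - θ)) (𝓝 θ) (𝓝 0) := by
    have : Continuous fun θ' => 2 ^ N * snorm (d := d) N (θ' - θ) :=
      continuous_const.mul ((continuous_snorm N).comp (continuous_id.sub continuous_const))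
    simpa using this.tendsto θ
  refine squeeze_zero (fun _ => norm_nonneg _) (fun θ' => ?_) h0
  rw [← map_sub]
  exact norm_weightedJet_le N _

/-- Tempered distributions commute with integrals of families of Schwartz functions. -/
theorem tempered_apply_integral (hK : Continuous K)
    (hintg : ∀ N, Integrable (fun z => snorm N (K z)) μ) {s : 𝓢(Space d, ℂ)}
    (hs : ∀ t, s t = ∫ z, K z t ∂μ) (f : Tempered d) :
    Integrable (fun z => f (K z)) μ ∧ f s = ∫ z, f (K z) ∂μ := by
  obtain ⟨N, C, hC, hf⟩ := exists_norm_apply_le_snorm f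
  -- By Hahn–Banach `f` factors through the Banach space of weighted `N`-jets. The Bochner integral
  -- is taken there, since the Schwartz space is not normed.
  obtain ⟨F, hF⟩ := exists_clm_comp_eq (weightedJet N) (weightedJet_injective N) f.toLinearMap C
    (fun θ => (hf θ).trans
      (mul_le_mul_of_nonneg_left (snorm_le_norm_weightedJet N θ) hC.le))
  have hF' : ∀ θ, F (weightedJet N θ) = f θ := hF
  have hJ : Integrable (fun z => weightedJet N (K z)) μ :=
    ((hintg N).const_mul (2 ^ N)).mono'
      ((continuous_weightedJet N).comp hK).aestronglyMeasurable
      (Eventually.of_forall fun z => norm_weightedJet_le N _)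
  have hjs : weightedJet N s = ∫ z, weightedJet N (K z) ∂μ := by
    refine funext fun n => jetFun_ext fun x => ?_
    let ev : (∀ n : Fin (N + 1), JetFun d n) →L[ℂ] (Space d [×(n : ℕ)]→L[ℝ] ℂ) :=
      (jetEval x).comp (ContinuousLinearMap.proj n)
    have h1 : jetEval x ((∫ z, weightedJet N (K z) ∂μ) n)
        = ∫ z, jetEval x (weightedJet N (K z) n) ∂μ := (ev.integral_comp_comm hJ).symm
    rw [h1]
    simp only [jetEval_weightedJet]
    rw [integral_smul, iteratedFDeriv_integral hK hintg hs]
  constructor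
  · simpa only [hF'] using F.integrable_comp hJ
  · rw [← hF', hjs, ← F.integral_comp_comm hJ]
    simp only [hF']

/-- Tempered distributions commute with absolutely convergent series of Schwartz functions. -/
theorem tempered_hasSum {κ : Type*} [Countable κ] {K : κ → 𝓢(Space d, ℂ)}
    (hsum : ∀ N, Summable fun i => snorm N (K i)) {s : 𝓢(Space d, ℂ)}
    (hs : ∀ t, HasSum (fun i => K i t) (s t)) (f : Tempered d) :
    HasSum (fun i => f (K i)) (f s) := by
  -- A series is an integral against the counting measure, and the discrete topology makes the
  -- continuity requirement empty.
  let _ : TopologicalSpace κ := ⊥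
  have _ : DiscreteTopology κ := ⟨rfl⟩
  let _ : MeasurableSpace κ := ⊤
  have hintg : ∀ N, Integrable (fun i => snorm N (K i)) (Measure.count : Measure κ) := fun N => by
    rw [integrable_count_iff]
    simpa [Real.norm_of_nonneg (apply_nonneg (snorm N) (K _))] using hsum N
  have hs' : ∀ t, s t = ∫ i, K i t ∂(Measure.count : Measure κ) := fun t => by
    have h1 : Summable fun i => ‖K i t‖ := by
      refine Summable.of_nonneg_of_le (fun _ => norm_nonneg _) (fun i => ?_) (hsum 0)
      simpa using norm_apply_le_snorm (K i) t 0
    rw [integral_countable (integrable_count_iff.2 h1), ← (hs t).tsum_eq]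
    simp [Measure.real]
  obtain ⟨h1, h2⟩ := tempered_apply_integral continuous_of_discreteTopology hintg hs' f
  rw [integral_countable h1] at h2
  simp only [Measure.real, Measure.count_singleton, ENNReal.toReal_one, one_smul] at h2
  rw [h2]
  exact (integrable_count_iff.1 h1).of_norm.hasSum

end Integration

/-! ### Modulations of Schwartz functions -/

section Modulation

variable {d : ℕ}

theorem norm_character (ξ t : Space d) : ‖character ξ t‖ = 1 := by
  rw [character, show 2 * (Real.pi : ℂ) * Complex.I * ((inner ℝ t ξ : ℝ) : ℂ)
    = ((2 * Real.pi * inner ℝ t ξ : ℝ) : ℂ) * Complex.I by push_cast; ring]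
  exact Complex.norm_exp_ofReal_mul_I _

theorem character_add_left (ξ t s : Space d) :
    character ξ (t + s) = character ξ t * character ξ s := by
  rw [character, character, character, ← Complex.exp_add, inner_add_left]
  push_cast
  ring_nf

theorem character_add (ξ ζ t : Space d) :
    character (ξ + ζ) t = character ξ t * character ζ t := by
  rw [character, character, character, ← Complex.exp_add, inner_add_right]
  push_cast
  ring_nf

theorem character_comm (ξ t : Space d) : character ξ t = character t ξ := by
  rw [character, character, real_inner_comm]

theorem character_neg (ξ t : Space d) :
    character (-ξ) t = (starRingEnd ℂ) (character ξ t) := by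
  rw [character, character, ← Complex.exp_conj]
  simp [Complex.conj_ofNat]

theorem fourier_eq_integral_character (θ : 𝓢(Space d, ℂ)) (ξ : Space d) :
    𝓕 θ ξ = ∫ t, character (-ξ) t * θ t := by
  rw [SchwartzMap.fourier_coe, Real.fourier_eq']
  refine integral_congr_ae (Eventually.of_forall fun t => ?_)
  simp only [character, smul_eq_mul, inner_neg_right]
  congr 2
  push_cast
  ring

theorem fourierInv_eq_integral_character (θ : 𝓢(Space d, ℂ)) (t : Space d) :
    𝓕⁻ θ t = ∫ ξ, character ξ t * θ ξ := by
  rw [SchwartzMap.fourierInv_coe, Real.fourierInv_eq']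
  refine integral_congr_ae (Eventually.of_forall fun ξ => ?_)
  simp only [character, smul_eq_mul]
  rw [real_inner_comm]
  congr 2
  push_cast
  ring

theorem fourier_modulate (ξ : Space d) (θ : 𝓢(Space d, ℂ)) :
    𝓕 (schwartzModulate ξ θ) = schwartzTranslate ξ (𝓕 θ) := by
  ext y
  rw [schwartzTranslate_apply, fourier_eq_integral_character, fourier_eq_integral_character]
  refine integral_congr_ae (Eventually.of_forall fun t => ?_)
  simp only [schwartzModulate_apply]
  rw [← mul_assoc, ← character_add]
  congr 2
  abel

/-- Conjugation by the Fourier transform turns modulations into translations, so that continuity in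
`ξ` and polynomial bounds are inherited from the latter. -/
theorem schwartzModulate_eq (ξ : Space d) (θ : 𝓢(Space d, ℂ)) :
    schwartzModulate ξ θ = 𝓕⁻ (schwartzTranslate ξ (𝓕 θ)) := by
  rw [← fourier_modulate, FourierTransform.fourierInv_fourier_eq]

theorem exists_snorm_fourier_le (M : ℕ) :
    ∃ (N : ℕ) (C : ℝ), 0 < C ∧ ∀ θ : 𝓢(Space d, ℂ), snorm M (𝓕 θ) ≤ C * snorm N θ :=
  exists_snorm_clm_le (FourierTransform.fourierCLM ℂ 𝓢(Space d, ℂ)) M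

theorem exists_snorm_fourierInv_le (M : ℕ) :
    ∃ (N : ℕ) (C : ℝ), 0 < C ∧ ∀ θ : 𝓢(Space d, ℂ), snorm M (𝓕⁻ θ) ≤ C * snorm N θ :=
  exists_snorm_clm_le (FourierTransform.fourierInvCLM ℂ 𝓢(Space d, ℂ)) M

theorem exists_snorm_modulate_le (M : ℕ) :
    ∃ (N : ℕ) (C : ℝ), 0 < C ∧ ∀ (ξ : Space d) (θ : 𝓢(Space d, ℂ)),
      snorm M (schwartzModulate ξ θ) ≤ C * (1 + ‖ξ‖) ^ N * snorm N θ := by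
  obtain ⟨N₁, C₁, hC₁, h₁⟩ := exists_snorm_fourierInv_le (d := d) M
  obtain ⟨N₂, C₂, hC₂, h₂⟩ := exists_snorm_fourier_le (d := d) N₁
  refine ⟨max N₁ N₂, C₁ * 2 ^ N₁ * C₂, by positivity, fun ξ θ => ?_⟩
  rw [schwartzModulate_eq]
  have hx : (1 : ℝ) ≤ 1 + ‖ξ‖ := by linarith [norm_nonneg ξ]
  calc snorm M (𝓕⁻ (schwartzTranslate ξ (𝓕 θ)))
      ≤ C₁ * snorm N₁ (schwartzTranslate ξ (𝓕 θ)) := h₁ _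
    _ ≤ C₁ * (2 ^ N₁ * (1 + ‖ξ‖) ^ N₁ * snorm N₁ (𝓕 θ)) := by
        gcongr; exact snorm_schwartzTranslate_le _ _ _
    _ ≤ C₁ * (2 ^ N₁ * (1 + ‖ξ‖) ^ (max N₁ N₂) * (C₂ * snorm (max N₁ N₂) θ)) := by
        gcongr
        · exact le_max_left _ _
        · exact (h₂ θ).trans (mul_le_mul_of_nonneg_left (snorm_mono (le_max_right _ _) θ) hC₂.le)
    _ = _ := by ring

theorem continuous_schwartzModulate (θ : 𝓢(Space d, ℂ)) :
    Continuous fun ξ : Space d => schwartzModulate ξ θ := by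
  simp only [schwartzModulate_eq]
  exact (FourierTransform.fourierInvCLM ℂ 𝓢(Space d, ℂ)).continuous.comp
    (continuous_schwartzTranslate _)

/-- Separate continuity becomes joint because the modulations are locally uniformly bounded in the
seminorms. -/
theorem continuous_schwartzModulate_translate (θ : 𝓢(Space d, ℂ)) :
    Continuous fun z : Space d × Space d => schwartzModulate z.2 (schwartzTranslate z.1 θ) := by
  refine continuous_of_snorm fun M z => ?_
  obtain ⟨N, C, hC, h⟩ := exists_snorm_modulate_le (d := d) M
  have h1 : Tendsto (fun w : Space d × Space d => C * (1 + ‖w.2‖) ^ N *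
      snorm N (schwartzTranslate w.1 θ - schwartzTranslate z.1 θ)
      + snorm M (schwartzModulate w.2 (schwartzTranslate z.1 θ)
        - schwartzModulate z.2 (schwartzTranslate z.1 θ))) (𝓝 z) (𝓝 0) := by
    have hc : Continuous (fun w : Space d × Space d => C * (1 + ‖w.2‖) ^ N *
      snorm N (schwartzTranslate w.1 θ - schwartzTranslate z.1 θ)
      + snorm M (schwartzModulate w.2 (schwartzTranslate z.1 θ)
        - schwartzModulate z.2 (schwartzTranslate z.1 θ))) := by
      refine Continuous.add (Continuous.mul (by fun_prop) ?_) ?_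
      · exact (continuous_snorm N).comp
          (((continuous_schwartzTranslate θ).comp continuous_fst).sub continuous_const)
      · exact (continuous_snorm M).comp
          (((continuous_schwartzModulate _).comp continuous_snd).sub continuous_const)
    simpa using hc.tendsto z
  refine squeeze_zero (fun _ => apply_nonneg _ _) (fun w => ?_) h1
  have : schwartzModulate w.2 (schwartzTranslate w.1 θ)
      - schwartzModulate z.2 (schwartzTranslate z.1 θ)
      = schwartzModulate w.2 (schwartzTranslate w.1 θ - schwartzTranslate z.1 θ)
        + (schwartzModulate w.2 (schwartzTranslate z.1 θ)
          - schwartzModulate z.2 (schwartzTranslate z.1 θ)) := by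
    rw [map_sub]; abel
  rw [this]
  exact (map_add_le_add _ _ _).trans (add_le_add_left (h _ _) _)

end Modulation

/-! ### The lattice of integer points -/

section Lattice

variable {d : ℕ}

/-- The integer part of a vector. -/
def floorVec (x : Space d) : Fin d → ℤ := fun i => ⌊x i⌋

theorem latticePoint_apply (k : Fin d → ℤ) (i : Fin d) : latticePoint k i = k i := rfl

theorem latticePoint_sub (k l : Fin d → ℤ) :
    latticePoint (k - l) = latticePoint k - latticePoint l := by
  ext i; simp [latticePoint_apply]

theorem latticePoint_neg (k : Fin d → ℤ) : latticePoint (-k) = -latticePoint k := by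
  ext i; simp [latticePoint_apply]

theorem norm_le_sqrt_of_abs_le {x : Space d} {c : ℝ} (h : ∀ i, |x i| ≤ c) :
    ‖x‖ ≤ Real.sqrt d * c := by
  by_cases hd : d = 0
  · subst hd
    simp [EuclideanSpace.norm_eq]
  have hc : 0 ≤ c := (abs_nonneg _).trans (h ⟨0, Nat.pos_of_ne_zero hd⟩)
  rw [EuclideanSpace.norm_eq]
  refine Real.sqrt_le_iff.2 ⟨by positivity, ?_⟩
  rw [mul_pow, Real.sq_sqrt (by positivity)]
  calc ∑ i, ‖x i‖ ^ 2 ≤ ∑ _i : Fin d, c ^ 2 := by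
        gcongr with i
        exact h i
    _ = d * c ^ 2 := by simp

theorem norm_sub_floorVec_le (x : Space d) : ‖x - latticePoint (floorVec x)‖ ≤ Real.sqrt d := by
  have := norm_le_sqrt_of_abs_le (x := x - latticePoint (floorVec x)) (c := 1) fun i => by
    have h1 := Int.floor_le (x i)
    have h2 := Int.lt_floor_add_one (x i)
    simp only [PiLp.sub_apply, latticePoint_apply, floorVec]
    rw [abs_le]
    constructor <;> linarith
  simpa using this

theorem norm_le_of_mem_cube {k : Fin d → ℤ} {x : Space d} (h : x ∈ cube k) :
    ‖x - latticePoint k‖ ≤ Real.sqrt d := by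
  have := norm_le_sqrt_of_abs_le (x := x - latticePoint k) (c := 1) fun i => abs_le.2 (h i)
  simpa using this

theorem measurable_floorVec : Measurable (floorVec (d := d)) := by
  refine measurable_pi_lambda _ fun i => Int.measurable_floor.comp ?_
  exact (by fun_prop : Continuous fun x : Space d => x i).measurable

/-- Each fibre is a half-open unit cube, of volume one. Composition with the integer part therefore
identifies sequences with functions constant on unit cubes, preserving all `L^p` norms. -/
theorem measurePreserving_floorVec :
    MeasurePreserving (floorVec (d := d)) volume Measure.count := by
  refine ⟨measurable_floorVec, Measure.ext_of_singleton fun k => ?_⟩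
  rw [Measure.map_apply measurable_floorVec (measurableSet_singleton k),
    Measure.count_singleton]
  have h1 : floorVec (d := d) ⁻¹' {k} = (MeasurableEquiv.toLp 2 (Fin d → ℝ)).symm ⁻¹'
      (Set.univ.pi fun i => Set.Ico (k i : ℝ) (k i + 1)) := by
    ext x
    simp only [Set.mem_preimage, Set.mem_singleton_iff, Set.mem_pi, Set.mem_univ, true_implies,
      funext_iff, floorVec, Int.floor_eq_iff, Set.mem_Ico]
    rfl
  rw [h1, (EuclideanSpace.volume_preserving_symm_measurableEquiv_toLp (Fin d)).measure_preimage
    (MeasurableSet.univ_pi fun i => measurableSet_Ico).nullMeasurableSet, Real.volume_pi_Ico]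
  simp

theorem exists_summable_lattice (d : ℕ) :
    ∃ N₀ : ℕ, ∀ N ≥ N₀, Summable fun k : Fin d → ℤ => ((1 + ‖latticePoint k‖) ^ N)⁻¹ := by
  refine ⟨d + 1, fun N hN => ?_⟩
  have hintg : Integrable (fun x : Space d => (1 + ‖x‖) ^ (-(N : ℝ))) := by
    refine integrable_one_add_norm ?_
    simp only [finrank_euclideanSpace, Fintype.card_fin]
    exact_mod_cast hN
  have h2 : Integrable (fun x : Space d => ((1 + ‖latticePoint (floorVec x)‖) ^ N)⁻¹) := by
    refine (hintg.const_mul ((1 + Real.sqrt d) ^ N)).mono' ?_ (Eventually.of_forall fun x => ?_)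
    · exact ((measurable_of_countable (fun k : Fin d → ℤ =>
        ((1 + ‖latticePoint k‖) ^ N)⁻¹)).comp measurable_floorVec).aestronglyMeasurable
    · rw [Real.norm_of_nonneg (by positivity), Real.rpow_neg (by positivity), Real.rpow_natCast,
        ← div_eq_mul_inv, inv_le_comm₀ (by positivity) (by positivity), inv_div,
        div_le_iff₀ (by positivity), ← mul_pow]
      gcongr
      have h1 := one_add_norm_add_le (latticePoint (floorVec x)) (x - latticePoint (floorVec x))
      rw [add_sub_cancel] at h1
      refine h1.trans ?_
      gcongr
      exact norm_sub_floorVec_le x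
  have h3 : Integrable (fun k : Fin d → ℤ => ((1 + ‖latticePoint k‖) ^ N)⁻¹) Measure.count :=
    (measurePreserving_floorVec.integrable_comp
      (measurable_of_countable _).aestronglyMeasurable).1 h2
  exact (integrable_count_iff.1 h3).of_norm

end Lattice

/-! ### Fourier series -/

section FourierSeries

variable {d : ℕ}

/-- The radius of a ball that contains the support of the cutoff function. -/
def cutoffRadius (d : ℕ) : ℝ := Real.sqrt d + 2

/-- The period of the Fourier series. -/
def period (d : ℕ) : ℝ := 2 * (cutoffRadius d + 1)

theorem cutoffRadius_pos (d : ℕ) : 0 < cutoffRadius d := by unfold cutoffRadius; positivity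

theorem one_le_period (d : ℕ) : 1 ≤ period d := by
  unfold period; linarith [cutoffRadius_pos d]

theorem period_pos (d : ℕ) : 0 < period d := one_pos.trans_le (one_le_period d)

/-- The frequencies of the Fourier series. -/
def freq (n : Fin d → ℤ) : Space d := (period d)⁻¹ • latticePoint n

theorem one_add_norm_latticePoint_le (n : Fin d → ℤ) :
    1 + ‖latticePoint n‖ ≤ period d * (1 + ‖freq n‖) := by
  have h := period_pos d
  rw [freq, norm_smul, Real.norm_of_nonneg (by positivity), mul_add, mul_one,
    mul_inv_cancel_left₀ h.ne']
  linarith [one_le_period d]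

theorem summable_of_decay {κ : ℝ} {N : ℕ} (hN : Summable fun n : Fin d → ℤ =>
      ((1 + ‖latticePoint n‖) ^ N)⁻¹) {u : (Fin d → ℤ) → ℝ} (h0 : ∀ n, 0 ≤ u n)
    (h : ∀ n, (1 + ‖freq n‖) ^ N * u n ≤ κ) : Summable u := by
  refine Summable.of_nonneg_of_le h0 (fun n => ?_) (hN.mul_left (period d ^ N * κ))
  have h1 : 0 < (1 + ‖latticePoint n‖) ^ N := by positivity
  rw [← div_eq_mul_inv, le_div_iff₀ h1]
  calc u n * (1 + ‖latticePoint n‖) ^ N ≤ u n * (period d * (1 + ‖freq n‖)) ^ N := by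
        gcongr
        · exact h0 n
        · exact one_add_norm_latticePoint_le n
    _ = period d ^ N * ((1 + ‖freq n‖) ^ N * u n) := by rw [mul_pow]; ring
    _ ≤ period d ^ N * κ := by
        gcongr
        · exact pow_nonneg (period_pos d).le N
        · exact h n

theorem mFourier_coe (n : Fin d → ℤ) (x : Fin d → ℝ) :
    UnitAddTorus.mFourier n (fun i => (x i : UnitAddCircle))
      = character (latticePoint n) (WithLp.toLp 2 x) := by
  simp only [UnitAddTorus.mFourier, ContinuousMap.coe_mk, fourier_coe_apply, character]
  rw [← Complex.exp_sum]
  congr 1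
  simp only [PiLp.inner_apply, latticePoint_apply, RCLike.inner_apply, conj_trivial]
  push_cast
  rw [Finset.mul_sum]
  refine Finset.sum_congr rfl fun i _ => ?_
  ring

/-- The rescaled function on `Fin d → ℝ`. -/
def rescale (h : 𝓢(Space d, ℂ)) (x : Fin d → ℝ) : ℂ := h (period d • WithLp.toLp 2 x)

/-- The periodization of a rescaled function. -/
def periodize (h : 𝓢(Space d, ℂ)) (x : Fin d → ℝ) : ℂ :=
  ∑ᶠ k : Fin d → ℤ, rescale h (x + fun i => (k i : ℝ))

theorem continuous_rescale (h : 𝓢(Space d, ℂ)) : Continuous (rescale h) := by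
  unfold rescale
  exact h.continuous.comp (by fun_prop)

/-- The rescaled support lies strictly inside the unit cube centred at zero, so its integer
translates are disjoint and periodization causes no overlap. -/
theorem abs_lt_of_rescale_ne_zero {h : 𝓢(Space d, ℂ)}
    (hsupp : ∀ t, h t ≠ 0 → ‖t‖ ≤ cutoffRadius d) {x : Fin d → ℝ} (hx : rescale h x ≠ 0)
    (i : Fin d) : |x i| < 1 / 2 := by
  have h1 := hsupp _ hx
  have h2 : |period d * x i| ≤ cutoffRadius d := by
    refine le_trans ?_ h1
    have := PiLp.norm_apply_le (p := 2) (period d • WithLp.toLp 2 x) i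
    simpa using this
  rw [abs_mul, abs_of_pos (period_pos d)] at h2
  by_contra h3
  push Not at h3
  have h4 : period d * (1 / 2) ≤ cutoffRadius d :=
    le_trans (mul_le_mul_of_nonneg_left h3 (period_pos d).le) h2
  -- The period `2 (R + 1)` exceeds the diameter `2 R` of the support; the added one makes the
  -- inequality strict.
  unfold period at h4
  linarith

theorem continuous_periodize {h : 𝓢(Space d, ℂ)}
    (hsupp : ∀ t, h t ≠ 0 → ‖t‖ ≤ cutoffRadius d) : Continuous (periodize h) := by
  unfold periodize
  refine continuous_finsum (fun k => (continuous_rescale h).comp (by fun_prop)) fun x => ?_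
  refine ⟨Metric.ball x 1, Metric.ball_mem_nhds x one_pos, ?_⟩
  -- Near `x`, only translates by integer vectors in a fixed box contribute, so the periodization is
  -- a locally finite sum.
  refine (Set.finite_Icc (fun i => ⌊-(|x i| + 2)⌋) (fun i => ⌈|x i| + 2⌉)).subset ?_
  rintro k ⟨y, hy, hyx⟩
  have h1 : ∀ i, |(k i : ℝ)| ≤ |x i| + 2 := fun i => by
    have h2 := abs_lt_of_rescale_ne_zero hsupp hy i
    have h3 : |y i - x i| < 1 := (dist_le_pi_dist y x i).trans_lt hyx
    simp only [Pi.add_apply] at h2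
    have h4 := abs_sub_abs_le_abs_sub (y i) (x i)
    have h5 : |(k i : ℝ)| ≤ |y i + k i| + |y i| := by
      have := abs_sub (y i + (k i : ℝ)) (y i)
      simpa using this
    linarith
  rw [Set.mem_Icc]
  constructor
  · intro i
    have := (abs_le.1 (h1 i)).1
    exact_mod_cast (Int.floor_le _).trans this
  · intro i
    have := (abs_le.1 (h1 i)).2
    exact_mod_cast this.trans (Int.le_ceil _)

theorem periodize_add (h : 𝓢(Space d, ℂ)) (x : Fin d → ℝ) (k : Fin d → ℤ) :
    periodize h (x + fun i => (k i : ℝ)) = periodize h x := by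
  unfold periodize
  rw [← finsum_comp_equiv (Equiv.addLeft k) (f := fun l : Fin d → ℤ =>
    rescale h (x + fun i => (l i : ℝ)))]
  refine finsum_congr fun l => ?_
  congr 1
  ext i
  simp [add_assoc]

theorem periodize_eq {h : 𝓢(Space d, ℂ)} (hsupp : ∀ t, h t ≠ 0 → ‖t‖ ≤ cutoffRadius d)
    {x : Fin d → ℝ} (hx : ∀ i, |x i| ≤ 1 / 2) : periodize h x = rescale h x := by
  unfold periodize
  rw [finsum_eq_single _ 0]
  · congr 1
    ext i
    simp
  · intro k hk
    by_contra h1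
    apply hk
    ext i
    have h2 := abs_lt_of_rescale_ne_zero hsupp h1 i
    simp only [Pi.add_apply] at h2
    have h3 : |(k i : ℝ)| < 1 := by
      have := abs_sub (x i + (k i : ℝ)) (x i)
      rw [add_sub_cancel_left] at this
      linarith [hx i]
    have h4 : |k i| < 1 := by exact_mod_cast h3
    simpa using Int.abs_lt_one_iff.1 h4

/-- The periodization, as a function on the torus. -/
def torusFun (h : 𝓢(Space d, ℂ)) (z : UnitAddTorus (Fin d)) : ℂ :=
  periodize h fun i => (AddCircle.equivIoc 1 (-(1 / 2)) (z i) : ℝ)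

theorem torusFun_coe (h : 𝓢(Space d, ℂ)) (x : Fin d → ℝ) :
    torusFun h (fun i => (x i : UnitAddCircle)) = periodize h x := by
  have h1 : ∀ i, ∃ k : ℤ,
      (AddCircle.equivIoc 1 (-(1 / 2)) (x i : UnitAddCircle) : ℝ) = x i + k := fun i => by
    have h2 : ((AddCircle.equivIoc 1 (-(1 / 2)) (x i : UnitAddCircle) : ℝ) : UnitAddCircle)
        = (x i : UnitAddCircle) := AddCircle.coe_equivIoc ..
    obtain ⟨k, hk⟩ := AddSubgroup.mem_zmultiples_iff.1 (QuotientAddGroup.eq_iff_sub_mem.1 h2)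
    exact ⟨k, by simp only [zsmul_eq_mul, mul_one] at hk; linarith⟩
  choose k hk using h1
  rw [← periodize_add h x k]
  unfold torusFun
  congr 1
  ext i
  exact hk i

/-- Continuity descends along the projection `ℝ^d → 𝕋^d`. Openness of each coordinate projection is
what makes the product map a quotient map. -/
theorem continuous_torusFun {h : 𝓢(Space d, ℂ)}
    (hsupp : ∀ t, h t ≠ 0 → ‖t‖ ≤ cutoffRadius d) : Continuous (torusFun h) := by
  have hq : IsOpenQuotientMap (Pi.map fun (_ : Fin d) (x : ℝ) => (x : UnitAddCircle)) :=
    IsOpenQuotientMap.piMap fun _ => QuotientAddGroup.isOpenQuotientMap_mk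
  refine hq.isQuotientMap.continuous_iff.2 ?_
  have : torusFun h ∘ (Pi.map fun (_ : Fin d) (x : ℝ) => (x : UnitAddCircle)) = periodize h :=
    funext fun x => torusFun_coe h x
  rw [this]
  exact continuous_periodize hsupp

/-- On the fundamental cube the periodization is the rescaled function, which vanishes elsewhere.
The coefficient is thus an integral over the whole space, and undoing the dilation produces the
factor `L^{-d}` and the frequency `freq n`. -/
theorem mFourierCoeff_torusFun {h : 𝓢(Space d, ℂ)}
    (hsupp : ∀ t, h t ≠ 0 → ‖t‖ ≤ cutoffRadius d) (n : Fin d → ℤ) :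
    UnitAddTorus.mFourierCoeff (torusFun h) n = (period d ^ d : ℝ)⁻¹ * 𝓕 h (freq n) := by
  have hL := period_pos d
  rw [UnitAddTorus.mFourierCoeff_eq_integral _ _ fun _ => -(1 / 2)]
  have h1 : ∀ x ∈ {x : Fin d → ℝ | ∀ i, x i ∈ Set.Ioc (-(1 / 2) : ℝ) (-(1 / 2) + 1)},
      UnitAddTorus.mFourier (-n) (fun i => (x i : UnitAddCircle))
        • torusFun h (fun i => (x i : UnitAddCircle))
      = character (latticePoint (-n)) (WithLp.toLp 2 x) * rescale h x := fun x hx => by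
    rw [mFourier_coe, torusFun_coe, periodize_eq hsupp, smul_eq_mul]
    intro i
    have := hx i
    rw [Set.mem_Ioc] at this
    rw [abs_le]
    constructor <;> linarith
  have hms : MeasurableSet {x : Fin d → ℝ | ∀ i, x i ∈ Set.Ioc (-(1 / 2) : ℝ) (-(1 / 2) + 1)} :=
    MeasurableSet.univ_pi' fun i => measurableSet_Ioc
  rw [setIntegral_congr_fun hms h1, setIntegral_eq_integral_of_forall_compl_eq_zero]
  · have h2 : ∀ x : Fin d → ℝ, character (latticePoint (-n)) (WithLp.toLp 2 x) * rescale h x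
        = (fun t : Space d => character (-freq n) (period d • t) * h (period d • t))
          (WithLp.toLp 2 x) := fun x => by
      simp only [rescale]
      congr 1
      rw [character, character, latticePoint_neg, freq, inner_smul_left, inner_neg_right,
        inner_neg_right, inner_smul_right]
      simp only [conj_trivial]
      congr 3
      field_simp
    simp only [h2]
    have h3 := (EuclideanSpace.volume_preserving_symm_measurableEquiv_toLp (Fin d)).symm.integral_comp'
      (g := fun t : Space d => character (-freq n) (period d • t) * h (period d • t))
    have h4 : ∫ x : Fin d → ℝ, (fun t : Space d => character (-freq n) (period d • t)
        * h (period d • t)) (WithLp.toLp 2 x)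
        = ∫ t : Space d, character (-freq n) (period d • t) * h (period d • t) := h3
    rw [h4, Measure.integral_comp_smul volume
      (fun t : Space d => character (-freq n) t * h t) (period d),
      ← fourier_eq_integral_character, abs_of_nonneg (by positivity)]
    simp
  · intro x hx
    have : rescale h x = 0 := by
      by_contra h2
      apply hx
      intro i
      have h3 := abs_lt.1 (abs_lt_of_rescale_ne_zero hsupp h2 i)
      exact ⟨h3.1, by linarith⟩
    rw [this, mul_zero]

/-- The expansion of a function with support in a ball into a Fourier series. -/
theorem hasSum_fourier_of_support {h : 𝓢(Space d, ℂ)}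
    (hsupp : ∀ t, h t ≠ 0 → ‖t‖ ≤ cutoffRadius d) {t : Space d} (ht : ‖t‖ ≤ cutoffRadius d) :
    HasSum (fun n : Fin d → ℤ =>
      ((period d ^ d : ℝ)⁻¹ : ℂ) * 𝓕 h (freq n) * character (freq n) t) (h t) := by
  have hL := period_pos d
  obtain ⟨N, hN⟩ := exists_summable_lattice d
  let H : C(UnitAddTorus (Fin d), ℂ) := ⟨torusFun h, continuous_torusFun hsupp⟩
  have hsum : Summable (UnitAddTorus.mFourierCoeff H) := by
    refine Summable.of_norm (summable_of_decay (hN N le_rfl) (κ := 2 ^ N * snorm N (𝓕 h))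
      (fun _ => norm_nonneg _) fun n => ?_)
    have h1 : UnitAddTorus.mFourierCoeff H n = _ := mFourierCoeff_torusFun hsupp n
    refine le_trans ?_ (norm_apply_le_snorm (𝓕 h) (freq n) N)
    rw [h1, norm_mul]
    gcongr
    refine mul_le_of_le_one_left (norm_nonneg _) ?_
    rw [Complex.norm_real, norm_inv]
    refine inv_le_one_of_one_le₀ ?_
    rw [Real.norm_of_nonneg (by positivity)]
    exact one_le_pow₀ (one_le_period d)
  have h2 := UnitAddTorus.hasSum_mFourier_series_apply_of_summable hsum
    (fun i => (((period d)⁻¹ * t i : ℝ) : UnitAddCircle))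
  have h3 : H (fun i => (((period d)⁻¹ * t i : ℝ) : UnitAddCircle)) = h t := by
    have h4 : H (fun i => (((period d)⁻¹ * t i : ℝ) : UnitAddCircle))
      = periodize h (fun i => (period d)⁻¹ * t i) := torusFun_coe h _
    rw [h4, periodize_eq hsupp]
    · unfold rescale
      congr 1
      ext i
      simp [mul_inv_cancel_left₀ hL.ne']
    · intro i
      have h5 : |t i| ≤ cutoffRadius d := (PiLp.norm_apply_le t i).trans ht
      rw [abs_mul, abs_of_pos (by positivity), inv_mul_le_iff₀ hL]
      refine h5.trans ?_
      unfold period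
      linarith
  rw [h3] at h2
  refine h2.congr_fun fun n => ?_
  have h1 : UnitAddTorus.mFourierCoeff H n = _ := mFourierCoeff_torusFun hsupp n
  rw [h1, mFourier_coe, smul_eq_mul]
  congr 1
  · simp
  · rw [character, character, freq, inner_smul_right]
    have : (WithLp.toLp 2 fun i => (period d)⁻¹ * t i : Space d) = (period d)⁻¹ • t := by
      ext i; simp
    rw [this, inner_smul_left]
    simp

end FourierSeries

/-! ### Expansion of translates of a window -/

section Windows

variable {d : ℕ}

/-- A bump function that equals one on a neighbourhood of the cube `[-1, 1]^d`. -/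
def cutoffBump (d : ℕ) : ContDiffBump (0 : Space d) where
  rIn := Real.sqrt d + 1
  rOut := cutoffRadius d
  rIn_pos := by positivity
  rIn_lt_rOut := by unfold cutoffRadius; linarith

/-- A test function that equals one on a neighbourhood of the cube `[-1, 1]^d`. -/
def cutoff (d : ℕ) : 𝓢(Space d, ℂ) :=
  HasCompactSupport.toSchwartzMap (f := fun x => ((cutoffBump d x : ℝ) : ℂ))
    ((cutoffBump d).hasCompactSupport.comp_left Complex.ofReal_zero)
    (Complex.ofRealCLM.contDiff.comp (cutoffBump d).contDiff)

theorem cutoff_apply (t : Space d) : cutoff d t = ((cutoffBump d t : ℝ) : ℂ) := rfl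

theorem cutoff_eq_one {t : Space d} (ht : ‖t‖ ≤ Real.sqrt d) : cutoff d t = 1 := by
  rw [cutoff_apply, (cutoffBump d).one_of_mem_closedBall, Complex.ofReal_one]
  rw [Metric.mem_closedBall, dist_zero_right]
  change ‖t‖ ≤ Real.sqrt d + 1
  linarith

theorem norm_le_of_cutoff_ne_zero {t : Space d} (ht : cutoff d t ≠ 0) :
    ‖t‖ ≤ cutoffRadius d := by
  by_contra h
  apply ht
  rw [cutoff_apply, (cutoffBump d).zero_of_le_dist, Complex.ofReal_zero]
  rw [dist_zero_right]
  exact (not_le.1 h).le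

/-- The function `x ↦ ∫ χ(t) w(t - x) exp(-2πi t·ζ) dt`, where `χ` is the cutoff function. -/
def coef (w : 𝓢(Space d, ℂ)) (ζ : Space d) : 𝓢(Space d, ℂ) :=
  𝓕⁻ (schwartzMul (𝓕⁻ w) (schwartzTranslate (-ζ) (𝓕 (cutoff d))))

/-- The convolution of two Schwartz functions. -/
def sconv (w θ : 𝓢(Space d, ℂ)) : 𝓢(Space d, ℂ) := 𝓕 (schwartzMul (𝓕⁻ w) (𝓕⁻ θ))

theorem schwartzMul_comm (a b : 𝓢(Space d, ℂ)) : schwartzMul a b = schwartzMul b a := by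
  ext x; rw [schwartzMul_apply, schwartzMul_apply, mul_comm]

/-- This exhibits `x ↦ w (t - x)` as an inverse Fourier transform, the form needed to apply
Parseval's formula to a convolution. -/
theorem fourierInv_modulate_fourierInv (w : 𝓢(Space d, ℂ)) (t x : Space d) :
    𝓕⁻ (schwartzModulate (-t) (𝓕⁻ w)) x = w (t - x) := by
  have h : 𝓕⁻ (schwartzModulate (-t) (𝓕⁻ w)) x = 𝓕 (schwartzModulate (-t) (𝓕⁻ w)) (-x) := by
    rw [fourierInv_eq_integral_character, fourier_eq_integral_character]
    refine integral_congr_ae (Eventually.of_forall fun y => ?_)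
    simp only [neg_neg]
    rw [character_comm]
  rw [h, fourier_modulate, FourierTransform.fourier_fourierInv_eq, schwartzTranslate_apply]
  congr 1
  abel

theorem sconv_apply (w θ : 𝓢(Space d, ℂ)) (t : Space d) :
    sconv w θ t = ∫ x, w (t - x) * θ x := by
  have h := SchwartzMap.integral_fourierInv_mul_eq θ (schwartzModulate (-t) (𝓕⁻ w))
  rw [sconv, fourier_eq_integral_character]
  simp only [fourierInv_modulate_fourierInv] at h
  simp only [schwartzMul_apply]
  simp only [mul_comm (w _)]
  rw [← h]
  refine integral_congr_ae (Eventually.of_forall fun y => ?_)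
  simp only [schwartzModulate_apply]
  ring

theorem translate_fourier_cutoff (ζ : Space d) :
    schwartzTranslate (-ζ) (𝓕 (cutoff d)) = 𝓕 (schwartzModulate (-ζ) (cutoff d)) :=
  (fourier_modulate _ _).symm

/-- Parseval twice: the pairings with `coef w ζ` are the values at `ζ` of the Fourier transform of
the localized convolution `χ · (w * θ)`. -/
theorem integral_coef_mul (w θ : 𝓢(Space d, ℂ)) (ζ : Space d) :
    ∫ x, coef w ζ x * θ x = 𝓕 (schwartzMul (cutoff d) (sconv w θ)) ζ := by
  rw [coef, SchwartzMap.integral_fourierInv_mul_eq, fourier_eq_integral_character,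
    translate_fourier_cutoff]
  have h := SchwartzMap.integral_fourier_mul_eq (schwartzModulate (-ζ) (cutoff d))
    (schwartzMul (𝓕⁻ w) (𝓕⁻ θ))
  calc ∫ x, schwartzMul (𝓕⁻ w) (𝓕 (schwartzModulate (-ζ) (cutoff d))) x * 𝓕⁻ θ x
      = ∫ x, 𝓕 (schwartzModulate (-ζ) (cutoff d)) x * schwartzMul (𝓕⁻ w) (𝓕⁻ θ) x := by
        refine integral_congr_ae (Eventually.of_forall fun y => ?_)
        simp only [schwartzMul_apply]
        ring
    _ = _ := by
        rw [h]
        refine integral_congr_ae (Eventually.of_forall fun y => ?_)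
        simp only [schwartzMul_apply, schwartzModulate_apply, sconv]
        ring

/-- On the Fourier side `coef w ζ` is the fixed function `𝓕⁻ w` times the translate by `-ζ` of `𝓕
χ`, and these two drift apart as `ζ` grows. -/
theorem exists_coef_decay (w : 𝓢(Space d, ℂ)) (N K : ℕ) :
    ∃ C : ℝ, 0 < C ∧ ∀ ζ, (1 + ‖ζ‖) ^ K * snorm N (coef w ζ) ≤ C := by
  obtain ⟨M, C, hC, h⟩ := exists_snorm_fourierInv_le (d := d) N
  set B := 2 ^ M * 4 ^ (M + K) * snorm (M + K) (𝓕⁻ w) * snorm (M + K) (𝓕 (cutoff d))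
  refine ⟨C * B + 1, ?_, fun ζ => ?_⟩
  · have : 0 ≤ B := by positivity
    positivity
  · have h1 := snorm_schwartzMul_translate_le M K (𝓕⁻ w) (𝓕 (cutoff d)) (-ζ)
    rw [norm_neg] at h1
    calc (1 + ‖ζ‖) ^ K * snorm N (coef w ζ) ≤ (1 + ‖ζ‖) ^ K * (C * snorm M _) := by
          gcongr; exact h _
      _ = C * ((1 + ‖ζ‖) ^ K * snorm M _) := by ring
      _ ≤ C * B := by gcongr
      _ ≤ C * B + 1 := by linarith

/-- The separation of variables: near the origin the cutoff equals one, so the Fourier series of `χ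
· (w * θ)` represents the convolution itself. The variable `t` enters only through the characters,
and `θ` only through pairings. -/
theorem hasSum_coef (w θ : 𝓢(Space d, ℂ)) {t : Space d} (ht : ‖t‖ ≤ Real.sqrt d) :
    HasSum (fun n : Fin d → ℤ => ((period d ^ d : ℝ)⁻¹ : ℂ) * (∫ x, coef w (freq n) x * θ x)
      * character (freq n) t) (∫ x, w (t - x) * θ x) := by
  have h := hasSum_fourier_of_support (h := schwartzMul (cutoff d) (sconv w θ)) (t := t) (fun s hs => by
    rw [schwartzMul_apply] at hs
    exact norm_le_of_cutoff_ne_zero (left_ne_zero_of_mul hs))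
    (ht.trans (by unfold cutoffRadius; linarith))
  rw [schwartzMul_apply, cutoff_eq_one ht, one_mul, sconv_apply] at h
  simpa only [integral_coef_mul] using h

theorem exists_snorm_sconv_le (w : 𝓢(Space d, ℂ)) (M : ℕ) :
    ∃ (N : ℕ) (C : ℝ), 0 < C ∧ ∀ θ, snorm M (sconv w θ) ≤ C * snorm N θ := by
  obtain ⟨N₁, C₁, hC₁, h₁⟩ := exists_snorm_fourier_le (d := d) M
  obtain ⟨N₂, C₂, hC₂, h₂⟩ := exists_snorm_fourierInv_le (d := d) N₁
  set B := snorm N₁ (𝓕⁻ w)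
  have hB : 0 ≤ B := apply_nonneg _ _
  refine ⟨N₂, C₁ * (2 ^ N₁ * 4 ^ N₁ * (B + 1) * C₂), by positivity, fun θ => ?_⟩
  calc snorm M (sconv w θ) ≤ C₁ * snorm N₁ (schwartzMul (𝓕⁻ w) (𝓕⁻ θ)) := h₁ _
    _ ≤ C₁ * (2 ^ N₁ * 4 ^ N₁ * B * snorm N₁ (𝓕⁻ θ)) := by
        gcongr; exact snorm_schwartzMul_le _ _ _
    _ ≤ C₁ * (2 ^ N₁ * 4 ^ N₁ * (B + 1) * (C₂ * snorm N₂ θ)) := by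
        gcongr
        · linarith
        · exact h₂ θ
    _ = _ := by ring

end Windows

/-! ### The short-time Fourier transform as a tempered distribution -/

section STFT

variable {d : ℕ}

theorem integrable_one_add_norm_pow_mul {D : Type*} [NormedAddCommGroup D] [NormedSpace ℝ D]
    [MeasurableSpace D] [BorelSpace D] [SecondCountableTopology D] (μ : Measure D)
    [μ.HasTemperateGrowth] (ψ : 𝓢(D, ℂ)) (M : ℕ) :
    Integrable (fun x => (1 + ‖x‖) ^ M * ‖ψ x‖) μ := by
  have h : ∀ x : D, (1 + ‖x‖) ^ M * ‖ψ x‖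
      = ∑ i ∈ Finset.range (M + 1), (M.choose i : ℝ) * (‖x‖ ^ i * ‖ψ x‖) := fun x => by
    rw [add_comm, add_pow, Finset.sum_mul]
    refine Finset.sum_congr rfl fun i _ => ?_
    simp only [one_pow]
    ring
  simp only [h]
  exact integrable_finsetSum _ fun i _ => (ψ.integrable_pow_mul μ i).const_mul _

theorem stft_eq (g : 𝓢(Space d, ℂ)) (f : Tempered d) (z : Space d × Space d) :
    stft g f z = f (schwartzModulate (-z.2) (schwartzTranslate z.1 (schwartzConj g))) := by
  unfold stft
  congr 1
  ext t
  simp only [schwartzConj_apply, schwartzModulate_apply, schwartzTranslate_apply, map_mul,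
    character_neg]

theorem continuous_stft (g : 𝓢(Space d, ℂ)) (f : Tempered d) : Continuous (stft g f) := by
  have h : stft g f = fun z : Space d × Space d =>
      f (schwartzModulate (-z.2) (schwartzTranslate z.1 (schwartzConj g))) :=
    funext (stft_eq g f)
  rw [h]
  have h1 : Continuous fun z : Space d × Space d => (z.1, -z.2) := by fun_prop
  have h2 := (continuous_schwartzModulate_translate (schwartzConj g)).comp h1
  simp only [Function.comp_def] at h2
  have hf : Continuous (fun θ : 𝓢(Space d, ℂ) => f θ) := map_continuous f
  exact hf.comp h2

theorem exists_stft_le (g : 𝓢(Space d, ℂ)) (f : Tempered d) :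
    ∃ (N : ℕ) (C : ℝ), 0 < C ∧ ∀ z, ‖stft g f z‖ ≤ C * (1 + ‖z‖) ^ N := by
  obtain ⟨N₁, C₁, hC₁, h₁⟩ := exists_norm_apply_le_snorm f
  obtain ⟨N₂, C₂, hC₂, h₂⟩ := exists_snorm_modulate_le (d := d) N₁
  set B := snorm N₂ (schwartzConj g)
  have hB : 0 ≤ B := apply_nonneg _ _
  refine ⟨N₂ + N₂, C₁ * C₂ * 2 ^ N₂ * (B + 1), by positivity, fun z => ?_⟩
  rw [stft_eq]
  calc _ ≤ C₁ * snorm N₁ (schwartzModulate (-z.2) (schwartzTranslate z.1 (schwartzConj g))) :=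
        h₁ _
    _ ≤ C₁ * (C₂ * (1 + ‖-z.2‖) ^ N₂ * snorm N₂ (schwartzTranslate z.1 (schwartzConj g))) := by
        gcongr; exact h₂ _ _
    _ ≤ C₁ * (C₂ * (1 + ‖-z.2‖) ^ N₂ * (2 ^ N₂ * (1 + ‖z.1‖) ^ N₂ * B)) := by
        gcongr; exact snorm_schwartzTranslate_le _ _ _
    _ ≤ C₁ * (C₂ * (1 + ‖z‖) ^ N₂ * (2 ^ N₂ * (1 + ‖z‖) ^ N₂ * (B + 1))) := by
        rw [norm_neg]
        gcongr
        · exact norm_snd_le z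
        · exact norm_fst_le z
        · linarith
    _ = _ := by rw [pow_add]; ring

instance : (volume : Measure (Space d × Space d)).HasTemperateGrowth :=
  have : (volume : Measure (Space d × Space d)).IsAddHaarMeasure :=
    inferInstanceAs (Measure.IsAddHaarMeasure
      ((volume : Measure (Space d)).prod (volume : Measure (Space d))))
  inferInstance

theorem integrable_stft_mul (g : 𝓢(Space d, ℂ)) (f : Tempered d)
    (Φ : 𝓢(Space d × Space d, ℂ)) : Integrable fun z => stft g f z * Φ z := by
  obtain ⟨N, C, hC, h⟩ := exists_stft_le g f
  refine ((integrable_one_add_norm_pow_mul volume Φ N).const_mul C).mono'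
    ((continuous_stft g f).mul Φ.continuous).aestronglyMeasurable
    (Eventually.of_forall fun z => ?_)
  rw [norm_mul, ← mul_assoc]
  gcongr
  exact h z

theorem exists_isGivenBy_stft (g : 𝓢(Space d, ℂ)) (f : Tempered d) :
    ∃ v : Tempered2 d, IsGivenBy v (stft g f) := by
  obtain ⟨N, C, hC, h⟩ := exists_stft_le g f
  let μ : Measure (Space d × Space d) := volume
  have : μ.HasTemperateGrowth := inferInstanceAs (Measure.HasTemperateGrowth volume)
  -- Growth of order `N` is dominated through `∫ |Φ|` and `∫ |z|^N |Φ|`, which two orders of decay,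
  -- `I` and `N + I`, make finite; `I` is an integrable power for the measure.
  have hbd : ∃ (s : Finset (ℕ × ℕ)) (B : ℝ), 0 ≤ B ∧ ∀ Φ : 𝓢(Space d × Space d, ℂ),
      ‖∫ z, stft g f z * Φ z‖ ≤ B * (s.sup (schwartzSeminormFamily ℂ (Space d × Space d) ℂ)) Φ := by
    let I : ℕ := μ.integrablePower
    let J : ℝ := ∫ z, (1 + ‖z‖) ^ (-(I : ℝ)) ∂μ
    have hJ : 0 ≤ J := integral_nonneg fun z => by positivity
    refine ⟨{(0, 0), (N + I, 0), (I, 0)}, C * 2 ^ N * (2 ^ I * J * 2 + 2 ^ I * J * 2),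
      by positivity, fun Φ => ?_⟩
    set s : Finset (ℕ × ℕ) := {(0, 0), (N + I, 0), (I, 0)}
    set S := (s.sup (schwartzSeminormFamily ℂ (Space d × Space d) ℂ)) Φ
    have hmem : ∀ i ∈ s, SchwartzMap.seminorm ℂ i.1 i.2 Φ ≤ S := fun i hi =>
      Seminorm.le_def.1 (Finset.le_sup (f := schwartzSeminormFamily ℂ (Space d × Space d) ℂ) hi) Φ
    have h0 := hmem (0, 0) (by simp [s])
    have h1 := hmem (N + I, 0) (by simp [s])
    have h2 := hmem (I, 0) (by simp [s])
    have a0 := Φ.integral_pow_mul_iteratedFDeriv_le (𝕜 := ℂ) μ 0 0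
    have a1 := Φ.integral_pow_mul_iteratedFDeriv_le (𝕜 := ℂ) μ N 0
    simp only [norm_iteratedFDeriv_zero, zero_add] at a0 a1
    have i0 := Φ.integrable_pow_mul μ 0
    have i1 := Φ.integrable_pow_mul μ N
    calc ‖∫ z, stft g f z * Φ z‖ ≤ ∫ z, C * 2 ^ N * (‖z‖ ^ 0 * ‖Φ z‖ + ‖z‖ ^ N * ‖Φ z‖) ∂μ := by
          refine norm_integral_le_of_norm_le ((i0.add i1).const_mul _)
            (Eventually.of_forall fun z => ?_)
          have hz : (1 + ‖z‖) ^ N ≤ 2 ^ N * (1 + ‖z‖ ^ N) := by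
            have := add_pow_le (zero_le_one (α := ℝ)) (norm_nonneg z) N
            rw [one_pow] at this
            refine this.trans ?_
            gcongr
            · norm_num
            · omega
          calc ‖stft g f z * Φ z‖ ≤ (C * (2 ^ N * (1 + ‖z‖ ^ N))) * ‖Φ z‖ := by
                rw [norm_mul]
                gcongr
                exact (h z).trans (by gcongr)
            _ = _ := by ring
      _ = C * 2 ^ N * (∫ z, ‖z‖ ^ 0 * ‖Φ z‖ ∂μ + ∫ z, ‖z‖ ^ N * ‖Φ z‖ ∂μ) := by
          rw [integral_const_mul, integral_add i0 i1]
      _ ≤ C * 2 ^ N * (2 ^ I * J * (S + S) + 2 ^ I * J * (S + S)) := by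
          gcongr
          · refine a0.trans ?_
            change 2 ^ I * J * _ ≤ _
            gcongr
          · refine a1.trans ?_
            change 2 ^ I * J * _ ≤ _
            gcongr
      _ = _ := by ring
  let v : 𝓢(Space d × Space d, ℂ) →L[ℂ] ℂ :=
    SchwartzMap.mkCLMtoNormedSpace (fun Φ => ∫ z, stft g f z * Φ z)
      (fun Φ Ψ => by
        rw [← integral_add (integrable_stft_mul g f Φ) (integrable_stft_mul g f Ψ)]
        simp [mul_add])
      (fun c Φ => by
        rw [RingHom.id_apply, smul_eq_mul, ← integral_const_mul]
        refine integral_congr_ae (Eventually.of_forall fun z => ?_)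
        simp only [_root_.smul_apply, smul_eq_mul]
        ring)
      hbd
  refine ⟨ContinuousLinearMap.toPointwiseConvergenceCLM _ _ _ _ v, fun Φ =>
    ⟨integrable_stft_mul g f Φ, rfl⟩⟩

theorem continuous_schwartzMul_left (b : 𝓢(Space d, ℂ)) : Continuous fun a => schwartzMul a b := by
  simp only [schwartzMul_comm _ b]
  exact (SchwartzMap.smulLeftCLM ℂ b).continuous

/-- Superposing the modulations `M_{-ξ}` with density `ψ` amounts to multiplication by `𝓕 ψ`. -/
theorem integral_stft_mul_right (g : 𝓢(Space d, ℂ)) (f : Tempered d) (ψ : 𝓢(Space d, ℂ))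
    (x : Space d) : ∫ ξ, stft g f (x, ξ) * ψ ξ
      = f (schwartzMul (schwartzTranslate x (schwartzConj g)) (𝓕 ψ)) := by
  set w := schwartzTranslate x (schwartzConj g) with hw
  have hK : Continuous fun ξ : Space d => ψ ξ • schwartzModulate (-ξ) w :=
    ψ.continuous.smul ((continuous_schwartzModulate w).comp continuous_neg)
  have h := tempered_apply_integral (μ := volume) hK (fun N => ?_)
    (s := schwartzMul w (𝓕 ψ)) (fun t => ?_) f
  · rw [h.2]
    refine integral_congr_ae (Eventually.of_forall fun ξ => ?_)
    simp only [stft_eq, map_smul, smul_eq_mul]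
    ring
  · obtain ⟨M, C, hC, hM⟩ := exists_snorm_modulate_le (d := d) N
    refine ((integrable_one_add_norm_pow_mul volume ψ M).const_mul (C * snorm M w)).mono'
      ((continuous_snorm N).comp hK).aestronglyMeasurable (Eventually.of_forall fun ξ => ?_)
    rw [Real.norm_of_nonneg (apply_nonneg _ _), map_smul_eq_mul]
    calc ‖ψ ξ‖ * snorm N (schwartzModulate (-ξ) w)
        ≤ ‖ψ ξ‖ * (C * (1 + ‖-ξ‖) ^ M * snorm M w) := by gcongr; exact hM _ _
      _ = _ := by rw [norm_neg]; ring
  · rw [schwartzMul_apply, fourier_eq_integral_character, ← integral_const_mul]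
    refine integral_congr_ae (Eventually.of_forall fun ξ => ?_)
    simp only [_root_.smul_apply, schwartzModulate_apply, smul_eq_mul]
    rw [character_neg, character_neg, character_comm]
    ring

/-- Superposing the translates of the window with density `θ` produces its convolution with `θ`;
together with the integration over `ξ` this computes the pairing with a tensor product. -/
theorem integral_tempered_schwartzMul_translate (w θ b : 𝓢(Space d, ℂ)) (f : Tempered d) :
    ∫ x, f (schwartzMul (schwartzTranslate x w) b) * θ x = f (schwartzMul (sconv w θ) b) := by
  have hK : Continuous fun x : Space d => θ x • schwartzMul (schwartzTranslate x w) b :=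
    θ.continuous.smul ((continuous_schwartzMul_left b).comp (continuous_schwartzTranslate w))
  have h := tempered_apply_integral (μ := volume) hK (fun N => ?_)
    (s := schwartzMul (sconv w θ) b) (fun t => ?_) f
  · rw [h.2]
    refine integral_congr_ae (Eventually.of_forall fun ξ => ?_)
    simp only [map_smul, smul_eq_mul]
    ring
  · refine ((integrable_one_add_norm_pow_mul volume θ N).const_mul
      (2 ^ N * 4 ^ N * (2 ^ N * snorm N w) * snorm N b)).mono'
      ((continuous_snorm N).comp hK).aestronglyMeasurable (Eventually.of_forall fun x => ?_)
    rw [Real.norm_of_nonneg (apply_nonneg _ _), map_smul_eq_mul]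
    calc ‖θ x‖ * snorm N (schwartzMul (schwartzTranslate x w) b)
        ≤ ‖θ x‖ * (2 ^ N * 4 ^ N * (2 ^ N * (1 + ‖x‖) ^ N * snorm N w) * snorm N b) := by
          gcongr
          refine (snorm_schwartzMul_le _ _ _).trans ?_
          gcongr
          exact snorm_schwartzTranslate_le _ _ _
      _ = _ := by ring
  · rw [schwartzMul_apply, sconv_apply, ← integral_mul_const]
    refine integral_congr_ae (Eventually.of_forall fun ξ => ?_)
    simp only [_root_.smul_apply, schwartzMul_apply, schwartzTranslate_apply, smul_eq_mul]
    ring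

/-- The pairing of the short-time Fourier transform with a tensor product. -/
theorem isGivenBy_stft_apply_tensor {g : 𝓢(Space d, ℂ)} {f : Tempered d} {v : Tempered2 d}
    (hv : IsGivenBy v (stft g f)) (θ ψ : 𝓢(Space d, ℂ)) :
    v (schwartzTensor θ ψ) = f (schwartzMul (sconv (schwartzConj g) θ) (𝓕 ψ)) := by
  obtain ⟨h1, h2⟩ := hv (schwartzTensor θ ψ)
  rw [h2]
  have h3 := integral_prod _ h1
  rw [← integral_tempered_schwartzMul_translate]
  refine h3.trans ?_
  refine integral_congr_ae (Eventually.of_forall fun x => ?_)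
  simp only
  rw [← integral_stft_mul_right, ← integral_mul_const]
  refine integral_congr_ae (Eventually.of_forall fun ξ => ?_)
  change stft g f (x, ξ) * (θ x * ψ ξ) = _
  ring

end STFT

/-! ### Test functions and products -/

section Products

variable {d : ℕ}

theorem testToSchwartz_testMul (χ ψ : Test d) :
    testToSchwartz (testMul χ ψ) = schwartzMul (testToSchwartz χ) (testToSchwartz ψ) := by
  ext x
  rw [schwartzMul_apply, testToSchwartz_apply, testToSchwartz_apply, testToSchwartz_apply]
  exact Complex.ofReal_mul _ _

theorem testToSchwartz_testTranslate (x : Space d) (χ : Test d) :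
    testToSchwartz (testTranslate x χ) = schwartzTranslate x (testToSchwartz χ) := by
  ext t; rfl

/-- The product of a test function and the real part of a Schwartz function. -/
def testMulRe (χ : Test d) (θ : 𝓢(Space d, ℂ)) : Test d where
  toFun x := χ x * (θ x).re
  contDiff' := χ.contDiff.mul (Complex.reCLM.contDiff.comp (θ.smooth ⊤))
  hasCompactSupport' := χ.hasCompactSupport.mul_right
  tsupport_subset' := by simp

/-- The product of a test function and the imaginary part of a Schwartz function. -/
def testMulIm (χ : Test d) (θ : 𝓢(Space d, ℂ)) : Test d where
  toFun x := χ x * (θ x).im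
  contDiff' := χ.contDiff.mul (Complex.imCLM.contDiff.comp (θ.smooth ⊤))
  hasCompactSupport' := χ.hasCompactSupport.mul_right
  tsupport_subset' := by simp

/-- Test functions are real-valued, so a complex Schwartz multiplier has to be split to reach the
domain of a distribution. -/
theorem schwartzMul_testToSchwartz (χ : Test d) (θ : 𝓢(Space d, ℂ)) :
    schwartzMul (testToSchwartz χ) θ
      = testToSchwartz (testMulRe χ θ) + Complex.I • testToSchwartz (testMulIm χ θ) := by
  ext x
  have h1 : testToSchwartz (testMulRe χ θ) x = ((χ x * (θ x).re : ℝ) : ℂ) := rfl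
  have h2 : testToSchwartz (testMulIm χ θ) x = ((χ x * (θ x).im : ℝ) : ℂ) := rfl
  rw [schwartzMul_apply, add_apply, _root_.smul_apply, h1, h2, testToSchwartz_apply]
  conv_lhs => rw [← Complex.re_add_im (θ x)]
  push_cast
  rw [smul_eq_mul]
  ring

variable (φ : UnityGenerator d)

/-- The translate `φ_k`, as a Schwartz function. -/
def cell (k : Fin d → ℤ) : 𝓢(Space d, ℂ) :=
  schwartzTranslate (latticePoint k) (testToSchwartz φ.toTest)

theorem cell_apply (k : Fin d → ℤ) (x : Space d) :
    cell φ k x = ((φ.toTest (x - latticePoint k) : ℝ) : ℂ) := rfl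

theorem testToSchwartz_cell (k : Fin d → ℤ) :
    testToSchwartz (testTranslate (latticePoint k) φ.toTest) = cell φ k :=
  testToSchwartz_testTranslate _ _

theorem mem_cube_of_cell_ne_zero {k : Fin d → ℤ} {x : Space d} (h : cell φ k x ≠ 0) :
    x ∈ cube k := by
  rw [cell_apply] at h
  have h1 : φ.toTest (x - latticePoint k) ≠ 0 := fun h2 => h (by rw [h2, Complex.ofReal_zero])
  have h2 := φ.tsupport_subset (subset_tsupport _ h1)
  exact fun i => ⟨(h2 i).1.le, (h2 i).2.le⟩

theorem hasSum_cell (x : Space d) : HasSum (fun k => cell φ k x) 1 := by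
  have h := (φ.hasSum x).mapL Complex.ofRealCLM
  simpa [cell_apply] using h

/-- The translates of `φ` move away from `θ`, so the products decay faster than any power of the
lattice point. The partition of unity hence converges on Schwartz functions in every seminorm. -/
theorem summable_snorm_cell (θ : 𝓢(Space d, ℂ)) (N : ℕ) :
    Summable fun k => snorm N (schwartzMul (cell φ k) θ) := by
  obtain ⟨K, hK⟩ := exists_summable_lattice d
  refine Summable.of_nonneg_of_le (fun _ => apply_nonneg _ _) (fun k => ?_)
    ((hK K le_rfl).mul_left (2 ^ N * 4 ^ (N + K) * snorm (N + K) θ *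
      snorm (N + K) (testToSchwartz φ.toTest)))
  rw [← div_eq_mul_inv, le_div_iff₀ (by positivity), mul_comm, schwartzMul_comm]
  exact snorm_schwartzMul_translate_le N K θ _ _

theorem hasSum_tempered_cell (f : Tempered d) (θ : 𝓢(Space d, ℂ)) :
    HasSum (fun k => f (schwartzMul (cell φ k) θ)) (f θ) := by
  refine tempered_hasSum (summable_snorm_cell φ θ) (fun t => ?_) f
  simpa only [schwartzMul_apply, one_mul] using (hasSum_cell φ t).mul_right (θ t)

/-- The product of a Schwartz function and a tempered distribution. -/
def temperedMul (a : 𝓢(Space d, ℂ)) (f : Tempered d) : Tempered d :=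
  TemperedDistribution.smulLeftCLM ℂ a f

theorem temperedMul_apply (a : 𝓢(Space d, ℂ)) (f : Tempered d) (θ : 𝓢(Space d, ℂ)) :
    temperedMul a f θ = f (schwartzMul a θ) := rfl

/-- The partition of unity writes a Schwartz function as a convergent series of complex combinations
of test functions, so a tempered distribution is determined by its restriction. -/
theorem restrict_injective (φ : UnityGenerator d) : Function.Injective (restrict (d := d)) := by
  intro f f' h
  ext θ
  refine (hasSum_tempered_cell φ f θ).unique ?_
  refine (hasSum_tempered_cell φ f' θ).congr_fun fun k => ?_
  have h1 : ∀ ψ : Test d, f (testToSchwartz ψ) = f' (testToSchwartz ψ) := fun ψ => by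
    rw [← restrict_apply, ← restrict_apply, h]
  rw [← testToSchwartz_cell, schwartzMul_testToSchwartz, map_add, map_add, map_smul, map_smul,
    h1, h1]

variable {E : Type*} [NormedAddCommGroup E] [NormedSpace ℂ E] {ι : E →L[ℂ] Tempered d}

theorem isProduct_restrict_iff (φ : UnityGenerator d) {χ : Test d} {f : Tempered d} {e : E} :
    IsProduct ι χ (restrict f) e ↔ ι e = temperedMul (testToSchwartz χ) f := by
  constructor
  · intro h
    refine restrict_injective φ ?_
    ext ψ
    rw [h ψ, restrict_apply, restrict_apply, testToSchwartz_testMul, temperedMul_apply]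
  · intro h ψ
    rw [h, restrict_apply, restrict_apply, testToSchwartz_testMul, temperedMul_apply]

theorem IsProduct.unique (φ : UnityGenerator d) (hι : Function.Injective ι) {χ : Test d} {T : Distr d} {e e' : E}
    (h : IsProduct ι χ T e) (h' : IsProduct ι χ T e') : e = e' := by
  refine hι (restrict_injective φ ?_)
  ext ψ
  rw [h ψ, h' ψ]

theorem localNorm_eq (φ : UnityGenerator d) (hι : Function.Injective ι) {χ : Test d} {T : Distr d} {e : E}
    (h : IsProduct ι χ T e) : localNorm ι χ T = ‖e‖ₑ := by
  refine le_antisymm (iInf₂_le e h) (le_iInf₂ fun e' he' => ?_)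
  rw [h.unique φ hι he']

/-- The cutoff function, as a test function. -/
def cutoffTest (d : ℕ) : Test d where
  toFun x := cutoffBump d x
  contDiff' := (cutoffBump d).contDiff
  hasCompactSupport' := (cutoffBump d).hasCompactSupport
  tsupport_subset' := by simp

theorem testToSchwartz_cutoffTest : testToSchwartz (cutoffTest d) = cutoff d := rfl

/-- The element `e` is supported where the translate of the cutoff function is one. -/
def IsLocal (ι : E →L[ℂ] Tempered d) (k : Fin d → ℤ) (e : E) : Prop :=
  ∀ θ, ι e (schwartzMul (schwartzTranslate (latticePoint k) (cutoff d)) θ) = ι e θ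

theorem cell_mul_cutoff (k : Fin d → ℤ) (x : Space d) :
    φ.toTest (x - latticePoint k) * cutoffTest d (x - latticePoint k)
      = φ.toTest (x - latticePoint k) := by
  by_cases h : cell φ k x = 0
  · rw [cell_apply, Complex.ofReal_eq_zero] at h
    rw [h, zero_mul]
  · have h1 := cutoff_eq_one (norm_le_of_mem_cube (mem_cube_of_cell_ne_zero φ h))
    rw [cutoff_apply] at h1
    have h2 : cutoffTest d (x - latticePoint k) = 1 := by exact_mod_cast h1
    rw [h2, mul_one]

/-- The cutoff is one on the support of `φ`, hence it may be inserted without changing the product.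
-/
theorem IsProduct.isLocal {k : Fin d → ℤ} {T : Distr d} {e : E}
    (h : IsProduct ι (testTranslate (latticePoint k) φ.toTest) T e) : IsLocal ι k e := by
  intro θ
  have h1 : temperedMul (schwartzTranslate (latticePoint k) (cutoff d)) (ι e) = ι e := by
    refine restrict_injective φ ?_
    ext ψ
    rw [restrict_apply, temperedMul_apply, ← testToSchwartz_cutoffTest,
      ← testToSchwartz_testTranslate, ← testToSchwartz_testMul, ← restrict_apply, h, h]
    congr 1
    ext x
    change φ.toTest (x - latticePoint k) * (cutoffTest d (x - latticePoint k) * ψ x)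
      = φ.toTest (x - latticePoint k) * ψ x
    rw [← mul_assoc, cell_mul_cutoff]
  rw [← temperedMul_apply, h1]

end Products

/-! ### Estimates in TMIB spaces -/

section TMIB

variable {d : ℕ} {E : Type*} [NormedAddCommGroup E] [NormedSpace ℂ E] {ι : E →L[ℂ] Tempered d}

/-- The pairing with a Schwartz function, as a continuous linear form on `E`. -/
def pairingCLM (ι : E →L[ℂ] Tempered d) (θ : 𝓢(Space d, ℂ)) : E →L[ℂ] ℂ :=
  (PointwiseConvergenceCLM.evalCLM (RingHom.id ℂ) ℂ θ).comp ι

theorem pairingCLM_apply (θ : 𝓢(Space d, ℂ)) (e : E) : pairingCLM ι θ e = ι e θ := rfl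

/-- A Banach space that is continuously embedded in the tempered distributions is so by a jointly
continuous pairing. -/
theorem exists_pairing_le [CompleteSpace E] (ι : E →L[ℂ] Tempered d) :
    ∃ (N : ℕ) (C : ℝ), 0 < C ∧ ∀ e θ, ‖ι e θ‖ ≤ C * ‖e‖ * snorm N θ := by
  by_contra hcon
  push Not at hcon
  -- The index and the constant fail together along `N`. After normalization every `snorm M` is at
  -- most one on `θ' N` for `N ≥ M`, so the functionals are pointwise bounded on `E`; the uniform
  -- bound from Banach–Steinhaus contradicts the constants `N + 1`.
  choose e θ h using fun N : ℕ => hcon N (N + 1) (by positivity)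
  have hpos : ∀ N, 0 < snorm N (θ N) := fun N => by
    refine lt_of_le_of_ne (apply_nonneg _ _) fun h0 => ?_
    have h1 : θ N = 0 := by
      ext x
      have := norm_apply_le_snorm (θ N) x N
      rw [← h0, mul_zero] at this
      have h2 : 0 < (1 + ‖x‖) ^ N := by positivity
      have h3 : ‖θ N x‖ ≤ 0 := by
        by_contra h4
        exact absurd this (not_le.2 (mul_pos h2 (not_le.1 h4)))
      simpa using h3
    have h2 := h N
    rw [h1, map_zero, map_zero, norm_zero, mul_zero] at h2
    exact lt_irrefl _ h2
  let θ' : ℕ → 𝓢(Space d, ℂ) := fun N => ((snorm N (θ N))⁻¹ : ℂ) • θ N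
  have hθ' : ∀ N, snorm N (θ' N) = 1 := fun N => by
    simp only [θ', map_smul_eq_mul, norm_inv, Complex.norm_real, Real.norm_of_nonneg (hpos N).le]
    exact inv_mul_cancel₀ (hpos N).ne'
  obtain ⟨B, hB⟩ := banach_steinhaus (g := fun N => pairingCLM ι (θ' N)) (fun x => by
    obtain ⟨M, C, hC, hM⟩ := exists_norm_apply_le_snorm (ι x)
    refine ⟨C + ∑ N ∈ Finset.range M, ‖ι x (θ' N)‖, fun N => ?_⟩
    rw [pairingCLM_apply]
    by_cases hN : M ≤ N
    · calc ‖ι x (θ' N)‖ ≤ C * snorm M (θ' N) := hM _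
        _ ≤ C * snorm N (θ' N) := by gcongr; exact snorm_mono hN _
        _ = C := by rw [hθ', mul_one]
        _ ≤ _ := le_add_of_nonneg_right (Finset.sum_nonneg fun _ _ => norm_nonneg _)
    · refine le_trans ?_ (le_add_of_nonneg_left hC.le)
      exact Finset.single_le_sum (f := fun N => ‖ι x (θ' N)‖) (fun _ _ => norm_nonneg _)
        (Finset.mem_range.2 (not_le.1 hN)))
  obtain ⟨N, hN⟩ := exists_nat_gt B
  have h1 : ‖ι (e N) (θ' N)‖ ≤ B * ‖e N‖ :=
    ((pairingCLM ι (θ' N)).le_opNorm (e N)).trans (by gcongr; exact hB N)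
  have h2 : ‖ι (e N) (θ' N)‖ = (snorm N (θ N))⁻¹ * ‖ι (e N) (θ N)‖ := by
    simp only [θ', map_smul, norm_smul, norm_inv, Complex.norm_real,
      Real.norm_of_nonneg (hpos N).le]
  rw [h2, inv_mul_le_iff₀ (hpos N)] at h1
  have h3 := (h N).trans_le h1
  rw [mul_comm (snorm N (θ N))] at h3
  have h4 := lt_of_mul_lt_mul_right h3 (hpos N).le
  have h5 : B * ‖e N‖ ≤ ((N : ℝ) + 1) * ‖e N‖ := by gcongr; linarith
  exact absurd h4 (not_lt.2 h5)

/-- The operator norm is an infimum of admissible constants, so the bound is first obtained up to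
`ε`; dividing `ε` by `‖e‖` forces the separate treatment of `‖e‖ = 0`. -/
theorem norm_le_of_inducedOpNorm_le {S : Tempered d →L[ℂ] Tempered d} {B : ℝ} (hB : 0 ≤ B)
    (h : inducedOpNorm ι S ≤ ENNReal.ofReal B) {e e' : E} (he : ι e' = S (ι e)) :
    ‖e'‖ ≤ B * ‖e‖ := by
  by_cases he0 : ‖e‖ = 0
  · have h1 : inducedOpNorm ι S < ∞ := h.trans_lt ENNReal.ofReal_lt_top
    unfold inducedOpNorm at h1
    simp only [iInf_lt_iff] at h1
    obtain ⟨C, hC, -⟩ := h1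
    have := hC e e' he
    rw [he0, mul_zero] at this ⊢
    exact this
  have he1 : 0 < ‖e‖ := lt_of_le_of_ne (norm_nonneg _) (Ne.symm he0)
  refine le_of_forall_pos_le_add fun ε hε => ?_
  have h1 : inducedOpNorm ι S < ENNReal.ofReal (B + ε / ‖e‖) := h.trans_lt
    ((ENNReal.ofReal_lt_ofReal_iff (by positivity)).2 (by linarith [div_pos hε he1]))
  unfold inducedOpNorm at h1
  simp only [iInf_lt_iff] at h1
  obtain ⟨C, hC, hlt⟩ := h1
  have h2 : (C : ℝ) < B + ε / ‖e‖ := by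
    rw [ENNReal.ofReal, ENNReal.coe_lt_coe, ← NNReal.coe_lt_coe,
      Real.coe_toNNReal _ (by positivity)] at hlt
    exact hlt
  calc ‖e'‖ ≤ C * ‖e‖ := hC e e' he
    _ ≤ (B + ε / ‖e‖) * ‖e‖ := by gcongr
    _ = B * ‖e‖ + ε := by field_simp

theorem exists_modulate (hι : Function.Injective ι)
    (hmem : ∀ (ξ : Space d) (e : E), ∃ e' : E, ι e' = modulate ξ (ι e)) {C τ : ℝ} (hC : 0 < C)
    (h : ∀ ξ : Space d, modulationNorm ι ξ ≤ ENNReal.ofReal (C * (1 + ‖ξ‖) ^ τ)) :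
    ∃ M : Space d → E →ₗ[ℂ] E, (∀ ξ e, ι (M ξ e) = modulate ξ (ι e)) ∧
      ∀ ξ e, ‖M ξ e‖ ≤ C * (1 + ‖ξ‖) ^ τ * ‖e‖ := by
  choose m hm using hmem
  refine ⟨fun ξ => ⟨⟨m ξ, fun a b => hι ?_⟩, fun c a => hι ?_⟩, hm, fun ξ e => ?_⟩
  · rw [hm, map_add, map_add, map_add, hm, hm]
  · simp only [RingHom.id_apply]
    rw [hm, map_smul, map_smul, map_smul, hm]
  · have h1 := h (-ξ)
    unfold modulationNorm at h1
    rw [neg_neg, norm_neg] at h1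
    exact norm_le_of_inducedOpNorm_le (by positivity) h1 (hm ξ e)

/-- Localized elements pair with translates of Schwartz functions with rapid decay. -/
theorem exists_local_pairing_le [CompleteSpace E]
    (hmem : ∀ (x : Space d) (e : E), ∃ e' : E, ι e' = translate x (ι e)) {C₀ τ : ℝ}
    (hC₀ : 0 < C₀)
    (h : ∀ x : Space d, translationNorm ι x ≤ ENNReal.ofReal (C₀ * (1 + ‖x‖) ^ τ)) (K : ℕ) :
    ∃ (M : ℕ) (C : ℝ), 0 < C ∧ ∀ (k : Fin d → ℤ) (l : Space d) (e : E) (θ : 𝓢(Space d, ℂ)),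
      IsLocal ι k e → (1 + ‖l - latticePoint k‖) ^ K * ‖ι e (schwartzTranslate l θ)‖
        ≤ C * (1 + ‖latticePoint k‖) ^ τ * ‖e‖ * snorm M θ := by
  obtain ⟨N, C, hC, hN⟩ := exists_pairing_le ι
  set B := 2 ^ N * 4 ^ (N + K) * snorm (N + K) (cutoff d)
  have hB : 0 ≤ B := by positivity
  refine ⟨N + K, C * C₀ * (B + 1), by positivity, fun k l e θ he => ?_⟩
  -- Moving `e` to the origin costs a factor `(1 + |k|)^τ`. The cutoff can then be placed at the
  -- origin, where its product with a translate by `l - k` decays rapidly.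
  obtain ⟨e', he'⟩ := hmem (-latticePoint k) e
  have h1 : ‖e'‖ ≤ C₀ * (1 + ‖latticePoint k‖) ^ τ * ‖e‖ := by
    have := norm_le_of_inducedOpNorm_le (by positivity) (h (-latticePoint k)) he'
    rwa [norm_neg] at this
  have h2 : ι e (schwartzTranslate l θ)
      = ι e' (schwartzMul (cutoff d) (schwartzTranslate (l - latticePoint k) θ)) := by
    rw [he', ← he]
    change _ = ι e (schwartzTranslate (- -latticePoint k) _)
    congr 1
    ext x
    simp only [schwartzMul_apply, schwartzTranslate_apply, neg_neg]
    congr 2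
    abel
  have h3 := snorm_schwartzMul_translate_le N K (cutoff d) θ (l - latticePoint k)
  rw [h2]
  set s := snorm N (schwartzMul (cutoff d) (schwartzTranslate (l - latticePoint k) θ))
  calc (1 + ‖l - latticePoint k‖) ^ K * _
      ≤ (1 + ‖l - latticePoint k‖) ^ K * (C * ‖e'‖ * s) := by gcongr; exact hN _ _
    _ = C * ‖e'‖ * ((1 + ‖l - latticePoint k‖) ^ K * s) := by ring
    _ ≤ C * (C₀ * (1 + ‖latticePoint k‖) ^ τ * ‖e‖) * ((B + 1) * snorm (N + K) θ) := by
        refine mul_le_mul (mul_le_mul_of_nonneg_left h1 hC.le) (h3.trans ?_) (by positivity)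
          (by positivity)
        gcongr
        linarith
    _ = _ := by ring

end TMIB

/-! ### Sequence space inequalities -/

section Sequences

variable {κ : Type*} [MeasurableSpace κ] [MeasurableSingletonClass κ]

theorem eLpNorm_count_ennreal (x : κ → ℝ≥0∞) {p : ℝ≥0∞} (h0 : p ≠ 0) (hp : p ≠ ∞) :
    eLpNorm x p Measure.count = (∑' k, x k ^ p.toReal) ^ (1 / p.toReal) := by
  rw [eLpNorm_eq_lintegral_rpow_enorm_toReal h0 hp, lintegral_count]
  rfl

/-- A substitute for Young's inequality with non-conjugate exponents: with `m` the larger of the two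
powers, the product is at most `m ^ (P⁻¹ + Q⁻¹)`, and `m ≤ 1` allows lowering the exponent to one.
-/
theorem ennreal_mul_le_rpow_add_rpow {u v : ℝ≥0∞} (hu : u ≤ 1) (hv : v ≤ 1) {P Q : ℝ}
    (hP : 0 < P) (hQ : 0 < Q) (h : 1 ≤ P⁻¹ + Q⁻¹) : u * v ≤ u ^ P + v ^ Q := by
  set m := max (u ^ P) (v ^ Q) with hm
  have hm1 : m ≤ 1 := max_le (ENNReal.rpow_le_one hu hP.le) (ENNReal.rpow_le_one hv hQ.le)
  have h1 : u ≤ m ^ P⁻¹ := by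
    rw [← ENNReal.rpow_rpow_inv hP.ne' u]
    gcongr
    exact le_max_left _ _
  have h2 : v ≤ m ^ Q⁻¹ := by
    rw [← ENNReal.rpow_rpow_inv hQ.ne' v]
    gcongr
    exact le_max_right _ _
  calc u * v ≤ m ^ P⁻¹ * m ^ Q⁻¹ := mul_le_mul' h1 h2
    _ = m ^ (P⁻¹ + Q⁻¹) := (ENNReal.rpow_add_of_nonneg _ _ (by positivity) (by positivity)).symm
    _ ≤ m ^ (1 : ℝ) := ENNReal.rpow_le_rpow_of_exponent_ge hm1 h
    _ = m := ENNReal.rpow_one m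
    _ ≤ _ := max_le le_self_add le_add_self

theorem tsum_div_eLpNorm_rpow_le (x : κ → ℝ≥0∞) {p : ℝ≥0∞} (h0 : p ≠ 0) (hp : p ≠ ∞) :
    ∑' k, (x k / eLpNorm x p Measure.count) ^ p.toReal ≤ 1 := by
  have hP : 0 < p.toReal := ENNReal.toReal_pos h0 hp
  simp only [ENNReal.div_rpow_of_nonneg _ _ hP.le]
  simp only [div_eq_mul_inv]
  rw [ENNReal.tsum_mul_right]
  have : eLpNorm x p Measure.count ^ p.toReal = ∑' k, x k ^ p.toReal := by
    rw [eLpNorm_count_ennreal x h0 hp, one_div, ENNReal.rpow_inv_rpow hP.ne']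
  rw [← this]
  exact ENNReal.mul_inv_le_one _

theorem tsum_mul_le_top (x y : κ → ℝ≥0∞) :
    ∑' k, x k * y k ≤ eLpNorm x ∞ Measure.count * eLpNorm y 1 Measure.count := by
  rw [eLpNorm_one_eq_lintegral_enorm, lintegral_count, ← ENNReal.tsum_mul_left]
  refine ENNReal.tsum_le_tsum fun k => ?_
  exact mul_le_mul' (enorm_le_eLpNorm_count x k (by simp)) le_rfl

theorem ennreal_one_le_inv_add_inv_cases {p q : ℝ≥0∞} (hp : 1 ≤ p) (hq : 1 ≤ q)
    (h : 1 ≤ p⁻¹ + q⁻¹) : (p = ∞ ∧ q = 1) ∨ (p = 1 ∧ q = ∞) ∨ (p ≠ ∞ ∧ q ≠ ∞) := by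
  by_cases hp' : p = ∞
  · subst hp'
    rw [ENNReal.inv_top, zero_add, ENNReal.one_le_inv] at h
    exact Or.inl ⟨rfl, le_antisymm h hq⟩
  by_cases hq' : q = ∞
  · subst hq'
    rw [ENNReal.inv_top, add_zero, ENNReal.one_le_inv] at h
    exact Or.inr (Or.inl ⟨le_antisymm h hp, rfl⟩)
  · exact Or.inr (Or.inr ⟨hp', hq'⟩)

/-- Hölder's inequality for sequences, with exponents that need not be conjugate. -/
theorem tsum_mul_le_eLpNorm_mul_eLpNorm (x y : κ → ℝ≥0∞) {p q : ℝ≥0∞} (hp : 1 ≤ p) (hq : 1 ≤ q)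
    (h : 1 ≤ p⁻¹ + q⁻¹) :
    ∑' k, x k * y k ≤ 2 * (eLpNorm x p Measure.count * eLpNorm y q Measure.count) := by
  have htwo : ∀ a : ℝ≥0∞, a ≤ 2 * a := fun a => by
    rw [two_mul]; exact le_self_add
  rcases ennreal_one_le_inv_add_inv_cases hp hq h with ⟨rfl, rfl⟩ | ⟨rfl, rfl⟩ | ⟨hp', hq'⟩
  · exact (tsum_mul_le_top x y).trans (htwo _)
  · refine le_trans ?_ (htwo _)
    rw [mul_comm]
    simpa only [mul_comm] using tsum_mul_le_top y x
  have hp0 : p ≠ 0 := (one_pos.trans_le hp).ne'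
  have hq0 : q ≠ 0 := (one_pos.trans_le hq).ne'
  have hzero : ∀ (z : κ → ℝ≥0∞) {r : ℝ≥0∞}, r ≠ 0 → eLpNorm z r Measure.count = 0 →
      ∀ k, z k = 0 := fun z r hr hz k => by
    have := enorm_le_eLpNorm_count z k hr
    rw [hz] at this
    exact le_antisymm this bot_le
  by_cases hx0 : eLpNorm x p Measure.count = 0
  · simp [hzero x hp0 hx0]
  by_cases hy0 : eLpNorm y q Measure.count = 0
  · simp [hzero y hq0 hy0]
  by_cases hx1 : eLpNorm x p Measure.count = ∞
  · rw [hx1, ENNReal.top_mul hy0]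
    simp
  by_cases hy1 : eLpNorm y q Measure.count = ∞
  · rw [hy1, ENNReal.mul_top hx0]
    simp
  set a := eLpNorm x p Measure.count
  set b := eLpNorm y q Measure.count
  -- Both sequences are normalized, so their entries are at most one. The two sums of normalized
  -- powers are at most one each, whence the factor two.
  have hle : ∀ k, x k * y k
      ≤ a * b * ((x k / a) ^ p.toReal + (y k / b) ^ q.toReal) := fun k => by
    have h1 : x k / a ≤ 1 := ENNReal.div_le_of_le_mul
      (by rw [one_mul]; exact enorm_le_eLpNorm_count x k hp0)
    have h2 : y k / b ≤ 1 := ENNReal.div_le_of_le_mul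
      (by rw [one_mul]; exact enorm_le_eLpNorm_count y k hq0)
    have h3 : (1 : ℝ) ≤ p.toReal⁻¹ + q.toReal⁻¹ := by
      rw [← ENNReal.toReal_inv, ← ENNReal.toReal_inv, ← ENNReal.toReal_add (by simpa using hp0)
        (by simpa using hq0), ← ENNReal.toReal_one]
      exact ENNReal.toReal_mono (by simp [hp0, hq0]) h
    have h4 := ennreal_mul_le_rpow_add_rpow h1 h2 (ENNReal.toReal_pos hp0 hp')
      (ENNReal.toReal_pos hq0 hq') h3
    calc x k * y k = a * b * ((x k / a) * (y k / b)) := by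
          rw [mul_mul_mul_comm, ENNReal.mul_div_cancel hx0 hx1, ENNReal.mul_div_cancel hy0 hy1]
      _ ≤ _ := by gcongr
  refine (ENNReal.tsum_le_tsum hle).trans ?_
  rw [ENNReal.tsum_mul_left, ENNReal.tsum_add, mul_comm 2]
  gcongr
  rw [← one_add_one_eq_two]
  exact add_le_add (tsum_div_eLpNorm_rpow_le x hp0 hp')
    (tsum_div_eLpNorm_rpow_le y hq0 hq')

theorem eLpNorm_count_comp_equiv (e : κ ≃ κ) (x : κ → ℝ≥0∞) {p : ℝ≥0∞} (h0 : p ≠ 0) :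
    eLpNorm (fun k => x (e k)) p Measure.count = eLpNorm x p Measure.count := by
  by_cases hp : p = ∞
  · subst hp
    rw [eLpNorm_exponent_top, eLpNorm_exponent_top, eLpNormEssSup_count, eLpNormEssSup_count]
    exact e.iSup_comp (g := fun k => ‖x k‖ₑ)
  · rw [eLpNorm_count_ennreal _ h0 hp, eLpNorm_count_ennreal _ h0 hp,
      e.tsum_eq (fun k => x k ^ p.toReal)]

/-- A bilinear convolution inequality. -/
theorem tsum_convolution_le {d : ℕ} (x y ρ : (Fin d → ℤ) → ℝ≥0∞) {p q : ℝ≥0∞} (hp : 1 ≤ p)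
    (hq : 1 ≤ q) (h : 1 ≤ p⁻¹ + q⁻¹) :
    ∑' k, y k * ∑' j, ρ (k - j) * x j
      ≤ 2 * (∑' r, ρ r) * (eLpNorm x p Measure.count * eLpNorm y q Measure.count) := by
  have h1 : ∀ k, ∑' j, ρ (k - j) * x j = ∑' r, ρ r * x (k - r) := fun k => by
    rw [← (Equiv.subLeft k).tsum_eq fun r => ρ r * x (k - r)]
    simp
  have hL : ∑' k, y k * ∑' j, ρ (k - j) * x j = ∑' k, ∑' r, y k * (ρ r * x (k - r)) :=
    tsum_congr fun k => by rw [h1, ENNReal.tsum_mul_left]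
  rw [hL, ENNReal.tsum_comm]
  -- For a fixed shift `r` this is Hölder's inequality, since a shift preserves the `ℓ^p` norm;
  -- summing over `r` leaves the total mass of `ρ`.
  have h2 : ∀ r, ∑' k, y k * (ρ r * x (k - r))
      ≤ ρ r * (2 * (eLpNorm x p Measure.count * eLpNorm y q Measure.count)) := fun r => by
    have h3 := tsum_mul_le_eLpNorm_mul_eLpNorm (fun k => x (k - r)) y hp hq h
    have h4 : eLpNorm (fun k => x (k - r)) p Measure.count = eLpNorm x p Measure.count :=
      eLpNorm_count_comp_equiv (Equiv.subRight r) x (one_pos.trans_le hp).ne'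
    rw [h4] at h3
    calc ∑' k, y k * (ρ r * x (k - r)) = ∑' k, ρ r * (x (k - r) * y k) := by
          refine tsum_congr fun k => by ring
      _ = ρ r * ∑' k, x (k - r) * y k := ENNReal.tsum_mul_left
      _ ≤ _ := by gcongr
  refine (ENNReal.tsum_le_tsum h2).trans ?_
  rw [ENNReal.tsum_mul_right, ← mul_assoc, mul_comm _ 2]

end Sequences

/-! ### Discrete description of amalgam spaces -/

section Discrete

variable {d : ℕ} {E : Type*} [NormedAddCommGroup E] [NormedSpace ℂ E] (ι : E →L[ℂ] Tempered d)
  (φ : UnityGenerator d) (η : PolyWeight d)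

theorem PolyWeight.exists_le (η : PolyWeight d) : ∃ (C : ℝ) (m : ℕ), 0 < C ∧
    ∀ x y, η.toFun y ≤ C * η.toFun x * (1 + ‖y - x‖) ^ m := by
  obtain ⟨C, τ, hC, hτ, h⟩ := η.moderate
  refine ⟨C, ⌈τ⌉₊, hC, fun x y => ?_⟩
  have h1 := h x (y - x)
  rw [add_sub_cancel] at h1
  refine h1.trans ?_
  have := (η.pos x).le
  gcongr
  rw [← Real.rpow_natCast]
  exact Real.rpow_le_rpow_of_exponent_le (by linarith [norm_nonneg (y - x)]) (Nat.le_ceil τ)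

/-- The weighted norm of the product of a distribution and the translate `φ_k`. -/
def cellNorm (T : Distr d) (k : Fin d → ℤ) : ℝ≥0∞ :=
  ENNReal.ofReal (η.toFun (latticePoint k)) *
    localNorm ι (testTranslate (latticePoint k) φ.toTest) T

theorem mem_cube_floorVec (t : Space d) : t ∈ cube (floorVec t) := by
  intro i
  have h1 : (t - latticePoint (floorVec t)) i = t i - ⌊t i⌋ := rfl
  rw [h1]
  constructor
  · linarith [Int.floor_le (t i)]
  · linarith [Int.lt_floor_add_one (t i)]

theorem PolyWeight.exists_lattice_le (η : PolyWeight d) : ∃ C : ℝ≥0, 0 < C ∧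
    ∀ (k : Fin d → ℤ) (t : Space d), t ∈ cube k →
      ENNReal.ofReal (η.toFun (latticePoint k)) ≤ C * ENNReal.ofReal (η.toFun t) ∧
      ENNReal.ofReal (η.toFun t) ≤ C * ENNReal.ofReal (η.toFun (latticePoint k)) := by
  obtain ⟨C, m, hC, h⟩ := η.exists_le
  have hD : 0 ≤ C * (1 + Real.sqrt d) ^ m := by positivity
  refine ⟨(C * (1 + Real.sqrt d) ^ m).toNNReal, Real.toNNReal_pos.2 (by positivity),
    fun k t ht => ?_⟩
  have h1 := norm_le_of_mem_cube ht
  have h2 : ∀ x y : Space d, ‖y - x‖ ≤ Real.sqrt d →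
      ENNReal.ofReal (η.toFun y)
        ≤ ENNReal.ofReal (C * (1 + Real.sqrt d) ^ m) * ENNReal.ofReal (η.toFun x) := by
    intro x y hxy
    rw [← ENNReal.ofReal_mul hD]
    refine ENNReal.ofReal_le_ofReal ((h x y).trans ?_)
    have := (η.pos x).le
    calc C * η.toFun x * (1 + ‖y - x‖) ^ m ≤ C * η.toFun x * (1 + Real.sqrt d) ^ m := by gcongr
      _ = _ := by ring
  exact ⟨h2 t _ (by rwa [norm_sub_rev]), h2 _ t h1⟩

/-- The point `t` belongs to the cube indexed by its integer part. Keeping only that term of the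
amalgam function bounds it below by a function constant on unit cubes, whose `L^p` norm is the
sequence norm. -/
theorem exists_eLpNorm_cellNorm_le : ∃ C : ℝ≥0, 0 < C ∧ ∀ (T : Distr d) (p : ℝ≥0∞),
    eLpNorm (cellNorm ι φ η T) p Measure.count ≤ C * eLpNorm (amalgamFun ι φ η T) p volume := by
  obtain ⟨C, hC, h⟩ := η.exists_lattice_le
  refine ⟨C, hC, fun T p => ?_⟩
  rw [← eLpNorm_comp_measurePreserving (Measurable.of_discrete).aestronglyMeasurable
    (measurePreserving_floorVec (d := d))]
  have h1 := eLpNorm_le_nnreal_smul_eLpNorm_of_ae_le_mul' (c := C) (μ := (volume : Measure (Space d)))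
    (f := cellNorm ι φ η T ∘ floorVec) (g := amalgamFun ι φ η T)
    (Eventually.of_forall fun t => ?_) p
  · exact h1
  · change ENNReal.ofReal _ * _ ≤ C * (_ * ENNReal.ofReal (η.toFun t))
    have ht := mem_cube_floorVec t
    calc _ ≤ C * ENNReal.ofReal (η.toFun t) * _ := mul_le_mul' (h _ t ht).1 le_rfl
      _ ≤ C * ENNReal.ofReal (η.toFun t) * _ := mul_le_mul' le_rfl ?_
      _ = _ := by rw [mul_assoc, mul_comm (ENNReal.ofReal _)]
    have h2 := ENNReal.le_tsum (f := fun k : Fin d → ℤ => (cube k).indicator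
      (fun _ => localNorm ι (testTranslate (latticePoint k) φ.toTest) T) t) (floorVec t)
    simpa only [Set.indicator_of_mem ht] using h2

theorem exists_volume_cube_le (d : ℕ) : ∃ V : ℝ≥0, ∀ k : Fin d → ℤ, volume (cube k) ≤ V := by
  refine ⟨(volume (Metric.closedBall (0 : Space d) (Real.sqrt d))).toNNReal, fun k => ?_⟩
  rw [ENNReal.coe_toNNReal measure_closedBall_lt_top.ne]
  calc volume (cube k) ≤ volume (Metric.closedBall (latticePoint k) (Real.sqrt d)) := by
        refine measure_mono fun t ht => ?_
        rw [Metric.mem_closedBall, dist_eq_norm]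
        exact norm_le_of_mem_cube ht
    _ = _ := Measure.addHaar_closedBall_center _ _ _

/-- A function that is bounded by `S` and whose integral is at most `V * S`. -/
theorem eLpNorm_le_of_le_of_lintegral_le {α : Type*} [MeasurableSpace α] {μ : Measure α}
    {h : α → ℝ≥0∞} {S : ℝ≥0∞} {V : ℝ≥0} (h1 : ∀ t, h t ≤ S) (h2 : ∫⁻ t, h t ∂μ ≤ V * S)
    {p : ℝ≥0∞} (hp : 1 ≤ p) : eLpNorm h p μ ≤ (V + 1) * S := by
  by_cases hS : S = ∞
  · rw [hS, ENNReal.mul_top (by simp)]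
    exact le_top
  by_cases hp' : p = ∞
  · subst hp'
    rw [eLpNorm_exponent_top]
    refine (eLpNormEssSup_le_of_ae_enorm_bound (Eventually.of_forall h1)).trans ?_
    exact le_mul_of_one_le_left bot_le le_add_self
  have hp0 : p ≠ 0 := (one_pos.trans_le hp).ne'
  have hP : 1 ≤ p.toReal := by
    rw [← ENNReal.toReal_one]
    exact ENNReal.toReal_mono hp' hp
  have hP0 : 0 < p.toReal := one_pos.trans_le hP
  rw [eLpNorm_eq_lintegral_rpow_enorm_toReal hp0 hp', one_div]
  rw [ENNReal.rpow_inv_le_iff hP0]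
  -- Interpolation between `L^1` and `L^∞`: `h ^ p ≤ S ^ (p - 1) * h`. Enlarging `V` to `V + 1 ≥ 1`
  -- later gives a constant independent of `p`.
  have h3 : ∀ z : ℝ≥0∞, z ^ p.toReal = z ^ (p.toReal - 1) * z := fun z => by
    conv_lhs => rw [show p.toReal = (p.toReal - 1) + 1 by ring]
    rw [ENNReal.rpow_add_of_nonneg _ _ (by linarith) zero_le_one, ENNReal.rpow_one]
  calc ∫⁻ t, ‖h t‖ₑ ^ p.toReal ∂μ ≤ ∫⁻ t, S ^ (p.toReal - 1) * h t ∂μ := by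
        refine lintegral_mono fun t => ?_
        change h t ^ p.toReal ≤ _
        rw [h3]
        exact mul_le_mul' (ENNReal.rpow_le_rpow (h1 t) (by linarith)) le_rfl
    _ ≤ S ^ (p.toReal - 1) * (V * S) := by
        rw [lintegral_const_mul' _ _ (ENNReal.rpow_ne_top_of_nonneg (by linarith) hS)]
        gcongr
    _ = V * S ^ p.toReal := by rw [h3 S]; ring
    _ ≤ (V + 1) ^ p.toReal * S ^ p.toReal := by
        gcongr
        calc (V : ℝ≥0∞) ≤ V + 1 := le_self_add
          _ = (V + 1) ^ (1 : ℝ) := (ENNReal.rpow_one _).symm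
          _ ≤ _ := ENNReal.rpow_le_rpow_of_exponent_le le_add_self hP
    _ = _ := (ENNReal.mul_rpow_of_nonneg _ _ hP0.le).symm

/-- The sum of the indicator functions of the cubes with the coefficients `x`. -/
def cubeSum (x : (Fin d → ℤ) → ℝ≥0∞) (t : Space d) : ℝ≥0∞ :=
  ∑' k, (cube k).indicator (fun _ => x k) t

theorem cubeSum_le (x : (Fin d → ℤ) → ℝ≥0∞) (t : Space d) : cubeSum x t ≤ ∑' k, x k :=
  ENNReal.tsum_le_tsum fun _ => Set.indicator_le_self' (fun _ _ => bot_le) t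

theorem lintegral_cubeSum_le {V : ℝ≥0} (hV : ∀ k : Fin d → ℤ, volume (cube k) ≤ V)
    (x : (Fin d → ℤ) → ℝ≥0∞) : ∫⁻ t, cubeSum x t ≤ V * ∑' k, x k := by
  unfold cubeSum
  rw [lintegral_tsum fun k => (measurable_const.indicator (measurableSet_cube k)).aemeasurable,
    ← ENNReal.tsum_mul_left]
  refine ENNReal.tsum_le_tsum fun k => ?_
  rw [lintegral_indicator_const (measurableSet_cube k), mul_comm]
  gcongr
  exact hV k

theorem exists_amalgamFun_le : ∃ C : ℝ≥0, 0 < C ∧ ∀ (T : Distr d) (t : Space d),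
    amalgamFun ι φ η T t ≤ C * cubeSum (cellNorm ι φ η T) t := by
  obtain ⟨C, hC, h⟩ := η.exists_lattice_le
  refine ⟨C, hC, fun T t => ?_⟩
  unfold amalgamFun cubeSum
  rw [← ENNReal.tsum_mul_right, ← ENNReal.tsum_mul_left]
  refine ENNReal.tsum_le_tsum fun k => ?_
  by_cases ht : t ∈ cube k
  · simp only [Set.indicator_of_mem ht, cellNorm]
    rw [mul_comm, ← mul_assoc]
    gcongr
    exact (h k t ht).2
  · simp [Set.indicator_of_notMem ht]

/-- Off the balls around finitely many lattice points only a tail of a convergent series survives.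
Summability of the cells thus yields the vanishing condition of `L^∞_0`. -/
theorem cubeSum_vanishes {x : (Fin d → ℤ) → ℝ≥0∞} (hx : ∑' k, x k ≠ ∞) {ε : ℝ≥0∞}
    (hε : 0 < ε) : ∃ K : Set (Space d), IsCompact K ∧ ∀ t ∉ K, cubeSum x t ≤ ε := by
  obtain ⟨s, hs⟩ := ((ENNReal.tendsto_tsum_compl_atTop_zero hx).eventually_le_const hε).exists
  refine ⟨⋃ k ∈ s, Metric.closedBall (latticePoint k) (Real.sqrt d),
    s.isCompact_biUnion fun k _ => isCompact_closedBall _ _, fun t ht => ?_⟩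
  have h1 : ∀ k ∈ s, (cube k).indicator (fun _ => x k) t = 0 := fun k hk => by
    refine Set.indicator_of_notMem (fun hmem => ht ?_) _
    simp only [Set.mem_iUnion]
    refine ⟨k, hk, ?_⟩
    rw [Metric.mem_closedBall, dist_eq_norm]
    exact norm_le_of_mem_cube hmem
  unfold cubeSum
  have h2 : (Function.support fun k => (cube k).indicator (fun _ => x k) t) ⊆ {k | k ∉ s} :=
    fun k hk hks => hk (h1 k hks)
  rw [← tsum_subtype_eq_of_support_subset h2]
  refine le_trans (ENNReal.tsum_le_tsum fun k => ?_) hs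
  exact Set.indicator_le_self' (s := cube k.1) (f := fun _ => x k.1) (fun _ _ => bot_le) t

/-- The amalgam norm is bounded by the sum of the local norms. -/
theorem exists_amalgam_le_tsum : ∃ C : ℝ≥0, 0 < C ∧ ∀ (G : GlobalComponent) (T : Distr d),
    MemLoc ι T → (amalgam ι φ η G).toFun T ≤ C * ∑' k, cellNorm ι φ η T k := by
  obtain ⟨C, hC, h⟩ := exists_amalgamFun_le ι φ η
  obtain ⟨V, hV⟩ := exists_volume_cube_le d
  refine ⟨C * (V + 1), by positivity, fun G T hT => ?_⟩
  by_cases hS : ∑' k, cellNorm ι φ η T k = ∞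
  · rw [hS, ENNReal.mul_top]
    · exact le_top
    · simp [hC.ne']
  have hcond : AmalgamCond ι φ η G T := by
    refine ⟨hT, ?_⟩
    cases G with
    | lp p hp => trivial
    | linftyZero =>
      intro ε hε
      obtain ⟨K, hK, h1⟩ := cubeSum_vanishes hS
        (ENNReal.div_pos hε.ne' (ENNReal.coe_ne_top (r := C)))
      refine ⟨K, hK, ?_⟩
      rw [eLpNorm_exponent_top]
      refine eLpNormEssSup_le_of_ae_enorm_bound ?_
      filter_upwards [ae_restrict_mem hK.measurableSet.compl] with t ht
      refine (h T t).trans ((mul_le_mul' le_rfl (h1 t ht)).trans ?_)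
      exact ENNReal.mul_div_le
  refine (iInf_le _ hcond).trans ?_
  have h1 := eLpNorm_le_nnreal_smul_eLpNorm_of_ae_le_mul' (c := C)
    (μ := (volume : Measure (Space d))) (f := amalgamFun ι φ η T)
    (g := cubeSum (cellNorm ι φ η T)) (Eventually.of_forall fun t => h T t) G.exponent
  refine h1.trans ?_
  have h2 := eLpNorm_le_of_le_of_lintegral_le (cubeSum_le (cellNorm ι φ η T))
    (lintegral_cubeSum_le hV (cellNorm ι φ η T)) G.one_le_exponent
  calc (C : ℝ≥0∞) * _ ≤ C * ((V + 1) * ∑' k, cellNorm ι φ η T k) := mul_le_mul' le_rfl h2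
    _ = _ := by rw [← mul_assoc]; push_cast; rfl

theorem amalgam_lt_top {G : GlobalComponent} {T : Distr d}
    (h : (amalgam ι φ η G).toFun T < ∞) : AmalgamCond ι φ η G T ∧
      (amalgam ι φ η G).toFun T = eLpNorm (amalgamFun ι φ η T) G.exponent volume := by
  have h1 : AmalgamCond ι φ η G T := by
    by_contra hcon
    simp [amalgam, hcon] at h
  exact ⟨h1, by simp [amalgam, h1]⟩

/-- The sequence of the local norms belongs to the sequence space with the same exponent. -/
theorem exists_eLpNorm_cellNorm_le_amalgam : ∃ C : ℝ≥0, 0 < C ∧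
    ∀ (G : GlobalComponent) (T : Distr d), (amalgam ι φ η G).toFun T < ∞ →
      eLpNorm (cellNorm ι φ η T) G.exponent Measure.count ≤ C * (amalgam ι φ η G).toFun T := by
  obtain ⟨C, hC, h⟩ := exists_eLpNorm_cellNorm_le ι φ η
  refine ⟨C, hC, fun G T hT => ?_⟩
  rw [(amalgam_lt_top ι φ η hT).2]
  exact h T _

end Discrete

/-! ### Series of modulations -/

section Series

variable {d : ℕ}

theorem exists_tsum_le_of_decay (d : ℕ) : ∃ (N : ℕ) (S : ℝ), 0 < S ∧
    ∀ (u : (Fin d → ℤ) → ℝ) (κ : ℝ), (∀ n, 0 ≤ u n) → (∀ n, (1 + ‖freq n‖) ^ N * u n ≤ κ) →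
      Summable u ∧ ∑' n, u n ≤ S * κ := by
  obtain ⟨N, hN⟩ := exists_summable_lattice d
  have hs := hN N le_rfl
  have hL := period_pos d
  have h0 : 0 ≤ ∑' n : Fin d → ℤ, ((1 + ‖latticePoint n‖) ^ N)⁻¹ :=
    tsum_nonneg fun _ => by positivity
  refine ⟨N, period d ^ N * ∑' n : Fin d → ℤ, ((1 + ‖latticePoint n‖) ^ N)⁻¹ + 1,
    by positivity, fun u κ h1 h2 => ?_⟩
  have hu := summable_of_decay hs h1 h2
  have hκ : 0 ≤ κ := le_trans (mul_nonneg (by positivity) (h1 0)) (h2 0)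
  refine ⟨hu, ?_⟩
  calc ∑' n, u n ≤ ∑' n : Fin d → ℤ, period d ^ N * κ * ((1 + ‖latticePoint n‖) ^ N)⁻¹ := by
        refine hu.tsum_le_tsum (fun n => ?_) (hs.mul_left _)
        rw [← div_eq_mul_inv, le_div_iff₀ (by positivity)]
        calc u n * (1 + ‖latticePoint n‖) ^ N ≤ u n * (period d * (1 + ‖freq n‖)) ^ N := by
              gcongr
              · exact h1 n
              · exact one_add_norm_latticePoint_le n
          _ = period d ^ N * ((1 + ‖freq n‖) ^ N * u n) := by rw [mul_pow]; ring
          _ ≤ _ := by gcongr; exact h2 n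
    _ = period d ^ N * (∑' n : Fin d → ℤ, ((1 + ‖latticePoint n‖) ^ N)⁻¹) * κ := by
        rw [tsum_mul_left]; ring
    _ ≤ _ := by gcongr; linarith

/-- The sequence `c` decays faster than every power of the frequency. -/
def RapidDecay (c : (Fin d → ℤ) → ℂ) : Prop :=
  ∀ K : ℕ, ∃ κ : ℝ, ∀ n, (1 + ‖freq n‖) ^ K * ‖c n‖ ≤ κ

theorem norm_inv_period_pow_le : ‖((period d ^ d : ℝ)⁻¹ : ℂ)‖ ≤ 1 := by
  rw [norm_inv, Complex.norm_real]
  refine inv_le_one_of_one_le₀ ?_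
  rw [Real.norm_of_nonneg (pow_nonneg (period_pos d).le d)]
  exact one_le_pow₀ (one_le_period d)

theorem RapidDecay.summable_snorm {c : (Fin d → ℤ) → ℂ} (hc : RapidDecay c)
    (b θ : 𝓢(Space d, ℂ)) (M : ℕ) :
    Summable fun n => snorm M (c n • schwartzMul b (schwartzModulate (freq n) θ)) := by
  obtain ⟨N₀, S, hS, h⟩ := exists_tsum_le_of_decay d
  obtain ⟨N, C, hC, h1⟩ := exists_snorm_modulate_le (d := d) M
  obtain ⟨κ, hκ⟩ := hc (N₀ + N)
  refine (h _ (2 ^ M * 4 ^ M * snorm M b * C * snorm N θ * κ) (fun _ => apply_nonneg _ _)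
    fun n => ?_).1
  rw [map_smul_eq_mul]
  calc (1 + ‖freq n‖) ^ N₀ * (‖c n‖ * snorm M (schwartzMul b (schwartzModulate (freq n) θ)))
      ≤ (1 + ‖freq n‖) ^ N₀ * (‖c n‖ *
        (2 ^ M * 4 ^ M * snorm M b * (C * (1 + ‖freq n‖) ^ N * snorm N θ))) := by
        gcongr
        refine (snorm_schwartzMul_le _ _ _).trans ?_
        gcongr
        exact h1 _ _
    _ = 2 ^ M * 4 ^ M * snorm M b * C * snorm N θ * ((1 + ‖freq n‖) ^ (N₀ + N) * ‖c n‖) := by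
        rw [pow_add]; ring
    _ ≤ _ := by gcongr; exact hκ n

/-- The pairing of a tempered distribution with a product with a Fourier series. -/
theorem RapidDecay.hasSum_tempered {c : (Fin d → ℤ) → ℂ} (hc : RapidDecay c)
    (b θ s : 𝓢(Space d, ℂ)) {σ : Space d → ℂ}
    (hσ : ∀ t, b t ≠ 0 → HasSum (fun n => c n * character (freq n) t) (σ t))
    (hs : ∀ t, s t = b t * σ t * θ t) (f : Tempered d) :
    HasSum (fun n => c n * f (schwartzMul b (schwartzModulate (freq n) θ))) (f s) := by
  have h := tempered_hasSum (hc.summable_snorm b θ) (s := s) (fun t => ?_) f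
  · simpa only [map_smul, smul_eq_mul] using h
  · simp only [_root_.smul_apply, schwartzMul_apply, schwartzModulate_apply, smul_eq_mul]
    by_cases hb : b t = 0
    · rw [hs, hb]
      simp
    · rw [hs]
      have h2 := ((hσ t hb).mul_left (b t)).mul_right (θ t)
      refine h2.congr_fun fun n => ?_
      ring

variable {E : Type*} [NormedAddCommGroup E] [NormedSpace ℂ E] {ι : E →L[ℂ] Tempered d}

theorem IsLocal.modulate {k : Fin d → ℤ} {e e' : E} (he : IsLocal ι k e) {ξ : Space d}
    (h : ι e' = AmalgamMod.modulate ξ (ι e)) : IsLocal ι k e' := by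
  intro θ
  rw [h]
  change ι e (schwartzModulate ξ _) = ι e (schwartzModulate ξ θ)
  rw [← he (schwartzModulate ξ θ)]
  congr 1
  ext t
  simp only [schwartzMul_apply, schwartzModulate_apply]
  ring

/-- Coefficients with `K` orders of decay outweigh the polynomial growth of the modulations on `E`.
In this way multiplication by a Fourier series acts on `E`, although no multiplication operators are
given beyond the modulations. -/
theorem exists_modulation_series [CompleteSpace E] {M : Space d → E →ₗ[ℂ] E}
    (hM : ∀ ξ e, ι (M ξ e) = modulate ξ (ι e)) {C₀ : ℝ} {m : ℕ} (hC₀ : 0 < C₀)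
    (hb : ∀ ξ e, ‖M ξ e‖ ≤ C₀ * (1 + ‖ξ‖) ^ m * ‖e‖) :
    ∃ (K : ℕ) (C : ℝ), 0 < C ∧ ∀ (c : (Fin d → ℤ) → ℂ) (κ : ℝ),
      (∀ n, (1 + ‖freq n‖) ^ K * ‖c n‖ ≤ κ) → ∀ e : E,
        (Summable fun n => c n • M (freq n) e) ∧ ‖∑' n, c n • M (freq n) e‖ ≤ C * κ * ‖e‖ ∧
        ∀ θ, HasSum (fun n => c n * ι e (schwartzModulate (freq n) θ))
          (ι (∑' n, c n • M (freq n) e) θ) := by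
  obtain ⟨N, S, hS, h⟩ := exists_tsum_le_of_decay d
  refine ⟨N + m, S * C₀, by positivity, fun c κ hc e => ?_⟩
  obtain ⟨h1, h2⟩ := h (fun n => ‖c n • M (freq n) e‖) (C₀ * κ * ‖e‖) (fun _ => norm_nonneg _)
    fun n => by
      rw [norm_smul]
      calc (1 + ‖freq n‖) ^ N * (‖c n‖ * ‖M (freq n) e‖)
          ≤ (1 + ‖freq n‖) ^ N * (‖c n‖ * (C₀ * (1 + ‖freq n‖) ^ m * ‖e‖)) := by
            gcongr; exact hb _ _
        _ = C₀ * ((1 + ‖freq n‖) ^ (N + m) * ‖c n‖) * ‖e‖ := by rw [pow_add]; ring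
        _ ≤ _ := by gcongr; exact hc n
  refine ⟨h1.of_norm, ?_, fun θ => ?_⟩
  · refine (norm_tsum_le_tsum_norm h1).trans (h2.trans (le_of_eq (by ring)))
  · have h3 := h1.of_norm.hasSum.mapL (pairingCLM ι θ)
    refine h3.congr_fun fun n => ?_
    rw [map_smul, pairingCLM_apply, hM]
    rfl

/-- Multiplication of a localized element with a Schwartz function. -/
theorem exists_local_multiplier [CompleteSpace E] {M : Space d → E →ₗ[ℂ] E}
    (hM : ∀ ξ e, ι (M ξ e) = modulate ξ (ι e)) {C₀ : ℝ} {m : ℕ} (hC₀ : 0 < C₀)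
    (hb : ∀ ξ e, ‖M ξ e‖ ≤ C₀ * (1 + ‖ξ‖) ^ m * ‖e‖) :
    ∃ (N : ℕ) (C : ℝ), 0 < C ∧ ∀ (k : Fin d → ℤ) (e : E) (a : 𝓢(Space d, ℂ)), IsLocal ι k e →
      ∃ e' : E, ι e' = temperedMul a (ι e) ∧ ‖e'‖
        ≤ C * snorm N (schwartzMul (cutoff d) (schwartzTranslate (-latticePoint k) a)) * ‖e‖ := by
  obtain ⟨K, C, hC, h⟩ := exists_modulation_series hM hC₀ hb
  obtain ⟨N, C₁, hC₁, h₁⟩ := exists_snorm_fourier_le (d := d) K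
  refine ⟨N, C * 2 ^ K * C₁, by positivity, fun k e a he => ?_⟩
  -- Only the multiplier near the cell matters. Moved to the origin and cut off, it has a Fourier
  -- series, and its coefficients decay at a rate measured by one Schwartz norm of `b`.
  set b := schwartzMul (cutoff d) (schwartzTranslate (-latticePoint k) a) with hb_def
  let c : (Fin d → ℤ) → ℂ := fun n =>
    ((period d ^ d : ℝ)⁻¹ : ℂ) * 𝓕 b (freq n) * character (freq n) (-latticePoint k)
  have hc : ∀ n, ‖c n‖ ≤ ‖𝓕 b (freq n)‖ := fun n => by
    simp only [c, norm_mul, norm_character, mul_one]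
    exact mul_le_of_le_one_left (norm_nonneg _) norm_inv_period_pow_le
  have hdecay : ∀ (L : ℕ) (n : Fin d → ℤ), (1 + ‖freq n‖) ^ L * ‖c n‖ ≤ 2 ^ L * snorm L (𝓕 b) :=
    fun L n => (mul_le_mul_of_nonneg_left (hc n) (by positivity)).trans
      (norm_apply_le_snorm (𝓕 b) (freq n) L)
  obtain ⟨-, h2, h3⟩ := h c (2 ^ K * snorm K (𝓕 b)) (hdecay K) e
  refine ⟨_, ?_, h2.trans ?_⟩
  · ext θ
    refine (h3 θ).unique ?_
    have hc' : RapidDecay c := fun L => ⟨_, hdecay L⟩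
    -- The translated cutoff occurs twice, once inside `b` and once to confine `t` to the ball where
    -- the series of `b` is valid; locality of `e` removes both copies.
    set χ := schwartzTranslate (latticePoint k) (cutoff d)
    have h4 := hc'.hasSum_tempered χ θ (schwartzMul χ (schwartzMul χ (schwartzMul a θ)))
      (σ := fun t => b (t - latticePoint k)) (fun t ht => ?_) (fun t => ?_) (ι e)
    · rw [he, he] at h4
      rw [temperedMul_apply]
      refine h4.congr_fun fun n => ?_
      rw [he]
    · have h5 := hasSum_fourier_of_support (h := b) (t := t - latticePoint k) (fun s hs => by
        rw [hb_def, schwartzMul_apply] at hs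
        exact norm_le_of_cutoff_ne_zero (left_ne_zero_of_mul hs)) (norm_le_of_cutoff_ne_zero ht)
      refine h5.congr_fun fun n => ?_
      simp only [c]
      rw [sub_eq_add_neg, character_add_left]
      ring
    · simp only [schwartzMul_apply, hb_def, schwartzTranslate_apply, χ, sub_neg_eq_add,
        sub_add_cancel]
      ring
  · calc C * (2 ^ K * snorm K (𝓕 b)) * ‖e‖ ≤ C * (2 ^ K * (C₁ * snorm N b)) * ‖e‖ := by
          gcongr; exact h₁ _
      _ = _ := by ring

end Series

/-! ### The cells of an element of an amalgam space -/

section Cells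

variable {d : ℕ} {E : Type*} [NormedAddCommGroup E] [NormedSpace ℂ E] {ι : E →L[ℂ] Tempered d}
  (φ : UnityGenerator d)

theorem isProduct_cell_iff {k : Fin d → ℤ} {f : Tempered d} {e : E} :
    IsProduct ι (testTranslate (latticePoint k) φ.toTest) (restrict f) e
      ↔ ι e = temperedMul (cell φ k) f := by
  rw [isProduct_restrict_iff φ, testToSchwartz_cell]

theorem isLocal_of_eq_temperedMul_cell {k : Fin d → ℤ} {f : Tempered d} {e : E}
    (h : ι e = temperedMul (cell φ k) f) : IsLocal ι k e :=
  ((isProduct_cell_iff φ).2 h).isLocal φ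

theorem one_add_norm_rpow_le {x : Space d} {τ : ℝ} :
    (1 + ‖x‖) ^ τ ≤ (1 + ‖x‖) ^ ((⌈τ⌉₊ : ℕ) : ℝ) :=
  Real.rpow_le_rpow_of_exponent_le (by linarith [norm_nonneg x]) (Nat.le_ceil τ)

theorem IsTMIB.exists_modulate [CompleteSpace E] (hι : IsTMIB ι) :
    ∃ (M : Space d → E →ₗ[ℂ] E) (C : ℝ) (m : ℕ), 0 < C ∧
      (∀ ξ e, ι (M ξ e) = modulate ξ (ι e)) ∧ ∀ ξ e, ‖M ξ e‖ ≤ C * (1 + ‖ξ‖) ^ m * ‖e‖ := by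
  obtain ⟨τ, C, hτ, hC, -, h⟩ := hι.growth
  obtain ⟨M, h1, h2⟩ := AmalgamMod.exists_modulate hι.injective hι.modulate_mem hC h
  refine ⟨M, C, ⌈τ⌉₊, hC, h1, fun ξ e => (h2 ξ e).trans ?_⟩
  gcongr
  rw [← Real.rpow_natCast]
  exact one_add_norm_rpow_le

theorem IsTMIB.exists_translationNorm_le [CompleteSpace E] (hι : IsTMIB ι) :
    ∃ (C : ℝ) (m : ℕ), 0 < C ∧
      ∀ x : Space d, translationNorm ι x ≤ ENNReal.ofReal (C * (1 + ‖x‖) ^ (m : ℝ)) := by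
  obtain ⟨τ, C, hτ, hC, h, -⟩ := hι.growth
  refine ⟨C, ⌈τ⌉₊, hC, fun x => (h x).trans (ENNReal.ofReal_le_ofReal ?_)⟩
  exact mul_le_mul_of_nonneg_left one_add_norm_rpow_le hC.le

/-- The products of a localized element with the functions `φ_j` decay rapidly. -/
theorem exists_mul_cell_le [CompleteSpace E] (hι : IsTMIB ι) (K : ℕ) :
    ∃ C : ℝ, 0 < C ∧ ∀ (k j : Fin d → ℤ) (e : E), IsLocal ι k e →
      ∃ e' : E, ι e' = temperedMul (cell φ j) (ι e) ∧
        (1 + ‖latticePoint j - latticePoint k‖) ^ K * ‖e'‖ ≤ C * ‖e‖ := by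
  obtain ⟨M, C₀, m, hC₀, hM, hb⟩ := hι.exists_modulate
  obtain ⟨N, C, hC, h⟩ := exists_local_multiplier hM hC₀ hb
  set B := 2 ^ N * 4 ^ (N + K) * snorm (N + K) (cutoff d) *
    snorm (N + K) (testToSchwartz φ.toTest)
  have hB : 0 ≤ B := by positivity
  refine ⟨C * (B + 1), by positivity, fun k j e he => ?_⟩
  obtain ⟨e', h1, h2⟩ := h k e (cell φ j) he
  refine ⟨e', h1, ?_⟩
  have h3 := snorm_schwartzMul_translate_le N K (cutoff d) (testToSchwartz φ.toTest)
    (latticePoint j - latticePoint k)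
  have h4 : schwartzTranslate (-latticePoint k) (cell φ j)
      = schwartzTranslate (latticePoint j - latticePoint k) (testToSchwartz φ.toTest) := by
    rw [cell, schwartzTranslate_schwartzTranslate, neg_add_eq_sub]
  rw [h4] at h2
  set s := snorm N (schwartzMul (cutoff d)
    (schwartzTranslate (latticePoint j - latticePoint k) (testToSchwartz φ.toTest)))
  calc (1 + ‖latticePoint j - latticePoint k‖) ^ K * ‖e'‖
      ≤ (1 + ‖latticePoint j - latticePoint k‖) ^ K * (C * s * ‖e‖) := by gcongr
    _ = C * ((1 + ‖latticePoint j - latticePoint k‖) ^ K * s) * ‖e‖ := by ring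
    _ ≤ C * (B + 1) * ‖e‖ := by gcongr; linarith

theorem summable_of_polynomial_mul_le {u : (Fin d → ℤ) → ℝ} {κ : ℝ} {N : ℕ}
    (hN : Summable fun k : Fin d → ℤ => ((1 + ‖latticePoint k‖) ^ N)⁻¹) (h0 : ∀ k, 0 ≤ u k)
    (h : ∀ k, (1 + ‖latticePoint k‖) ^ N * u k ≤ κ) : Summable u ∧
      ∑' k, u k ≤ κ * ∑' k : Fin d → ℤ, ((1 + ‖latticePoint k‖) ^ N)⁻¹ := by
  have h1 : ∀ k, u k ≤ κ * ((1 + ‖latticePoint k‖) ^ N)⁻¹ := fun k => by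
    rw [← div_eq_mul_inv, le_div_iff₀ (by positivity), mul_comm]
    exact h k
  have hu := Summable.of_nonneg_of_le h0 h1 (hN.mul_left κ)
  refine ⟨hu, (hu.tsum_le_tsum h1 (hN.mul_left κ)).trans ?_⟩
  rw [tsum_mul_left]

/-- A tempered distribution whose cells belong to `E`, with polynomial bounds, belongs to
`E_loc`. -/
theorem memLoc_of_cells [CompleteSpace E] (hι : IsTMIB ι) {f : Tempered d}
    {e : (Fin d → ℤ) → E} (he : ∀ k, ι (e k) = temperedMul (cell φ k) f) {B : ℝ} {m : ℕ}
    (hB : ∀ k, ‖e k‖ ≤ B * (1 + ‖latticePoint k‖) ^ m) : MemLoc ι (restrict f) := by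
  intro χ
  obtain ⟨M, C₀, m₀, hC₀, hM, hb⟩ := hι.exists_modulate
  obtain ⟨N, C, hC, h⟩ := exists_local_multiplier hM hC₀ hb
  obtain ⟨N₀, hN₀⟩ := exists_summable_lattice d
  choose e' h1 h2 using fun k => h k (e k) (testToSchwartz χ)
    (isLocal_of_eq_temperedMul_cell φ (he k))
  -- Multiplication by the fixed `χ` makes distant cells decay rapidly, which beats their growth of
  -- order `m` with `N₀` orders to spare for summation.
  have hs : Summable fun k => ‖e' k‖ := by
    set D := 2 ^ N * 4 ^ (N + (N₀ + m)) * snorm (N + (N₀ + m)) (cutoff d) *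
      snorm (N + (N₀ + m)) (testToSchwartz χ)
    refine (summable_of_polynomial_mul_le (hN₀ N₀ le_rfl) (κ := C * D * B)
      (fun _ => norm_nonneg _) fun k => ?_).1
    have h3 := snorm_schwartzMul_translate_le N (N₀ + m) (cutoff d) (testToSchwartz χ)
      (-latticePoint k)
    rw [norm_neg] at h3
    have hB0 : 0 ≤ B := by
      by_contra hcon
      have := (norm_nonneg _).trans (hB 0)
      have h5 : 0 < (1 + ‖latticePoint (0 : Fin d → ℤ)‖) ^ m := by positivity
      nlinarith
    set s := snorm N (schwartzMul (cutoff d)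
      (schwartzTranslate (-latticePoint k) (testToSchwartz χ)))
    have hs0 : 0 ≤ s := apply_nonneg _ _
    calc (1 + ‖latticePoint k‖) ^ N₀ * ‖e' k‖
        ≤ (1 + ‖latticePoint k‖) ^ N₀ * (C * s * (B * (1 + ‖latticePoint k‖) ^ m)) := by
          gcongr
          exact (h2 k).trans (by gcongr; exact hB k)
      _ = C * ((1 + ‖latticePoint k‖) ^ (N₀ + m) * s) * B := by rw [pow_add]; ring
      _ ≤ _ := by gcongr
  refine ⟨∑' k, e' k, (isProduct_restrict_iff φ).2 ?_⟩
  ext θ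
  have h3 := hs.of_norm.hasSum.mapL (pairingCLM ι θ)
  refine h3.unique ?_
  rw [temperedMul_apply]
  refine (hasSum_tempered_cell φ f (schwartzMul (testToSchwartz χ) θ)).congr_fun fun k => ?_
  rw [pairingCLM_apply, h1, temperedMul_apply, he, temperedMul_apply]

/-- The linear maps that send an element of an amalgam space to its cells. -/
theorem exists_cellMap (hι : Function.Injective ι) (η : PolyWeight d) (G : GlobalComponent)
    {V : Type*} [SeminormedAddCommGroup V] [NormedSpace ℂ V] (Λ : V →ₗ[ℂ] Tempered d)
    (hΛ : ∀ v, (amalgam ι φ η G).toFun (restrict (Λ v)) = ‖v‖ₑ) :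
    ∃ R : (Fin d → ℤ) → V →ₗ[ℂ] E, (∀ k v, ι (R k v) = temperedMul (cell φ k) (Λ v)) ∧
      ∃ C : ℝ≥0, 0 < C ∧ ∀ v, eLpNorm (fun k => ENNReal.ofReal (η.toFun (latticePoint k)) *
        ‖R k v‖ₑ) G.exponent Measure.count ≤ C * ‖v‖ₑ := by
  have hfin : ∀ v, (amalgam ι φ η G).toFun (restrict (Λ v)) < ∞ := fun v => by
    rw [hΛ]; exact enorm_lt_top
  choose r hr using fun k v => (amalgam_lt_top ι φ η (hfin v)).1.1
    (testTranslate (latticePoint k) φ.toTest)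
  have hr' : ∀ k v, ι (r k v) = temperedMul (cell φ k) (Λ v) := fun k v =>
    (isProduct_cell_iff φ).1 (hr k v)
  refine ⟨fun k => ⟨⟨r k, fun a b => hι ?_⟩, fun c a => hι ?_⟩, hr', ?_⟩
  · rw [map_add, hr', hr', hr', map_add]
    exact map_add (TemperedDistribution.smulLeftCLM ℂ (cell φ k)) _ _
  · rw [map_smul, hr', hr', map_smul]
    exact map_smul (TemperedDistribution.smulLeftCLM ℂ (cell φ k)) _ _
  · obtain ⟨C, hC, h⟩ := exists_eLpNorm_cellNorm_le_amalgam ι φ η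
    refine ⟨C, hC, fun v => ?_⟩
    have h1 := h G (restrict (Λ v)) (hfin v)
    rw [hΛ] at h1
    have h2 : cellNorm ι φ η (restrict (Λ v))
        = fun k => ENNReal.ofReal (η.toFun (latticePoint k)) * ‖r k v‖ₑ := by
      ext k
      rw [cellNorm, localNorm_eq φ hι (hr k v)]
    rw [h2] at h1
    exact h1

theorem cellNorm_eq (hι : Function.Injective ι) (η : PolyWeight d) {f : Tempered d}
    {e : (Fin d → ℤ) → E} (he : ∀ k, ι (e k) = temperedMul (cell φ k) f) (k : Fin d → ℤ) :
    cellNorm ι φ η (restrict f) k = ENNReal.ofReal (η.toFun (latticePoint k) * ‖e k‖) := by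
  rw [cellNorm, localNorm_eq φ hι ((isProduct_cell_iff φ).2 (he k)),
    ENNReal.ofReal_mul (η.pos _).le, ofReal_norm]

/-- Polynomial bounds for the cells. -/
theorem exists_norm_le_of_weight {E : Type*} [NormedAddCommGroup E] (η : PolyWeight d) : ∃ (C : ℝ) (m : ℕ), 0 < C ∧
    ∀ (k : Fin d → ℤ) (e : E) (B : ℝ), 0 ≤ B →
      ENNReal.ofReal (η.toFun (latticePoint k)) * ‖e‖ₑ ≤ ENNReal.ofReal B →
        ‖e‖ ≤ C * B * (1 + ‖latticePoint k‖) ^ m := by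
  obtain ⟨C, m, hC, h⟩ := η.exists_le
  have h0 := η.pos 0
  refine ⟨C * (η.toFun 0)⁻¹, m, by positivity, fun k e B hB he => ?_⟩
  have h1 := h (latticePoint k) 0
  rw [zero_sub, norm_neg] at h1
  have hk := η.pos (latticePoint k)
  rw [← ofReal_norm, ← ENNReal.ofReal_mul hk.le, ENNReal.ofReal_le_ofReal_iff hB] at he
  have h2 : η.toFun 0 * ‖e‖ ≤ C * B * (1 + ‖latticePoint k‖) ^ m := by
    calc η.toFun 0 * ‖e‖ ≤ C * η.toFun (latticePoint k) * (1 + ‖latticePoint k‖) ^ m * ‖e‖ := by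
          gcongr
      _ = C * (η.toFun (latticePoint k) * ‖e‖) * (1 + ‖latticePoint k‖) ^ m := by ring
      _ ≤ _ := by gcongr
  calc ‖e‖ = (η.toFun 0)⁻¹ * (η.toFun 0 * ‖e‖) := by
        rw [← mul_assoc, inv_mul_cancel₀ h0.ne', one_mul]
    _ ≤ (η.toFun 0)⁻¹ * (C * B * (1 + ‖latticePoint k‖) ^ m) := by gcongr
    _ = _ := by ring

/-- Sums of the pairings of localized elements with polynomial bounds. -/
theorem exists_summable_pairing [CompleteSpace E] (hι : IsTMIB ι) (m : ℕ) :
    ∃ (M : ℕ) (C : ℝ), 0 < C ∧ ∀ (e : (Fin d → ℤ) → E) (B : ℝ), 0 ≤ B →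
      (∀ k, IsLocal ι k (e k)) → (∀ k, ‖e k‖ ≤ B * (1 + ‖latticePoint k‖) ^ m) →
      ∀ θ, (Summable fun k => ‖ι (e k) θ‖) ∧ ∑' k, ‖ι (e k) θ‖ ≤ C * B * snorm M θ := by
  obtain ⟨C₀, m₀, hC₀, h₀⟩ := hι.exists_translationNorm_le
  obtain ⟨N₀, hN₀⟩ := exists_summable_lattice d
  -- Orders of decay: `N₀` for summation, `m₀` for the growth of the translation norms, `m` for the
  -- growth of the elements.
  obtain ⟨M, C, hC, h⟩ := exists_local_pairing_le hι.translate_mem hC₀ h₀ (N₀ + m₀ + m)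
  have hS : 0 ≤ ∑' k : Fin d → ℤ, ((1 + ‖latticePoint k‖) ^ N₀)⁻¹ :=
    tsum_nonneg fun _ => by positivity
  refine ⟨M, C * (∑' k : Fin d → ℤ, ((1 + ‖latticePoint k‖) ^ N₀)⁻¹ + 1), by positivity,
    fun e B hB he hb θ => ?_⟩
  have h1 := summable_of_polynomial_mul_le (u := fun k => ‖ι (e k) θ‖) (hN₀ N₀ le_rfl)
    (κ := C * B * snorm M θ) (fun _ => norm_nonneg _) fun k => by
      have h2 := h k 0 (e k) θ (he k)
      rw [schwartzTranslate_zero, zero_sub, norm_neg, Real.rpow_natCast] at h2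
      have h3 : 0 < (1 + ‖latticePoint k‖) ^ (m₀ + m) := by positivity
      refine le_of_mul_le_mul_left ?_ h3
      calc (1 + ‖latticePoint k‖) ^ (m₀ + m) * ((1 + ‖latticePoint k‖) ^ N₀ * ‖ι (e k) θ‖)
          = (1 + ‖latticePoint k‖) ^ (N₀ + m₀ + m) * ‖ι (e k) θ‖ := by
            rw [pow_add, pow_add, pow_add]; ring
        _ ≤ C * (1 + ‖latticePoint k‖) ^ m₀ * ‖e k‖ * snorm M θ := h2
        _ ≤ C * (1 + ‖latticePoint k‖) ^ m₀ * (B * (1 + ‖latticePoint k‖) ^ m) * snorm M θ := by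
            gcongr; exact hb k
        _ = _ := by rw [pow_add]; ring
  refine ⟨h1.1, h1.2.trans ?_⟩
  have h4 : 0 ≤ C * B * snorm M θ := by positivity
  nlinarith

/-- The elements of an amalgam space are uniformly tempered. -/
theorem exists_amalgam_pairing_le [CompleteSpace E] (hι : IsTMIB ι) (η : PolyWeight d)
    (G : GlobalComponent)
    {V : Type*} [SeminormedAddCommGroup V] [NormedSpace ℂ V] (Λ : V →ₗ[ℂ] Tempered d)
    (hΛ : ∀ v, (amalgam ι φ η G).toFun (restrict (Λ v)) = ‖v‖ₑ) :
    ∃ (M : ℕ) (C : ℝ), 0 < C ∧ ∀ v θ, ‖Λ v θ‖ ≤ C * ‖v‖ * snorm M θ := by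
  obtain ⟨R, hR, C, hC, hC'⟩ := exists_cellMap φ hι.injective η G Λ hΛ
  obtain ⟨C₁, m, hC₁, h₁⟩ := exists_norm_le_of_weight (E := E) η
  obtain ⟨M, C₂, hC₂, h₂⟩ := exists_summable_pairing hι m
  have hC0 : (0 : ℝ) < C := hC
  refine ⟨M, C₂ * (C₁ * C), by positivity, fun v θ => ?_⟩
  -- Every sequence norm dominates the supremum, so for all global components the cells grow at most
  -- polynomially.
  have h3 : ∀ k, ‖R k v‖ ≤ C₁ * (C * ‖v‖) * (1 + ‖latticePoint k‖) ^ m := fun k => by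
    refine h₁ k _ _ (by positivity) ?_
    have h4 := enorm_le_eLpNorm_count (p := G.exponent)
      (fun k => ENNReal.ofReal (η.toFun (latticePoint k)) * ‖R k v‖ₑ) k
      (one_pos.trans_le G.one_le_exponent).ne'
    refine (h4.trans (hC' v)).trans (le_of_eq ?_)
    rw [ENNReal.ofReal_mul hC0.le, ofReal_norm, ENNReal.ofReal_coe_nnreal]
  obtain ⟨h5, h6⟩ := h₂ (fun k => R k v) (C₁ * (C * ‖v‖)) (by positivity)
    (fun k => isLocal_of_eq_temperedMul_cell φ (hR k v)) h3 θ
  have h7 : HasSum (fun k => ι (R k v) θ) (Λ v θ) := by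
    refine (hasSum_tempered_cell φ (Λ v) θ).congr_fun fun k => ?_
    rw [hR, temperedMul_apply]
  rw [← h7.tsum_eq]
  refine (norm_tsum_le_tsum_norm h5).trans (h6.trans (le_of_eq (by ring)))

end Cells

/-! ### The reconstruction of cells: elementary tensors -/

section Reconstruction

variable {d : ℕ}

theorem exists_tsum_lattice_ne_top (d : ℕ) : ∃ N : ℕ,
    ∑' r : Fin d → ℤ, ENNReal.ofReal ((1 + ‖latticePoint r‖) ^ N)⁻¹ ≠ ∞ := by
  obtain ⟨N, hN⟩ := exists_summable_lattice d
  exact ⟨N, (hN N le_rfl).tsum_ofReal_ne_top⟩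

theorem weight_mul_decay_le (η : PolyWeight d) {C : ℝ} {m : ℕ}
    (h : ∀ x y, η.toFun y ≤ C * η.toFun x * (1 + ‖y - x‖) ^ m) (x y : Space d) (N : ℕ) :
    η.toFun y * ((1 + ‖y - x‖) ^ (N + m))⁻¹ ≤ C * η.toFun x * ((1 + ‖y - x‖) ^ N)⁻¹ := by
  have h1 : 0 < (1 + ‖y - x‖) ^ m := by positivity
  calc η.toFun y * ((1 + ‖y - x‖) ^ (N + m))⁻¹
      ≤ C * η.toFun x * (1 + ‖y - x‖) ^ m * ((1 + ‖y - x‖) ^ (N + m))⁻¹ := by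
        gcongr; exact h x y
    _ = _ := by
        rw [pow_add, mul_inv]
        field_simp

variable {F : Type*} [NormedAddCommGroup F] [NormedSpace ℂ F] [CompleteSpace F]
  {ι : F →L[ℂ] Tempered d} (φ : UnityGenerator d)

/-- Pairings with translates are controlled by the cells, if the translations are uniformly
bounded. -/
theorem exists_weighted_pairing_le (hι : IsTMIB ι)
    (hω : ∀ x : Space d, translationNorm ι x ≤ 1) (η : PolyWeight d) (N : ℕ) :
    ∃ (M : ℕ) (C : ℝ), 0 < C ∧ ∀ (a : Tempered d) (e : (Fin d → ℤ) → F),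
      (∀ k, ι (e k) = temperedMul (cell φ k) a) → ∀ (k : Fin d → ℤ) (θ : 𝓢(Space d, ℂ)),
      ENNReal.ofReal (η.toFun (latticePoint k)) * ‖a (schwartzTranslate (latticePoint k) θ)‖ₑ
        ≤ ENNReal.ofReal (C * snorm M θ) *
          ∑' j, ENNReal.ofReal ((1 + ‖latticePoint (k - j)‖) ^ N)⁻¹ *
            (ENNReal.ofReal (η.toFun (latticePoint j)) * ‖e j‖ₑ) := by
  obtain ⟨C₁, m, hC₁, h₁⟩ := η.exists_le
  -- The bound on translations permits `τ = 0`: no power of `|k|` is lost, only powers of `|k - j|`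
  -- occur, and `m` of them pay for moving the weight from `k` to `j`.
  obtain ⟨M, C, hC, h⟩ := exists_local_pairing_le (C₀ := 1) (τ := 0) hι.translate_mem one_pos
    (fun x => by simpa using hω x) (N + m)
  refine ⟨M, C * C₁, by positivity, fun a e he k θ => ?_⟩
  have h2 : HasSum (fun j => ι (e j) (schwartzTranslate (latticePoint k) θ))
      (a (schwartzTranslate (latticePoint k) θ)) := by
    refine (hasSum_tempered_cell φ a _).congr_fun fun j => ?_
    rw [he, temperedMul_apply]
  rw [← h2.tsum_eq]
  calc _ ≤ ENNReal.ofReal (η.toFun (latticePoint k)) *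
        ∑' j, ‖ι (e j) (schwartzTranslate (latticePoint k) θ)‖ₑ := by
        gcongr
        exact enorm_tsum_le_tsum_enorm
    _ = ∑' j, ENNReal.ofReal (η.toFun (latticePoint k)) *
        ‖ι (e j) (schwartzTranslate (latticePoint k) θ)‖ₑ := ENNReal.tsum_mul_left.symm
    _ ≤ ∑' j, ENNReal.ofReal (C * C₁ * snorm M θ) *
          (ENNReal.ofReal ((1 + ‖latticePoint (k - j)‖) ^ N)⁻¹ *
            (ENNReal.ofReal (η.toFun (latticePoint j)) * ‖e j‖ₑ)) := by
        refine ENNReal.tsum_le_tsum fun j => ?_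
        have hk := (η.pos (latticePoint k)).le
        have hj := (η.pos (latticePoint j)).le
        have hs : 0 ≤ snorm M θ := apply_nonneg _ _
        rw [← ofReal_norm, ← ofReal_norm, ← ENNReal.ofReal_mul hk, ← ENNReal.ofReal_mul hj,
          ← ENNReal.ofReal_mul (by positivity), ← ENNReal.ofReal_mul (by positivity)]
        refine ENNReal.ofReal_le_ofReal ?_
        have h3 := h j (latticePoint k) (e j) θ (isLocal_of_eq_temperedMul_cell φ (he j))
        rw [Real.rpow_zero, mul_one] at h3
        have h4 := weight_mul_decay_le η h₁ (latticePoint j) (latticePoint k) N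
        have hpos : 0 < (1 + ‖latticePoint k - latticePoint j‖) ^ (N + m) := by positivity
        rw [mul_comm, ← le_div_iff₀ hpos, div_eq_mul_inv] at h3
        rw [latticePoint_sub]
        calc η.toFun (latticePoint k) * ‖ι (e j) (schwartzTranslate (latticePoint k) θ)‖
            ≤ η.toFun (latticePoint k) * (C * ‖e j‖ * snorm M θ *
              ((1 + ‖latticePoint k - latticePoint j‖) ^ (N + m))⁻¹) := by gcongr
          _ = C * ‖e j‖ * snorm M θ * (η.toFun (latticePoint k) *
              ((1 + ‖latticePoint k - latticePoint j‖) ^ (N + m))⁻¹) := by ring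
          _ ≤ C * ‖e j‖ * snorm M θ * (C₁ * η.toFun (latticePoint j) *
              ((1 + ‖latticePoint k - latticePoint j‖) ^ N)⁻¹) := by gcongr
          _ = _ := by ring
    _ = _ := ENNReal.tsum_mul_left

variable {E : Type*} [NormedAddCommGroup E] [NormedSpace ℂ E] [CompleteSpace E]
  {ιE : E →L[ℂ] Tempered d}

/-- The bilinear maps that reconstruct the cells. -/
theorem exists_reconstruction (hF : IsTMIB ι) (hω : ∀ x : Space d, translationNorm ι x ≤ 1)
    (hE : IsTMIB ιE) (η₁ η₂ : PolyWeight d) {G₁ G₂ : GlobalComponent}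
    (hG : 1 ≤ G₁.exponent⁻¹ + G₂.exponent⁻¹) (γ : 𝓢(Space d, ℂ))
    {V₁ V₂ : Type*} [SeminormedAddCommGroup V₁] [NormedSpace ℂ V₁] [SeminormedAddCommGroup V₂]
    [NormedSpace ℂ V₂] (Λ₁ : V₁ →ₗ[ℂ] Tempered d) (Λ₂ : V₂ →ₗ[ℂ] Tempered d)
    (hΛ₁ : ∀ v, (amalgam ι φ η₁ G₁).toFun (restrict (Λ₁ v)) = ‖v‖ₑ)
    (hΛ₂ : ∀ v, (amalgam ιE φ η₂ G₂).toFun (restrict (Λ₂ v)) = ‖v‖ₑ) :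
    ∃ L : (Fin d → ℤ) → V₁ →ₗ[ℂ] V₂ →ₗ[ℂ] E,
      (∃ C : ℝ≥0, ∀ a b, ∑' k, ENNReal.ofReal ((η₁.mul η₂).toFun (latticePoint k)) *
        ‖L k a b‖ₑ ≤ C * (‖a‖ₑ * ‖b‖ₑ)) ∧
      ∀ k a b θ, HasSum (fun n => ((period d ^ d : ℝ)⁻¹ : ℂ) *
          character (freq n) (-latticePoint k) *
          (Λ₁ a (schwartzTranslate (latticePoint k) (coef γ (freq n))) *
          Λ₂ b (schwartzMul (cell φ k) (schwartzModulate (freq n) θ)))) (ιE (L k a b) θ) := by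
  obtain ⟨R₁, hR₁, C₁, hC₁, hC₁'⟩ := exists_cellMap φ hF.injective η₁ G₁ Λ₁ hΛ₁
  obtain ⟨R₂, hR₂, C₂, hC₂, hC₂'⟩ := exists_cellMap φ hE.injective η₂ G₂ Λ₂ hΛ₂
  obtain ⟨M, C₀, m, hC₀, hM, hb⟩ := hE.exists_modulate
  obtain ⟨K, C₃, hC₃, h₃⟩ := exists_modulation_series hM hC₀ hb
  obtain ⟨N, hN⟩ := exists_tsum_lattice_ne_top d
  obtain ⟨M', C₄, hC₄, h₄⟩ := exists_weighted_pairing_le φ hF hω η₁ N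
  -- The norm `M'` controls the pairings with `a`; its decay of order `K` in `n` is what the
  -- modulation series in `E` requires.
  obtain ⟨C₅, hC₅, h₅⟩ := exists_coef_decay γ M' K
  set ρ : (Fin d → ℤ) → ℝ≥0∞ := fun r => ENNReal.ofReal ((1 + ‖latticePoint r‖) ^ N)⁻¹
  let x : V₁ → (Fin d → ℤ) → ℝ≥0∞ := fun a j =>
    ENNReal.ofReal (η₁.toFun (latticePoint j)) * ‖R₁ j a‖ₑ
  let y : V₂ → (Fin d → ℤ) → ℝ≥0∞ := fun b j =>
    ENNReal.ofReal (η₂.toFun (latticePoint j)) * ‖R₂ j b‖ₑ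
  let Q : (Fin d → ℤ) → V₁ → ℝ≥0∞ := fun k a => ∑' j, ρ (k - j) * x a j
  -- Finiteness needs only bounded entries of `x a` and summability of `ρ`; it allows the passage to
  -- real numbers.
  have hQ : ∀ k a, Q k a ≠ ∞ := fun k a => by
    have h6 : Q k a ≤ ∑' j, ρ (k - j) * (C₁ * ‖a‖ₑ) := by
      refine ENNReal.tsum_le_tsum fun j => ?_
      gcongr
      exact (enorm_le_eLpNorm_count (x a) j
        (one_pos.trans_le G₁.one_le_exponent).ne').trans (hC₁' a)
    refine ne_top_of_le_ne_top ?_ h6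
    have h7 : ∑' j, ρ (k - j) = ∑' r, ρ r := (Equiv.subLeft k).tsum_eq ρ
    rw [ENNReal.tsum_mul_right, h7]
    exact ENNReal.mul_ne_top hN (ENNReal.mul_ne_top (by simp) (by simp))
  let c : (Fin d → ℤ) → (Fin d → ℤ) → V₁ → ℂ := fun k n a =>
    ((period d ^ d : ℝ)⁻¹ : ℂ) * character (freq n) (-latticePoint k) *
      Λ₁ a (schwartzTranslate (latticePoint k) (coef γ (freq n)))
  have hc : ∀ k a n, (1 + ‖freq n‖) ^ K * ‖c k n a‖
      ≤ C₄ * C₅ * (Q k a).toReal / η₁.toFun (latticePoint k) := fun k a n => by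
    have hk := η₁.pos (latticePoint k)
    rw [le_div_iff₀ hk]
    have h6 : ‖c k n a‖ ≤ ‖Λ₁ a (schwartzTranslate (latticePoint k) (coef γ (freq n)))‖ := by
      simp only [c, norm_mul, norm_character, mul_one]
      exact mul_le_of_le_one_left (norm_nonneg _) norm_inv_period_pow_le
    have h7 := h₄ (Λ₁ a) (fun j => R₁ j a) (fun j => hR₁ j a) k (coef γ (freq n))
    have h8 : η₁.toFun (latticePoint k) *
        ‖Λ₁ a (schwartzTranslate (latticePoint k) (coef γ (freq n)))‖
        ≤ C₄ * snorm M' (coef γ (freq n)) * (Q k a).toReal := by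
      have h9 := ENNReal.toReal_mono (ENNReal.mul_ne_top ENNReal.ofReal_ne_top (hQ k a)) h7
      rwa [ENNReal.toReal_mul, ENNReal.toReal_mul, ENNReal.toReal_ofReal hk.le, toReal_enorm,
        ENNReal.toReal_ofReal (by positivity)] at h9
    calc (1 + ‖freq n‖) ^ K * ‖c k n a‖ * η₁.toFun (latticePoint k)
        ≤ (1 + ‖freq n‖) ^ K * ‖Λ₁ a (schwartzTranslate (latticePoint k) (coef γ (freq n)))‖ *
          η₁.toFun (latticePoint k) := by gcongr
      _ = (1 + ‖freq n‖) ^ K * (η₁.toFun (latticePoint k) *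
          ‖Λ₁ a (schwartzTranslate (latticePoint k) (coef γ (freq n)))‖) := by ring
      _ ≤ (1 + ‖freq n‖) ^ K * (C₄ * snorm M' (coef γ (freq n)) * (Q k a).toReal) := by gcongr
      _ = C₄ * ((1 + ‖freq n‖) ^ K * snorm M' (coef γ (freq n))) * (Q k a).toReal := by ring
      _ ≤ C₄ * C₅ * (Q k a).toReal := by gcongr; exact h₅ _
  have hsum : ∀ k a b, Summable fun n => c k n a • M (freq n) (R₂ k b) := fun k a b =>
    (h₃ (fun n => c k n a) _ (hc k a) (R₂ k b)).1
  let L : (Fin d → ℤ) → V₁ →ₗ[ℂ] V₂ →ₗ[ℂ] E := fun k =>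
    LinearMap.mk₂ ℂ (fun a b => ∑' n, c k n a • M (freq n) (R₂ k b))
      (fun a a' b => by
        rw [← (hsum k a b).tsum_add (hsum k a' b)]
        refine tsum_congr fun n => ?_
        rw [← add_smul]
        congr 1
        simp only [c, map_add]
        exact mul_add _ _ _)
      (fun z a b => by
        rw [← (hsum k a b).tsum_const_smul]
        refine tsum_congr fun n => ?_
        rw [smul_smul]
        congr 1
        simp only [c, map_smul]
        exact mul_left_comm _ z (Λ₁ a (schwartzTranslate (latticePoint k) (coef γ (freq n)))))
      (fun a b b' => by
        rw [← (hsum k a b).tsum_add (hsum k a b')]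
        refine tsum_congr fun n => ?_
        rw [← smul_add, map_add, map_add])
      (fun z a b => by
        rw [← (hsum k a b).tsum_const_smul]
        refine tsum_congr fun n => ?_
        rw [map_smul, map_smul, smul_comm])
  have hL : ∀ k a b, L k a b = ∑' n, c k n a • M (freq n) (R₂ k b) := fun k a b => rfl
  refine ⟨L, ⟨(C₃ * (C₄ * C₅)).toNNReal * (2 * (∑' r, ρ r).toNNReal * (C₁ * C₂)),
    fun a b => ?_⟩, fun k a b θ => ?_⟩
  · have h6 : ∀ k, ENNReal.ofReal ((η₁.mul η₂).toFun (latticePoint k)) * ‖L k a b‖ₑ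
        ≤ ENNReal.ofReal (C₃ * (C₄ * C₅)) * (y b k * Q k a) := fun k => by
      have hk₁ := η₁.pos (latticePoint k)
      have hk₂ := η₂.pos (latticePoint k)
      have h7 := (h₃ (fun n => c k n a) _ (hc k a) (R₂ k b)).2.1
      rw [← hL] at h7
      have h8 : y b k * Q k a
          = ENNReal.ofReal (η₂.toFun (latticePoint k) * ‖R₂ k b‖ * (Q k a).toReal) := by
        rw [ENNReal.ofReal_mul (by positivity), ENNReal.ofReal_mul hk₂.le,
          ENNReal.ofReal_toReal (hQ k a), ofReal_norm]
      rw [h8, ← ofReal_norm, ← ENNReal.ofReal_mul ((η₁.mul η₂).pos _).le,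
        ← ENNReal.ofReal_mul (by positivity)]
      refine ENNReal.ofReal_le_ofReal ?_
      change η₁.toFun (latticePoint k) * η₂.toFun (latticePoint k) * ‖L k a b‖ ≤ _
      calc _ ≤ η₁.toFun (latticePoint k) * η₂.toFun (latticePoint k) * (C₃ *
            (C₄ * C₅ * (Q k a).toReal / η₁.toFun (latticePoint k)) * ‖R₂ k b‖) := by gcongr
        _ = _ := by field_simp
    refine (ENNReal.tsum_le_tsum h6).trans ?_
    rw [ENNReal.tsum_mul_left]
    -- The condition on the exponents enters here.
    have h9 := tsum_convolution_le (x a) (y b) ρ G₁.one_le_exponent G₂.one_le_exponent hG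
    calc ENNReal.ofReal (C₃ * (C₄ * C₅)) * ∑' k, y b k * Q k a
        ≤ ENNReal.ofReal (C₃ * (C₄ * C₅)) * (2 * (∑' r, ρ r) *
          ((C₁ * ‖a‖ₑ) * (C₂ * ‖b‖ₑ))) := by
          refine mul_le_mul' le_rfl (h9.trans ?_)
          gcongr
          · exact hC₁' a
          · exact hC₂' b
      _ = _ := by
          push_cast
          rw [ENNReal.coe_toNNReal hN]
          change ENNReal.ofReal _ * _ = ENNReal.ofReal _ * _ * _
          ring
  · have h6 := (h₃ (fun n => c k n a) _ (hc k a) (R₂ k b)).2.2 θ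
    rw [← hL] at h6
    refine h6.congr_fun fun n => ?_
    simp only [c]
    rw [hR₂, temperedMul_apply]
    ring

end Reconstruction

/-! ### Projective tensor products -/

section Tensor

/-- The projective seminorm is the infimum over representations by sums of pure tensors, so it
dominates every seminorm with the cross bound on pure tensors. -/
theorem seminorm_le_of_tprod_le {κ : Type*} [Fintype κ] {V : κ → Type*}
    [∀ i, SeminormedAddCommGroup (V i)] [∀ i, NormedSpace ℂ (V i)]
    (q : Seminorm ℂ (⨂[ℂ] i, V i)) {C : ℝ} (hC : 0 ≤ C)
    (h : ∀ m : ∀ i, V i, q (PiTensorProduct.tprod ℂ m) ≤ C * ∏ i, ‖m i‖) (w : ⨂[ℂ] i, V i) :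
    q w ≤ C * ‖w‖ := by
  rw [PiTensorProduct.norm_def, Real.mul_iInf_of_nonneg hC]
  refine le_ciInf fun ⟨p, hp⟩ => ?_
  refine le_trans (congrArg q ((PiTensorProduct.mem_lifts_iff w p).1 hp)).ge ?_
  change _ ≤ C * (p.toList.map (fun p => ‖p.1‖ * ∏ i, ‖p.2 i‖)).sum
  generalize p.toList = l
  induction l with
  | nil => simp
  | cons a l ih =>
    rw [List.map_cons, List.sum_cons, List.map_cons, List.sum_cons, mul_add]
    refine (map_add_le_add q _ _).trans (add_le_add ?_ ih)
    rw [map_smul_eq_mul]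
    calc ‖a.1‖ * q _ ≤ ‖a.1‖ * (C * ∏ i, ‖a.2 i‖) := by gcongr; exact h _
      _ = _ := by ring

/-- A bilinear map, as a multilinear map. -/
def bilinearToMultilinear {V : Fin 2 → Type*} [∀ i, AddCommGroup (V i)] [∀ i, Module ℂ (V i)]
    {Y : Type*} [AddCommGroup Y] [Module ℂ Y] (B : V 0 →ₗ[ℂ] V 1 →ₗ[ℂ] Y) :
    MultilinearMap ℂ V Y where
  toFun m := B (m 0) (m 1)
  map_update_add' m i x y := by
    fin_cases i
    · have h : (1 : Fin 2) ≠ 0 := one_ne_zero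
      simp only [Fin.zero_eta, Function.update_self]
      rw [Function.update_of_ne h, Function.update_of_ne h, Function.update_of_ne h]
      exact LinearMap.map_add₂ B _ _ _
    · have h : (0 : Fin 2) ≠ 1 := zero_ne_one
      simp only [Fin.mk_one, Function.update_self]
      rw [Function.update_of_ne h, Function.update_of_ne h, Function.update_of_ne h]
      exact map_add _ _ _
  map_update_smul' m i c x := by
    fin_cases i
    · have h : (1 : Fin 2) ≠ 0 := one_ne_zero
      simp only [Fin.zero_eta, Function.update_self]
      rw [Function.update_of_ne h, Function.update_of_ne h]
      exact LinearMap.map_smul₂ B _ _ _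
    · have h : (0 : Fin 2) ≠ 1 := zero_ne_one
      simp only [Fin.mk_one, Function.update_self]
      rw [Function.update_of_ne h, Function.update_of_ne h]
      exact map_smul _ _ _

theorem bilinearToMultilinear_apply {V : Fin 2 → Type*} [∀ i, AddCommGroup (V i)]
    [∀ i, Module ℂ (V i)] {Y : Type*} [AddCommGroup Y] [Module ℂ Y]
    (B : V 0 →ₗ[ℂ] V 1 →ₗ[ℂ] Y) (m : ∀ i, V i) :
    bilinearToMultilinear B m = B (m 0) (m 1) := rfl

theorem ExtSeminorm.enorm_eq {X : Type*} [AddCommGroup X] [Module ℂ X] (N : ExtSeminorm X)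
    (x : N.FiniteSpace) : ‖x‖ₑ = N.toFun (N.incl x) := by
  rw [← ofReal_norm]
  exact ENNReal.ofReal_toReal (N.lt_top x).ne

variable {d : ℕ} {A : Fin 2 → ExtSeminorm (Tempered d)}

theorem tensorPairing_tprod (θ : Fin 2 → 𝓢(Space d, ℂ)) (m : ∀ i, (A i).FiniteSpace) :
    tensorPairing A θ (PiTensorProduct.tprod ℂ m)
      = (A 0).incl (m 0) (θ 0) * (A 1).incl (m 1) (θ 1) := by
  rw [tensorPairing, PiTensorProduct.lift.tprod]
  simp only [MultilinearMap.compLinearMap_apply, MultilinearMap.mkPiAlgebra_apply,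
    Fin.prod_univ_two]
  rfl

theorem norm_tensorPairing_le {θ : Fin 2 → 𝓢(Space d, ℂ)} {C₀ C₁ : ℝ} (h0 : 0 ≤ C₀)
    (hC₁ : 0 ≤ C₁)
    (h₀ : ∀ a, ‖(A 0).incl a (θ 0)‖ ≤ C₀ * ‖a‖) (h₁ : ∀ b, ‖(A 1).incl b (θ 1)‖ ≤ C₁ * ‖b‖)
    (w : AlgTensor A) : ‖tensorPairing A θ w‖ ≤ C₀ * C₁ * ‖w‖ := by
  refine seminorm_le_of_tprod_le ((normSeminorm ℂ ℂ).comp (tensorPairing A θ)) (by positivity)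
    (fun m => ?_) w
  change ‖tensorPairing A θ _‖ ≤ _
  rw [tensorPairing_tprod, norm_mul, Fin.prod_univ_two]
  calc _ ≤ C₀ * ‖m 0‖ * (C₁ * ‖m 1‖) := mul_le_mul (h₀ _) (h₁ _) (norm_nonneg _) (by positivity)
    _ = _ := by ring

end Tensor

/-! ### The norm of the modulation space dominates the amalgam norm -/

section Lower

variable {d : ℕ} {E F : Type*} [NormedAddCommGroup E] [NormedSpace ℂ E] [CompleteSpace E]
  [NormedAddCommGroup F] [NormedSpace ℂ F] [CompleteSpace F]
  {ιE : E →L[ℂ] Tempered d} {ιF : F →L[ℂ] Tempered d} (φ : UnityGenerator d)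

/-- The linear maps on the algebraic tensor product that reconstruct the cells. -/
theorem exists_tensor_reconstruction (hF : IsTMIB ιF)
    (hω : ∀ x : Space d, translationNorm ιF x ≤ 1)
    (hE : IsTMIB ιE) (η₁ η₂ : PolyWeight d) {G₁ G₂ : GlobalComponent}
    (hG : 1 ≤ G₁.exponent⁻¹ + G₂.exponent⁻¹) (γ : 𝓢(Space d, ℂ))
    {A : Fin 2 → ExtSeminorm (Tempered d)}
    (hA₀ : ∀ f, (A 0).toFun f = (amalgam ιF φ η₁ G₁).toFun (restrict f))
    (hA₁ : ∀ f, (A 1).toFun f = (amalgam ιE φ η₂ G₂).toFun (restrict (𝓕⁻ f))) :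
    ∃ L : (Fin d → ℤ) → AlgTensor A →ₗ[ℂ] E,
      (∃ C : ℝ≥0, ∀ (s : Finset (Fin d → ℤ)) (w : AlgTensor A),
        ∑ k ∈ s, (η₁.mul η₂).toFun (latticePoint k) * ‖L k w‖ ≤ C * ‖w‖) ∧
      ∀ k w θ, HasSum (fun n => ((period d ^ d : ℝ)⁻¹ : ℂ) *
          character (freq n) (-latticePoint k) *
          tensorPairing A ![schwartzTranslate (latticePoint k) (coef γ (freq n)),
            𝓕⁻ (schwartzMul (cell φ k) (schwartzModulate (freq n) θ))] w) (ιE (L k w) θ) := by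
  obtain ⟨B, ⟨C, hC⟩, hB⟩ := exists_reconstruction φ hF hω hE η₁ η₂ hG γ (A 0).incl
    ((FourierTransform.fourierInvₗ ℂ (Tempered d)).comp (A 1).incl)
    (fun v => by rw [(A 0).enorm_eq, hA₀]) (fun v => by rw [(A 1).enorm_eq, hA₁]; rfl)
  refine ⟨fun k => PiTensorProduct.lift (bilinearToMultilinear
    (V := fun i => (A i).FiniteSpace) (B k)), ⟨C, fun s w => ?_⟩, fun k w θ => ?_⟩
  · let q : Seminorm ℂ (AlgTensor A) := Seminorm.of
      (fun w => ∑ k ∈ s, (η₁.mul η₂).toFun (latticePoint k) *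
        ‖PiTensorProduct.lift (bilinearToMultilinear
          (V := fun i => (A i).FiniteSpace) (B k)) w‖)
      (fun x y => by
        rw [← Finset.sum_add_distrib]
        refine Finset.sum_le_sum fun k _ => ?_
        rw [← mul_add, map_add]
        exact mul_le_mul_of_nonneg_left (norm_add_le _ _) ((η₁.mul η₂).pos _).le)
      (fun c x => by
        rw [Finset.mul_sum]
        refine Finset.sum_congr rfl fun k _ => ?_
        rw [map_smul, norm_smul]
        ring)
    have hq : ∀ w, q w = ∑ k ∈ s, (η₁.mul η₂).toFun (latticePoint k) *
        ‖PiTensorProduct.lift (bilinearToMultilinear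
          (V := fun i => (A i).FiniteSpace) (B k)) w‖ := fun w => rfl
    rw [← hq]
    refine seminorm_le_of_tprod_le q (C := (C : ℝ)) C.coe_nonneg (fun m => ?_) w
    rw [hq, Fin.prod_univ_two]
    simp only [PiTensorProduct.lift.tprod, bilinearToMultilinear_apply]
    have h1 := (ENNReal.sum_le_tsum s).trans (hC (m 0) (m 1))
    have h2 := ENNReal.toReal_mono (by finiteness) h1
    rw [ENNReal.toReal_sum (fun _ _ => by finiteness)] at h2
    simpa only [ENNReal.toReal_mul, toReal_enorm, ENNReal.toReal_ofReal ((η₁.mul η₂).pos _).le,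
      ENNReal.coe_toReal] using h2
  · induction w using PiTensorProduct.induction_on with
    | smul_tprod r m =>
      simp only [map_smul, PiTensorProduct.lift.tprod, bilinearToMultilinear_apply]
      refine ((hB k (m 0) (m 1) θ).const_smul r).congr_fun fun n => ?_
      rw [tensorPairing_tprod]
      simp only [smul_eq_mul]
      exact mul_left_comm _ r _
    | add x y hx hy =>
      simp only [map_add]
      refine (hx.add hy).congr_fun fun n => ?_
      exact mul_add _ _ _

/-- The pairings on the algebraic tensor product are jointly continuous. -/
theorem exists_tensorPairing_le (hF : IsTMIB ιF) (hE : IsTMIB ιE) (η₁ η₂ : PolyWeight d)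
    (G₁ G₂ : GlobalComponent) {A : Fin 2 → ExtSeminorm (Tempered d)}
    (hA₀ : ∀ f, (A 0).toFun f = (amalgam ιF φ η₁ G₁).toFun (restrict f))
    (hA₁ : ∀ f, (A 1).toFun f = (amalgam ιE φ η₂ G₂).toFun (restrict (𝓕⁻ f))) :
    ∃ (M : ℕ) (C : ℝ), 0 < C ∧ ∀ (θ ψ : 𝓢(Space d, ℂ)) (w : AlgTensor A),
      ‖tensorPairing A ![θ, 𝓕⁻ ψ] w‖ ≤ C * snorm M θ * snorm M ψ * ‖w‖ := by
  obtain ⟨M₁, C₁, hC₁, h₁⟩ := exists_amalgam_pairing_le φ hF η₁ G₁ (A 0).incl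
    (fun v => by rw [(A 0).enorm_eq, hA₀])
  obtain ⟨M₂, C₂, hC₂, h₂⟩ := exists_amalgam_pairing_le φ hE η₂ G₂
    ((FourierTransform.fourierInvₗ ℂ (Tempered d)).comp (A 1).incl)
    (fun v => by rw [(A 1).enorm_eq, hA₁]; rfl)
  refine ⟨max M₁ M₂, C₁ * C₂, by positivity, fun θ ψ w => ?_⟩
  have h3 : 0 ≤ snorm (max M₁ M₂) θ := apply_nonneg _ _
  have h4 : 0 ≤ snorm (max M₁ M₂) ψ := apply_nonneg _ _
  have h := norm_tensorPairing_le (A := A) (θ := ![θ, 𝓕⁻ ψ])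
    (C₀ := C₁ * snorm (max M₁ M₂) θ) (C₁ := C₂ * snorm (max M₁ M₂) ψ) (by positivity)
    (by positivity) (fun a => ?_) (fun b => ?_) w
  · exact h.trans (le_of_eq (by ring))
  · refine (h₁ a θ).trans ?_
    rw [mul_right_comm]
    gcongr
    exact snorm_mono (le_max_left _ _) _
  · refine (h₂ b ψ).trans ?_
    rw [mul_right_comm]
    gcongr
    exact snorm_mono (le_max_right _ _) _

/-- A Schwartz function `y ↦ w (s - y)`. -/
theorem exists_reflect (w : 𝓢(Space d, ℂ)) (s : Space d) :
    ∃ θ : 𝓢(Space d, ℂ), ∀ y, θ y = w (s - y) :=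
  ⟨_, fourierInv_modulate_fourierInv w s⟩

theorem sconv_translate_apply (w c : 𝓢(Space d, ℂ)) (x t : Space d) :
    sconv w (schwartzTranslate x c) t = ∫ y, c y * w (t - x - y) := by
  rw [sconv_apply, ← integral_sub_right_eq_self (fun y => c y * w (t - x - y)) x]
  refine integral_congr_ae (Eventually.of_forall fun y => ?_)
  simp only [schwartzTranslate_apply, sub_sub_sub_cancel_right]
  exact mul_comm _ _

/-- The reproducing formula for dual windows `g` and `γ`, localized to a cell. -/
theorem hasSum_reproducing {g γ : 𝓢(Space d, ℂ)}
    (hγ : ∫ x, γ x * schwartzConj g x = 1) (f : Tempered d) (k : Fin d → ℤ)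
    (θ : 𝓢(Space d, ℂ)) :
    HasSum (fun n => ((period d ^ d : ℝ)⁻¹ : ℂ) * character (freq n) (-latticePoint k) *
      f (schwartzMul (sconv (schwartzConj g) (schwartzTranslate (latticePoint k)
        (coef γ (freq n)))) (schwartzMul (cell φ k) (schwartzModulate (freq n) θ))))
      (f (schwartzMul (cell φ k) θ)) := by
  set c : (Fin d → ℤ) → ℂ := fun n =>
    ((period d ^ d : ℝ)⁻¹ : ℂ) * character (freq n) (-latticePoint k) with hc_def
  have hc : ∀ n, ‖c n‖ ≤ 1 := fun n => by
    simp only [c, norm_mul, norm_character, mul_one]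
    exact norm_inv_period_pow_le
  set K : (Fin d → ℤ) → 𝓢(Space d, ℂ) := fun n => c n •
    schwartzMul (sconv (schwartzConj g) (schwartzTranslate (latticePoint k) (coef γ (freq n))))
      (schwartzMul (cell φ k) (schwartzModulate (freq n) θ))
  have h := tempered_hasSum (K := K) (s := schwartzMul (cell φ k) θ) (fun M => ?_) (fun t => ?_) f
  · simpa only [K, map_smul, smul_eq_mul] using h
  · obtain ⟨N₀, S, hS, h₀⟩ := exists_tsum_le_of_decay d
    obtain ⟨N₁, C₁, hC₁, h₁⟩ := exists_snorm_modulate_le (d := d) M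
    obtain ⟨N₂, C₂, hC₂, h₂⟩ := exists_snorm_sconv_le (schwartzConj g) M
    -- Of the decay, `N₁` orders pay for the modulation of `θ` and `N₀` for the summation over `n`.
    obtain ⟨C₃, hC₃, h₃⟩ := exists_coef_decay γ N₂ (N₀ + N₁)
    refine (h₀ (fun n => snorm M (K n)) (2 ^ M * 4 ^ M * (C₂ * (2 ^ N₂ *
      (1 + ‖latticePoint k‖) ^ N₂)) * C₃ * (2 ^ M * 4 ^ M * snorm M (cell φ k) *
        (C₁ * snorm N₁ θ))) (fun _ => apply_nonneg _ _) fun n => ?_).1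
    simp only [K]
    rw [map_smul_eq_mul]
    set z := sconv (schwartzConj g) (schwartzTranslate (latticePoint k) (coef γ (freq n)))
    have hz : snorm M z ≤ C₂ * (2 ^ N₂ * (1 + ‖latticePoint k‖) ^ N₂ *
        snorm N₂ (coef γ (freq n))) :=
      (h₂ _).trans (by gcongr; exact snorm_schwartzTranslate_le _ _ _)
    have hm : snorm M (schwartzMul (cell φ k) (schwartzModulate (freq n) θ))
        ≤ 2 ^ M * 4 ^ M * snorm M (cell φ k) * (C₁ * (1 + ‖freq n‖) ^ N₁ * snorm N₁ θ) :=
      (snorm_schwartzMul_le _ _ _).trans (by gcongr; exact h₁ _ _)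
    calc (1 + ‖freq n‖) ^ N₀ * (‖c n‖ *
          snorm M (schwartzMul z (schwartzMul (cell φ k) (schwartzModulate (freq n) θ))))
        ≤ (1 + ‖freq n‖) ^ N₀ * (1 * (2 ^ M * 4 ^ M * (C₂ * (2 ^ N₂ *
          (1 + ‖latticePoint k‖) ^ N₂ * snorm N₂ (coef γ (freq n)))) *
          (2 ^ M * 4 ^ M * snorm M (cell φ k) * (C₁ * (1 + ‖freq n‖) ^ N₁ * snorm N₁ θ)))) := by
          gcongr
          · exact hc n
          · refine (snorm_schwartzMul_le _ _ _).trans ?_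
            gcongr
      _ = 2 ^ M * 4 ^ M * (C₂ * (2 ^ N₂ * (1 + ‖latticePoint k‖) ^ N₂)) *
          ((1 + ‖freq n‖) ^ (N₀ + N₁) * snorm N₂ (coef γ (freq n))) *
          (2 ^ M * 4 ^ M * snorm M (cell φ k) * (C₁ * snorm N₁ θ)) := by
          rw [pow_add]; ring
      _ ≤ _ := by gcongr; exact h₃ _
  · simp only [K, _root_.smul_apply, schwartzMul_apply, schwartzModulate_apply, smul_eq_mul]
    by_cases ht : cell φ k t = 0
    · simp [ht]
    · obtain ⟨ψ, hψ⟩ := exists_reflect (schwartzConj g) (t - latticePoint k)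
      have h1 := hasSum_coef γ ψ (norm_le_of_mem_cube (mem_cube_of_cell_ne_zero φ ht))
      have h2 : ∫ x, γ (t - latticePoint k - x) * ψ x = 1 := by
        simp only [hψ]
        rw [integral_sub_left_eq_self (fun x => γ x * schwartzConj g x)]
        exact hγ
      rw [h2] at h1
      have h3 := h1.mul_right (cell φ k t * θ t)
      rw [one_mul] at h3
      refine h3.congr_fun fun n => ?_
      rw [sconv_translate_apply]
      simp only [c, hψ]
      rw [sub_eq_add_neg, character_add_left]
      ring

/-- If the short-time Fourier transform of `f` is represented by `u`, then the cells of `f` belong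
to `E`, and their norms are controlled by that of `u`. -/
theorem exists_cells_of_represents (hF : IsTMIB ιF)
    (hω : ∀ x : Space d, translationNorm ιF x ≤ 1)
    (hE : IsTMIB ιE) (η₁ η₂ : PolyWeight d) {G₁ G₂ : GlobalComponent}
    (hG : 1 ≤ G₁.exponent⁻¹ + G₂.exponent⁻¹) {g γ : 𝓢(Space d, ℂ)}
    (hγ : ∫ x, γ x * schwartzConj g x = 1) {A : Fin 2 → ExtSeminorm (Tempered d)}
    (hA₀ : ∀ f, (A 0).toFun f = (amalgam ιF φ η₁ G₁).toFun (restrict f))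
    (hA₁ : ∀ f, (A 1).toFun f = (amalgam ιE φ η₂ G₂).toFun (restrict (𝓕⁻ f))) :
    ∃ C : ℝ≥0, ∀ (f : Tempered d) (v : Tempered2 d) (u : ProjTensor A),
      IsGivenBy v (stft g f) → Represents A u v →
      ∃ e : (Fin d → ℤ) → E, (∀ k, ιE (e k) = temperedMul (cell φ k) f) ∧
        ∀ s : Finset (Fin d → ℤ),
          ∑ k ∈ s, (η₁.mul η₂).toFun (latticePoint k) * ‖e k‖ ≤ C * ‖u‖ := by
  obtain ⟨L, ⟨C, hC⟩, hL⟩ := exists_tensor_reconstruction φ hF hω hE η₁ η₂ hG γ hA₀ hA₁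
  obtain ⟨M, C₁, hC₁, h₁⟩ := exists_tensorPairing_le φ hF hE η₁ η₂ G₁ G₂ hA₀ hA₁
  refine ⟨C, fun f v u hv ⟨w, hw, hpair⟩ => ?_⟩
  have hLk : ∀ k w, ‖L k w‖ ≤ ((η₁.mul η₂).toFun (latticePoint k))⁻¹ * C * ‖w‖ := fun k w => by
    have h2 := hC {k} w
    rw [Finset.sum_singleton] at h2
    have h3 := (η₁.mul η₂).pos (latticePoint k)
    rw [mul_assoc, ← div_eq_inv_mul, le_div_iff₀ h3, mul_comm]
    exact h2
  have hcauchy : CauchySeq w := by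
    have h2 := hw.cauchySeq
    refine (UniformSpace.Completion.isUniformInducing_coe (AlgTensor A)).cauchy_map_iff.1 ?_
    rwa [Filter.map_map]
  have hnorm : Tendsto (fun n => ‖w n‖) atTop (𝓝 ‖u‖) := by
    have h2 := hw.norm
    simpa only [UniformSpace.Completion.norm_coe] using h2
  -- The reconstruction maps are bounded for each `k`, so they carry the Cauchy sequence of
  -- algebraic tensors to a convergent sequence in `E`.
  have hlim : ∀ k, ∃ e : E, Tendsto (fun n => L k (w n)) atTop (𝓝 e) := fun k => by
    refine cauchySeq_tendsto_of_complete ?_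
    exact ((L k).mkContinuous _ (hLk k)).uniformContinuous.comp_cauchySeq hcauchy
  choose e he using hlim
  refine ⟨e, fun k => ?_, fun s => ?_⟩
  · ext θ
    have h2 : Tendsto (fun n => ιE (L k (w n)) θ) atTop (𝓝 (ιE (e k) θ)) :=
      ((pairingCLM ιE θ).continuous.tendsto (e k)).comp (he k)
    refine tendsto_nhds_unique h2 ?_
    set c : (Fin d → ℤ) → ℂ := fun n =>
      ((period d ^ d : ℝ)⁻¹ : ℂ) * character (freq n) (-latticePoint k)
    have hc : ∀ n, ‖c n‖ ≤ 1 := fun n => by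
      simp only [c, norm_mul, norm_character, mul_one]
      exact norm_inv_period_pow_le
    set a : (Fin d → ℤ) → 𝓢(Space d, ℂ) := fun n =>
      schwartzTranslate (latticePoint k) (coef γ (freq n))
    set b : (Fin d → ℤ) → 𝓢(Space d, ℂ) := fun n =>
      schwartzMul (cell φ k) (schwartzModulate (freq n) θ)
    have h3 : ∀ n, ιE (L k (w n)) θ = ∑' i, c i * tensorPairing A ![a i, 𝓕⁻ (b i)] (w n) :=
      fun n => (hL k (w n) θ).tsum_eq.symm
    have h4 : HasSum (fun i => c i * v (schwartzTensor (a i) (𝓕⁻ (b i))))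
        (temperedMul (cell φ k) f θ) := by
      rw [temperedMul_apply]
      refine (hasSum_reproducing φ hγ f k θ).congr_fun fun n => ?_
      rw [isGivenBy_stft_apply_tensor hv, FourierTransform.fourier_fourierInv_eq]
    simp only [h3]
    rw [← h4.tsum_eq]
    obtain ⟨N₀, S, hS, h₀⟩ := exists_tsum_le_of_decay d
    obtain ⟨N₁, C₂, hC₂, h₂⟩ := exists_snorm_modulate_le (d := d) M
    obtain ⟨C₃, hC₃, h₃⟩ := exists_coef_decay γ M (N₀ + N₁)
    have hsum : Summable fun i => snorm M (a i) * snorm M (b i) := by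
      refine (h₀ _ (2 ^ M * (1 + ‖latticePoint k‖) ^ M * C₃ * (2 ^ M * 4 ^ M *
        snorm M (cell φ k) * (C₂ * snorm N₁ θ))) (fun _ => by positivity) fun n => ?_).1
      have ha : snorm M (a n) ≤ 2 ^ M * (1 + ‖latticePoint k‖) ^ M * snorm M (coef γ (freq n)) :=
        snorm_schwartzTranslate_le _ _ _
      have hb : snorm M (b n) ≤ 2 ^ M * 4 ^ M * snorm M (cell φ k) *
          (C₂ * (1 + ‖freq n‖) ^ N₁ * snorm N₁ θ) :=
        (snorm_schwartzMul_le _ _ _).trans (by gcongr; exact h₂ _ _)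
      calc (1 + ‖freq n‖) ^ N₀ * (snorm M (a n) * snorm M (b n))
          ≤ (1 + ‖freq n‖) ^ N₀ * ((2 ^ M * (1 + ‖latticePoint k‖) ^ M *
            snorm M (coef γ (freq n))) * (2 ^ M * 4 ^ M * snorm M (cell φ k) *
            (C₂ * (1 + ‖freq n‖) ^ N₁ * snorm N₁ θ))) := by gcongr
        _ = 2 ^ M * (1 + ‖latticePoint k‖) ^ M *
            ((1 + ‖freq n‖) ^ (N₀ + N₁) * snorm M (coef γ (freq n))) *
            (2 ^ M * 4 ^ M * snorm M (cell φ k) * (C₂ * snorm N₁ θ)) := by rw [pow_add]; ring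
        _ ≤ _ := by gcongr; exact h₃ _
    -- Representation gives convergence only for each fixed pair of test functions. Joint continuity
    -- of the pairing supplies a majorant summable in `i` and, as soon as `‖w n‖ ≤ ‖u‖ + 1`, uniform
    -- in `n`.
    refine tendsto_tsum_of_dominated_convergence
      (bound := fun i => C₁ * (‖u‖ + 1) * (snorm M (a i) * snorm M (b i)))
      (hsum.mul_left _) (fun i => ?_) ?_
    · exact (hpair ![a i, 𝓕⁻ (b i)]).const_mul (c i)
    · filter_upwards [hnorm.eventually_le_const (lt_add_one ‖u‖)] with n hn i
      rw [norm_mul]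
      calc ‖c i‖ * ‖tensorPairing A ![a i, 𝓕⁻ (b i)] (w n)‖
          ≤ 1 * (C₁ * snorm M (a i) * snorm M (b i) * (‖u‖ + 1)) := by
            gcongr
            · exact hc i
            · exact (h₁ _ _ _).trans (by gcongr)
        _ = _ := by ring
  · refine le_of_tendsto_of_tendsto' (tendsto_finsetSum s fun k _ => ((he k).norm.const_mul _))
      (hnorm.const_mul (C : ℝ)) fun n => hC s (w n)

end Lower

/-! ### Dual windows and the bound of the amalgam norm by the modulation norm -/

section LowerBound

variable {d : ℕ}

/-- A scalar multiple of `g` itself serves, because `∫ |g|²` is nonzero for a nonzero continuous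
function. -/
theorem exists_dual_window {g : 𝓢(Space d, ℂ)} (hg : g ≠ 0) :
    ∃ γ : 𝓢(Space d, ℂ), ∫ x, γ x * schwartzConj g x = 1 := by
  have hne : ∫ x, g x * schwartzConj g x ≠ 0 := by
    intro h0
    have h1 : ∀ x, g x * schwartzConj g x = ((‖g x‖ ^ 2 : ℝ) : ℂ) := fun x => by
      rw [schwartzConj_apply, Complex.mul_conj, Complex.normSq_eq_norm_sq]
    have hintg : Integrable fun x => ‖g x‖ ^ 2 := by
      have h2 := (schwartzMul g (schwartzConj g)).integrable (μ := volume)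
      have h3 := h2.norm
      refine h3.congr (Eventually.of_forall fun x => ?_)
      simp only [schwartzMul_apply, h1, Complex.norm_real]
      exact Real.norm_of_nonneg (by positivity)
    simp only [h1] at h0
    rw [integral_complex_ofReal, Complex.ofReal_eq_zero,
      integral_eq_zero_iff_of_nonneg (fun x => by positivity) hintg] at h0
    have h4 := (Continuous.ae_eq_iff_eq volume (by fun_prop) continuous_zero).1 h0
    apply hg
    ext x
    simpa using congrFun h4 x
  refine ⟨(∫ x, g x * schwartzConj g x)⁻¹ • g, ?_⟩
  simp only [_root_.smul_apply, smul_eq_mul, mul_assoc]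
  rw [integral_const_mul, inv_mul_cancel₀ hne]

variable {E F : Type*} [NormedAddCommGroup E] [NormedSpace ℂ E] [CompleteSpace E]
  [NormedAddCommGroup F] [NormedSpace ℂ F] [CompleteSpace F]
  {ιE : E →L[ℂ] Tempered d} {ιF : F →L[ℂ] Tempered d} (φ : UnityGenerator d)

/-- The estimate of the cells applies to all competitors in the two infima. It is an `ℓ^1` estimate,
which is why the global component `G` on the left is arbitrary. -/
theorem exists_amalgam_le_modulationSpaceNorm (hF : IsTMIB ιF)
    (hω : ∀ x : Space d, translationNorm ιF x ≤ 1)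
    (hE : IsTMIB ιE) (η₁ η₂ : PolyWeight d) {G₁ G₂ : GlobalComponent}
    (hG : 1 ≤ G₁.exponent⁻¹ + G₂.exponent⁻¹) (G : GlobalComponent) {g : 𝓢(Space d, ℂ)}
    (hg : g ≠ 0) :
    ∃ C : ℝ≥0, 0 < C ∧ ∀ f : Tempered d,
      (amalgam ιE φ (η₁.mul η₂) G).toFun (restrict f)
        ≤ C * modulationSpaceNorm g (projTensorNorm (temperedAmalgam ιF φ η₁ G₁)
          (fourierImage (temperedAmalgam ιE φ η₂ G₂))) f := by
  obtain ⟨γ, hγ⟩ := exists_dual_window hg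
  obtain ⟨C₁, h₁⟩ := exists_cells_of_represents φ hF hω hE η₁ η₂ hG hγ
    (A := ![temperedAmalgam ιF φ η₁ G₁, fourierImage (temperedAmalgam ιE φ η₂ G₂)])
    (fun _ => rfl) (fun _ => rfl)
  obtain ⟨C₂, hC₂, h₂⟩ := exists_amalgam_le_tsum ιE φ (η₁.mul η₂)
  obtain ⟨C₃, m, hC₃, h₃⟩ := exists_norm_le_of_weight (E := E) (η₁.mul η₂)
  refine ⟨C₂ * (C₁ + 1), by positivity, fun f => ?_⟩
  have hC : ((C₂ * (C₁ + 1) : ℝ≥0) : ℝ≥0∞) ≠ 0 := by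
    have : (0 : ℝ≥0) < C₂ * (C₁ + 1) := by positivity
    exact_mod_cast this.ne'
  unfold modulationSpaceNorm projTensorNorm
  simp only [ENNReal.mul_iInf_of_ne hC ENNReal.coe_ne_top]
  refine le_iInf₂ fun v hv => le_iInf₂ fun u hu => ?_
  obtain ⟨e, he, hsum⟩ := h₁ f v u hv hu
  have hk : ∀ k, ‖e k‖ ≤ C₃ * (C₁ * ‖u‖) * (1 + ‖latticePoint k‖) ^ m := fun k => by
    refine h₃ k _ _ (by positivity) ?_
    rw [← ofReal_norm, ← ENNReal.ofReal_mul ((η₁.mul η₂).pos _).le]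
    refine ENNReal.ofReal_le_ofReal ?_
    simpa using hsum {k}
  refine (h₂ G _ (memLoc_of_cells φ hE he hk)).trans ?_
  rw [ENNReal.coe_mul, mul_assoc]
  gcongr
  rw [ENNReal.tsum_eq_iSup_sum]
  refine iSup_le fun s => ?_
  simp only [cellNorm_eq φ hE.injective (η₁.mul η₂) he]
  rw [← ENNReal.ofReal_sum_of_nonneg fun k _ => by
    have := ((η₁.mul η₂).pos (latticePoint k)).le
    positivity]
  calc ENNReal.ofReal _ ≤ ENNReal.ofReal (C₁ * ‖u‖) := ENNReal.ofReal_le_ofReal (hsum s)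
    _ = C₁ * ‖u‖ₑ := by
        rw [ENNReal.ofReal_mul C₁.coe_nonneg, ofReal_norm, ENNReal.ofReal_coe_nnreal]
    _ ≤ _ := by gcongr; exact_mod_cast le_self_add

end LowerBound

/-! ### Elements of amalgam spaces are tempered -/

section TemperedExtension

variable {d : ℕ} {E : Type*} [NormedAddCommGroup E] [NormedSpace ℂ E] [CompleteSpace E]
  {ι : E →L[ℂ] Tempered d} (φ : UnityGenerator d)

theorem finite_latticePoint_le (R : ℝ) : {k : Fin d → ℤ | ‖latticePoint k‖ ≤ R}.Finite := by
  obtain ⟨N, hN⟩ := exists_summable_lattice d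
  have h1 := (hN (N + 1) (Nat.le_succ N)).tendsto_cofinite_zero
  have hR : 0 < ((1 + max R 0) ^ (N + 1))⁻¹ := by positivity
  have h2 := h1.eventually_lt_const hR
  rw [Filter.eventually_cofinite] at h2
  refine h2.subset fun k hk => ?_
  simp only [Set.mem_ofPred_eq, not_lt] at hk ⊢
  gcongr
  exact hk.trans (le_max_left _ _)

/-- A distribution is the sum of its cells. -/
theorem hasSum_distr_cell (T : Distr d) (ψ : Test d) :
    HasSum (fun k => T (testMul (testTranslate (latticePoint k) φ.toTest) ψ)) (T ψ) := by
  obtain ⟨R, hR⟩ := ψ.hasCompactSupport.isCompact.isBounded.exists_norm_le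
  -- Only these cells meet the support of `ψ`, so the sum is finite and linearity of `T` suffices.
  have hfin := finite_latticePoint_le (d := d) (R + Real.sqrt d)
  have hzero : ∀ k ∉ hfin.toFinset, ∀ x,
      testMul (testTranslate (latticePoint k) φ.toTest) ψ x = 0 := fun k hk x => by
    change φ.toTest (x - latticePoint k) * ψ x = 0
    by_contra hne
    apply hk
    rw [Set.Finite.mem_toFinset, Set.mem_ofPred_eq]
    have h1 : ‖x‖ ≤ R := hR x (subset_tsupport _ (right_ne_zero_of_mul hne))
    have h2 : ‖x - latticePoint k‖ ≤ Real.sqrt d := by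
      refine norm_le_of_mem_cube (mem_cube_of_cell_ne_zero φ ?_)
      rw [cell_apply]
      exact_mod_cast left_ne_zero_of_mul hne
    have h3 := norm_sub_le x (x - latticePoint k)
    rw [sub_sub_cancel] at h3
    linarith
  have h1 : ψ = ∑ k ∈ hfin.toFinset, testMul (testTranslate (latticePoint k) φ.toTest) ψ := by
    ext x
    have h2 : HasSum (fun k : Fin d → ℤ =>
        testMul (testTranslate (latticePoint k) φ.toTest) ψ x) (ψ x) := by
      have := (φ.hasSum x).mul_right (ψ x)
      rwa [one_mul] at this
    have h3 : HasSum (fun k : Fin d → ℤ =>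
        testMul (testTranslate (latticePoint k) φ.toTest) ψ x)
        (∑ k ∈ hfin.toFinset, testMul (testTranslate (latticePoint k) φ.toTest) ψ x) :=
      hasSum_sum_of_ne_finset_zero fun k hk => hzero k hk x
    rw [h2.unique h3]
    have h4 : ∀ s : Finset (Fin d → ℤ),
        (∑ k ∈ s, testMul (testTranslate (latticePoint k) φ.toTest) ψ) x
          = ∑ k ∈ s, testMul (testTranslate (latticePoint k) φ.toTest) ψ x := fun s => by
      induction s using Finset.cons_induction with
      | empty => rfl
      | cons a s ha ih =>
        rw [Finset.sum_cons, Finset.sum_cons, ← ih]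
        rfl
    exact (h4 _).symm
  have h5 : T ψ = ∑ k ∈ hfin.toFinset,
      T (testMul (testTranslate (latticePoint k) φ.toTest) ψ) := by
    conv_lhs => rw [h1]
    exact map_sum T _ _
  rw [h5]
  refine hasSum_sum_of_ne_finset_zero fun k hk => ?_
  have h6 : testMul (testTranslate (latticePoint k) φ.toTest) ψ = 0 := by
    ext x
    exact hzero k hk x
  rw [h6, map_zero]

/-- Each cell is an element of `E`, hence tempered, and the cells grow at most polynomially.
Localization makes the sum of their pairings converge with a Schwartz bound, and this sum is the
tempered extension. -/
theorem exists_restrict_eq (hι : IsTMIB ι) (η : PolyWeight d) (G : GlobalComponent) {T : Distr d}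
    (hT : (amalgam ι φ η G).toFun T < ∞) : ∃ f : Tempered d, restrict f = T := by
  obtain ⟨C₁, m, hC₁, h₁⟩ := exists_norm_le_of_weight (E := E) η
  obtain ⟨C₂, hC₂, h₂⟩ := exists_eLpNorm_cellNorm_le_amalgam ι φ η
  obtain ⟨M, C₃, hC₃, h₃⟩ := exists_summable_pairing hι m
  choose e he using fun k => (amalgam_lt_top ι φ η hT).1.1
    (testTranslate (latticePoint k) φ.toTest)
  set B : ℝ := (C₂ * (amalgam ι φ η G).toFun T).toReal
  have hB : ENNReal.ofReal B = C₂ * (amalgam ι φ η G).toFun T :=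
    ENNReal.ofReal_toReal (ENNReal.mul_ne_top ENNReal.coe_ne_top hT.ne)
  have hk : ∀ k, ‖e k‖ ≤ C₁ * B * (1 + ‖latticePoint k‖) ^ m := fun k => by
    refine h₁ k _ _ ENNReal.toReal_nonneg ?_
    rw [hB]
    refine le_trans ?_ (h₂ G T hT)
    refine le_trans (le_of_eq ?_) (enorm_le_eLpNorm_count (cellNorm ι φ η T) k
      (one_pos.trans_le G.one_le_exponent).ne')
    rw [enorm_eq_self, cellNorm, localNorm_eq φ hι.injective (he k)]
  have hB0 : 0 ≤ B := ENNReal.toReal_nonneg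
  have h4 := h₃ e (C₁ * B) (by positivity) (fun k => (he k).isLocal φ) hk
  let f : 𝓢(Space d, ℂ) →L[ℂ] ℂ :=
    SchwartzMap.mkCLMtoNormedSpace (fun θ => ∑' k, ι (e k) θ)
      (fun θ ψ => by
        rw [← (h4 θ).1.of_norm.tsum_add (h4 ψ).1.of_norm]
        exact tsum_congr fun k => map_add _ _ _)
      (fun c θ => by
        rw [RingHom.id_apply, smul_eq_mul, ← tsum_mul_left]
        exact tsum_congr fun k => map_smul _ _ _)
      ⟨Finset.Iic (M, M), C₃ * (C₁ * B), by positivity, fun θ =>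
        (norm_tsum_le_tsum_norm (h4 θ).1).trans (h4 θ).2⟩
  refine ⟨ContinuousLinearMap.toPointwiseConvergenceCLM _ _ _ _ f, ?_⟩
  ext ψ
  change ∑' k, ι (e k) (testToSchwartz ψ) = T ψ
  rw [← (hasSum_distr_cell φ T ψ).tsum_eq]
  exact tsum_congr fun k => he k ψ

end TemperedExtension

/-! ### The amalgam norm dominates the norm of the modulation space -/

section AmalgamEstimates

variable {d : ℕ} {E : Type*} [NormedAddCommGroup E] [NormedSpace ℂ E]
  {ι : E →L[ℂ] Tempered d} (φ : UnityGenerator d)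

/-- The amalgam norm of a distribution whose cells decay away from the point `k`. -/
theorem exists_amalgam_le_of_cell_decay (hι : Function.Injective ι) (η : PolyWeight d) :
    ∃ (K : ℕ) (C : ℝ), 0 < C ∧ ∀ (G : GlobalComponent) (k : Fin d → ℤ) (f : Tempered d)
      (e : (Fin d → ℤ) → E) (B : ℝ), MemLoc ι (restrict f) →
      (∀ j, ι (e j) = temperedMul (cell φ j) f) →
      (∀ j, (1 + ‖latticePoint j - latticePoint k‖) ^ K * ‖e j‖ ≤ B) →
      (amalgam ι φ η G).toFun (restrict f)
        ≤ ENNReal.ofReal (C * η.toFun (latticePoint k) * B) := by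
  obtain ⟨C₁, m, hC₁, h₁⟩ := η.exists_le
  obtain ⟨C₂, hC₂, h₂⟩ := exists_amalgam_le_tsum ι φ η
  obtain ⟨N, hN⟩ := exists_summable_lattice d
  have hN' := hN N le_rfl
  set S := ∑' r : Fin d → ℤ, ((1 + ‖latticePoint r‖) ^ N)⁻¹
  have hS : 0 ≤ S := tsum_nonneg fun _ => by positivity
  have hC₂' : (0 : ℝ) < C₂ := hC₂
  -- Of the assumed decay, `m` orders transfer the weight from `j` to `k`, and `N` orders sum over
  -- `j`.
  refine ⟨N + m, C₂ * (C₁ * (S + 1)), by positivity, fun G k f e B hloc he hB => ?_⟩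
  have hB0 : 0 ≤ B := le_trans (by positivity) (hB 0)
  have hk := η.pos (latticePoint k)
  refine (h₂ G _ hloc).trans ?_
  have h3 : ∀ j, cellNorm ι φ η (restrict f) j
      ≤ ENNReal.ofReal (C₁ * η.toFun (latticePoint k) * B *
        ((1 + ‖latticePoint (j - k)‖) ^ N)⁻¹) := fun j => by
    rw [cellNorm_eq φ hι η he]
    refine ENNReal.ofReal_le_ofReal ?_
    have hj := (η.pos (latticePoint j)).le
    have h4 := weight_mul_decay_le η h₁ (latticePoint k) (latticePoint j) N
    have hpos : 0 < (1 + ‖latticePoint j - latticePoint k‖) ^ (N + m) := by positivity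
    have h5 := hB j
    rw [mul_comm, ← le_div_iff₀ hpos, div_eq_mul_inv] at h5
    rw [latticePoint_sub]
    calc η.toFun (latticePoint j) * ‖e j‖ ≤ η.toFun (latticePoint j) *
          (B * ((1 + ‖latticePoint j - latticePoint k‖) ^ (N + m))⁻¹) := by gcongr
      _ = B * (η.toFun (latticePoint j) *
          ((1 + ‖latticePoint j - latticePoint k‖) ^ (N + m))⁻¹) := by ring
      _ ≤ B * (C₁ * η.toFun (latticePoint k) *
          ((1 + ‖latticePoint j - latticePoint k‖) ^ N)⁻¹) := by gcongr
      _ = _ := by ring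
  have h6 : Summable fun j : Fin d → ℤ => ((1 + ‖latticePoint (j - k)‖) ^ N)⁻¹ :=
    (Equiv.subRight k).summable_iff.2 hN'
  have h7 : ∑' j : Fin d → ℤ, ((1 + ‖latticePoint (j - k)‖) ^ N)⁻¹ = S :=
    (Equiv.subRight k).tsum_eq fun r : Fin d → ℤ => ((1 + ‖latticePoint r‖) ^ N)⁻¹
  calc (C₂ : ℝ≥0∞) * ∑' j, cellNorm ι φ η (restrict f) j
      ≤ C₂ * ENNReal.ofReal (C₁ * η.toFun (latticePoint k) * B * S) := by
        gcongr
        refine (ENNReal.tsum_le_tsum h3).trans (le_of_eq ?_)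
        rw [← h7, ← tsum_mul_left, ENNReal.ofReal_tsum_of_nonneg (fun j => by positivity)
          (h6.mul_left _)]
    _ = ENNReal.ofReal (C₂ * (C₁ * η.toFun (latticePoint k) * B * S)) := by
        rw [ENNReal.ofReal_mul hC₂'.le, ENNReal.ofReal_coe_nnreal]
    _ ≤ _ := by
        refine ENNReal.ofReal_le_ofReal ?_
        have h8 : 0 ≤ C₂ * (C₁ * η.toFun (latticePoint k) * B) := by positivity
        nlinarith

variable [CompleteSpace E]

/-- The amalgam norm of a localized element. -/
theorem exists_amalgam_local_le (hι : IsTMIB ι) (η : PolyWeight d) :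
    ∃ C : ℝ, 0 < C ∧ ∀ (G : GlobalComponent) (k : Fin d → ℤ) (e : E), IsLocal ι k e →
      (amalgam ι φ η G).toFun (restrict (ι e))
        ≤ ENNReal.ofReal (C * η.toFun (latticePoint k) * ‖e‖) := by
  obtain ⟨K, C₁, hC₁, h₁⟩ := exists_amalgam_le_of_cell_decay φ hι.injective η
  obtain ⟨C₂, hC₂, h₂⟩ := exists_mul_cell_le φ hι K
  obtain ⟨M, C₀, m, hC₀, hM, hb⟩ := hι.exists_modulate
  obtain ⟨N, C₃, hC₃, h₃⟩ := exists_local_multiplier hM hC₀ hb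
  refine ⟨C₁ * C₂, by positivity, fun G k e he => ?_⟩
  choose e' h4 h5 using fun j => h₂ k j e he
  refine (h₁ G k (ι e) e' (C₂ * ‖e‖) (fun χ => ?_) h4 h5).trans
    (le_of_eq (congrArg _ (by ring)))
  obtain ⟨e'', h6, -⟩ := h₃ k e (testToSchwartz χ) he
  exact ⟨e'', (isProduct_restrict_iff φ).2 h6⟩

/-- A Schwartz function, as a tempered distribution. -/
def toTempered (θ : 𝓢(Space d, ℂ)) : Tempered d :=
  SchwartzMap.toTemperedDistributionCLM (Space d) ℂ volume θ

theorem toTempered_apply (θ ψ : 𝓢(Space d, ℂ)) : toTempered θ ψ = ∫ x, θ x * ψ x := by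
  refine (SchwartzMap.toTemperedDistributionCLM_apply_apply volume θ ψ).trans ?_
  refine integral_congr_ae (Eventually.of_forall fun x => ?_)
  simp only [smul_eq_mul]
  exact mul_comm _ _

theorem temperedMul_toTempered (a θ : 𝓢(Space d, ℂ)) :
    temperedMul a (toTempered θ) = toTempered (schwartzMul a θ) := by
  ext ψ
  rw [temperedMul_apply, toTempered_apply, toTempered_apply]
  refine integral_congr_ae (Eventually.of_forall fun x => ?_)
  simp only [schwartzMul_apply]
  ring

theorem translate_toTempered (x : Space d) (θ : 𝓢(Space d, ℂ)) :
    translate x (toTempered θ) = toTempered (schwartzTranslate x θ) := by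
  ext ψ
  change toTempered θ (schwartzTranslate (-x) ψ) = _
  rw [toTempered_apply, toTempered_apply,
    ← integral_sub_right_eq_self (fun t => θ t * schwartzTranslate (-x) ψ t) x]
  refine integral_congr_ae (Eventually.of_forall fun t => ?_)
  simp only [schwartzTranslate_apply, sub_neg_eq_add, sub_add_cancel]

/-- The amalgam norm of the translates of a Schwartz function. -/
theorem exists_amalgam_translate_le (hι : IsTMIB ι)
    (hω : ∀ x : Space d, translationNorm ι x ≤ 1) (η : PolyWeight d) :
    ∃ (M : ℕ) (C : ℝ), 0 < C ∧ ∀ (G : GlobalComponent) (k : Fin d → ℤ) (c : 𝓢(Space d, ℂ)),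
      (amalgam ι φ η G).toFun (restrict (toTempered (schwartzTranslate (latticePoint k) c)))
        ≤ ENNReal.ofReal (C * η.toFun (latticePoint k) * snorm M c) := by
  obtain ⟨K, C₁, hC₁, h₁⟩ := exists_amalgam_le_of_cell_decay φ hι.injective η
  obtain ⟨j, hj, -⟩ := hι.schwartz
  obtain ⟨N, C₂, hC₂, h₂⟩ := exists_norm_le_snorm j
  set D := 2 ^ N * 4 ^ (N + K) * snorm (N + K) (testToSchwartz φ.toTest)
  have hD : 0 ≤ D := by positivity
  refine ⟨N + K, C₁ * (C₂ * (D + 1)), by positivity, fun G k c => ?_⟩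
  refine (h₁ G k _ (fun i => j (schwartzMul (cell φ i) (schwartzTranslate (latticePoint k) c)))
    (C₂ * (D + 1) * snorm (N + K) c) (fun χ => ?_) (fun i => ?_) (fun i => ?_)).trans
    (le_of_eq (congrArg _ (by ring)))
  · refine ⟨j (schwartzMul (testToSchwartz χ) (schwartzTranslate (latticePoint k) c)),
      (isProduct_restrict_iff φ).2 ?_⟩
    rw [temperedMul_toTempered]
    exact hj _
  · rw [temperedMul_toTempered]
    exact hj _
  · set b := schwartzMul c (schwartzTranslate (latticePoint i - latticePoint k)
      (testToSchwartz φ.toTest))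
    -- A cell of a translate is the translate by `k` of a product near the origin. Since
    -- translations have norm at most one, the decay in `i - k` comes without loss in `k`.
    have h3 : ι (j (schwartzMul (cell φ i) (schwartzTranslate (latticePoint k) c)))
        = translate (latticePoint k) (ι (j b)) := by
      rw [hj, hj]
      change _ = translate (latticePoint k) (toTempered b)
      rw [translate_toTempered]
      change toTempered _ = _
      congr 1
      ext t
      simp only [b, cell, schwartzMul_apply, schwartzTranslate_apply, sub_sub_sub_cancel_right]
      exact mul_comm _ _
    have h4 : ‖j (schwartzMul (cell φ i) (schwartzTranslate (latticePoint k) c))‖ ≤ ‖j b‖ := by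
      have := norm_le_of_inducedOpNorm_le zero_le_one
        (by rw [ENNReal.ofReal_one]; exact hω (latticePoint k)) h3
      rwa [one_mul] at this
    have h5 := snorm_schwartzMul_translate_le N K c (testToSchwartz φ.toTest)
      (latticePoint i - latticePoint k)
    calc (1 + ‖latticePoint i - latticePoint k‖) ^ K * _
        ≤ (1 + ‖latticePoint i - latticePoint k‖) ^ K * (C₂ * snorm N b) := by
          gcongr
          exact h4.trans (h₂ b)
      _ = C₂ * ((1 + ‖latticePoint i - latticePoint k‖) ^ K * snorm N b) := by ring
      _ ≤ C₂ * (D * snorm (N + K) c) := by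
          exact mul_le_mul_of_nonneg_left (h5.trans (mul_right_comm _ _ _).le) hC₂.le
      _ ≤ C₂ * ((D + 1) * snorm (N + K) c) := by gcongr; linarith
      _ = _ := by ring

end AmalgamEstimates

/-! ### Series of tensors and the expansion of the short-time Fourier transform -/

section Upper

variable {d : ℕ} {E F : Type*} [NormedAddCommGroup E] [NormedSpace ℂ E] [CompleteSpace E]
  [NormedAddCommGroup F] [NormedSpace ℂ F] [CompleteSpace F]
  {ιE : E →L[ℂ] Tempered d} {ιF : F →L[ℂ] Tempered d} (φ : UnityGenerator d)

/-- An absolutely convergent series of tensors represents the sum of the pairings. -/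
theorem exists_represents_of_summable {A : Fin 2 → ExtSeminorm (Tempered d)} {κ : Type*}
    [Countable κ] (w : κ → AlgTensor A) (hw : Summable fun i => ‖w i‖) (v : Tempered2 d)
    (h : ∀ θ : Fin 2 → 𝓢(Space d, ℂ),
      HasSum (fun i => tensorPairing A θ (w i)) (v (schwartzTensor (θ 0) (θ 1)))) :
    ∃ u : ProjTensor A, Represents A u v ∧ ‖u‖ ≤ ∑' i, ‖w i‖ := by
  have hw' : Summable fun i => ‖(w i : ProjTensor A)‖ := by
    simpa only [UniformSpace.Completion.norm_coe] using hw
  obtain ⟨s, hs⟩ := (atTop : Filter (Finset κ)).exists_seq_tendsto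
  refine ⟨∑' i, (w i : ProjTensor A), ⟨fun n => ∑ i ∈ s n, w i, ?_, fun θ => ?_⟩, ?_⟩
  · have h1 : Tendsto (fun t : Finset κ => ∑ i ∈ t, (w i : ProjTensor A)) atTop
        (𝓝 (∑' i, (w i : ProjTensor A))) := hw'.of_norm.hasSum
    refine (h1.comp hs).congr fun n => ?_
    exact (map_sum (UniformSpace.Completion.toCompl (α := AlgTensor A)) w (s n)).symm
  · have h1 : Tendsto (fun t : Finset κ => ∑ i ∈ t, tensorPairing A θ (w i)) atTop
        (𝓝 (v (schwartzTensor (θ 0) (θ 1)))) := h θ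
    refine (h1.comp hs).congr fun n => ?_
    exact (map_sum (tensorPairing A θ) w (s n)).symm
  · refine (norm_tsum_le_tsum_norm hw').trans (le_of_eq ?_)
    simp only [UniformSpace.Completion.norm_coe]

/-- The expansion of the convolution with the window into a Fourier series on a cell. -/
theorem hasSum_window (w θ₀ θ₁ : 𝓢(Space d, ℂ)) (f : Tempered d) (k : Fin d → ℤ) :
    HasSum (fun n => ((period d ^ d : ℝ)⁻¹ : ℂ) * character (freq n) (-latticePoint k) *
      (toTempered (schwartzTranslate (latticePoint k) (coef w (freq n))) θ₀ *
        f (schwartzMul (cell φ k) (schwartzModulate (freq n) θ₁))))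
      (f (schwartzMul (cell φ k) (schwartzMul (sconv w θ₀) θ₁))) := by
  -- The expansion is available near the origin, so the test function is moved back by `k`; the
  -- shift of the characters gives the factor `character (freq n) (-latticePoint k)`.
  set ψ := schwartzTranslate (-latticePoint k) θ₀ with hψ
  have h1 : ∀ n : Fin d → ℤ, toTempered (schwartzTranslate (latticePoint k) (coef w (freq n))) θ₀
      = ∫ x, coef w (freq n) x * ψ x := fun n => by
    rw [toTempered_apply, ← integral_sub_right_eq_self
      (fun x => coef w (freq n) x * ψ x) (latticePoint k)]
    refine integral_congr_ae (Eventually.of_forall fun x => ?_)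
    simp only [hψ, schwartzTranslate_apply, sub_neg_eq_add, sub_add_cancel]
  set c : (Fin d → ℤ) → ℂ := fun n => ((period d ^ d : ℝ)⁻¹ : ℂ) *
    character (freq n) (-latticePoint k) * ∫ x, coef w (freq n) x * ψ x
  have hc : RapidDecay c := fun K => by
    refine ⟨2 ^ K * snorm K (𝓕 (schwartzMul (cutoff d) (sconv w ψ))), fun n => ?_⟩
    refine le_trans ?_ (norm_apply_le_snorm _ (freq n) K)
    gcongr
    simp only [c, norm_mul, norm_character, mul_one, integral_coef_mul]
    exact mul_le_of_le_one_left (norm_nonneg _) norm_inv_period_pow_le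
  have h2 := hc.hasSum_tempered (cell φ k) θ₁
    (schwartzMul (cell φ k) (schwartzMul (sconv w θ₀) θ₁)) (σ := fun t => sconv w θ₀ t)
    (fun t ht => ?_) (fun t => ?_) f
  · refine h2.congr_fun fun n => ?_
    simp only [c, h1]
    ring
  · have h3 := hasSum_coef w ψ (norm_le_of_mem_cube (mem_cube_of_cell_ne_zero φ ht))
    have h4 : ∫ x, w (t - latticePoint k - x) * ψ x = sconv w θ₀ t := by
      rw [sconv_apply, ← integral_sub_right_eq_self
        (fun x => w (t - latticePoint k - x) * ψ x) (latticePoint k)]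
      refine integral_congr_ae (Eventually.of_forall fun x => ?_)
      simp only [hψ, schwartzTranslate_apply, sub_neg_eq_add, sub_add_cancel,
        sub_sub_sub_cancel_right]
    rw [h4] at h3
    refine h3.congr_fun fun n => ?_
    simp only [c]
    rw [sub_eq_add_neg, character_add_left]
    ring
  · simp only [schwartzMul_apply]
    ring

end Upper

/-! ### The bound of the modulation norm by the amalgam norm, and the equality of the spaces -/

section UpperBound

theorem ExtSeminorm.exists_incl_eq {X : Type*} [AddCommGroup X] [Module ℂ X] (N : ExtSeminorm X)
    {f : X} {B : ℝ} (hB : 0 ≤ B) (h : N.toFun f ≤ ENNReal.ofReal B) :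
    ∃ x : N.FiniteSpace, N.incl x = f ∧ ‖x‖ ≤ B := by
  let x : N.FiniteSpace := (⟨f, h.trans_lt ENNReal.ofReal_lt_top⟩ : N.carrier)
  refine ⟨x, rfl, ?_⟩
  have h1 : ‖x‖ₑ ≤ ENNReal.ofReal B := (N.enorm_eq x).trans_le h
  rwa [← ofReal_norm, ENNReal.ofReal_le_ofReal_iff hB] at h1

variable {d : ℕ} {E F : Type*} [NormedAddCommGroup E] [NormedSpace ℂ E] [CompleteSpace E]
  [NormedAddCommGroup F] [NormedSpace ℂ F] [CompleteSpace F]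
  {ιE : E →L[ℂ] Tempered d} {ιF : F →L[ℂ] Tempered d} (φ : UnityGenerator d)

/-- The elementary tensors in the expansion of a short-time Fourier transform. -/
theorem exists_elementary_tensors (hF : IsTMIB ιF)
    (hω : ∀ x : Space d, translationNorm ιF x ≤ 1)
    (hE : IsTMIB ιE) (η₁ η₂ : PolyWeight d) (G₁ G₂ : GlobalComponent) (w : 𝓢(Space d, ℂ))
    {A : Fin 2 → ExtSeminorm (Tempered d)}
    (hA₀ : ∀ f, (A 0).toFun f = (amalgam ιF φ η₁ G₁).toFun (restrict f))
    (hA₁ : ∀ f, (A 1).toFun f = (amalgam ιE φ η₂ G₂).toFun (restrict (𝓕⁻ f))) (N : ℕ) :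
    ∃ C : ℝ, 0 < C ∧ ∀ (f : Tempered d) (k : Fin d → ℤ) (e : E),
      ιE e = temperedMul (cell φ k) f → ∀ n : Fin d → ℤ, ∃ t : AlgTensor A,
        (1 + ‖freq n‖) ^ N * ‖t‖ ≤ C * ((η₁.mul η₂).toFun (latticePoint k) * ‖e‖) ∧
        ∀ θ : Fin 2 → 𝓢(Space d, ℂ), tensorPairing A θ t
          = ((period d ^ d : ℝ)⁻¹ : ℂ) * character (freq n) (-latticePoint k) *
            (toTempered (schwartzTranslate (latticePoint k) (coef w (freq n))) (θ 0) *
            f (schwartzMul (cell φ k) (schwartzModulate (freq n) (𝓕 (θ 1))))) := by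
  obtain ⟨M₁, C₁, hC₁, h₁⟩ := exists_amalgam_translate_le φ hF hω η₁
  obtain ⟨C₂, hC₂, h₂⟩ := exists_amalgam_local_le φ hE η₂
  obtain ⟨M, C₀, m, hC₀, hM, hb⟩ := hE.exists_modulate
  -- The extra `m` orders absorb the growth of the modulation by `freq n` on `E`, leaving `N` for
  -- the summation over `n`.
  obtain ⟨C₃, hC₃, h₃⟩ := exists_coef_decay w M₁ (N + m)
  refine ⟨C₁ * C₂ * C₀ * C₃, by positivity, fun f k e he n => ?_⟩
  have hk₁ := η₁.pos (latticePoint k)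
  have hk₂ := η₂.pos (latticePoint k)
  obtain ⟨a, ha, ha'⟩ := (A 0).exists_incl_eq
    (f := toTempered (schwartzTranslate (latticePoint k) (coef w (freq n))))
    (B := C₁ * η₁.toFun (latticePoint k) * snorm M₁ (coef w (freq n)))
    (by positivity) (by rw [hA₀]; exact h₁ G₁ k _)
  have hloc : IsLocal ιE k (M (freq n) e) :=
    (isLocal_of_eq_temperedMul_cell φ he).modulate (hM (freq n) e)
  obtain ⟨b, hb₁, hb₂⟩ := (A 1).exists_incl_eq (f := 𝓕 (ιE (M (freq n) e)))
    (B := C₂ * η₂.toFun (latticePoint k) * ‖M (freq n) e‖) (by positivity) (by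
      rw [hA₁, FourierTransform.fourierInv_fourier_eq]
      exact h₂ G₂ k _ hloc)
  let p : ∀ i, (A i).FiniteSpace := fun i => match i with
    | 0 => a
    | 1 => b
  set c : ℂ := ((period d ^ d : ℝ)⁻¹ : ℂ) * character (freq n) (-latticePoint k) with hc_def
  have hc : ‖c‖ ≤ 1 := by
    rw [hc_def, norm_mul, norm_character, mul_one]
    exact norm_inv_period_pow_le
  refine ⟨c • PiTensorProduct.tprod ℂ p, ?_, fun θ => ?_⟩
  · have h4 : ‖c • PiTensorProduct.tprod ℂ p‖ ≤ ‖a‖ * ‖b‖ := by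
      rw [norm_smul]
      refine (mul_le_of_le_one_left (norm_nonneg _) hc).trans ?_
      refine (PiTensorProduct.projectiveSeminorm_tprod_le p).trans (le_of_eq ?_)
      rw [Fin.prod_univ_two]
    have h5 : ‖b‖ ≤ C₂ * η₂.toFun (latticePoint k) * (C₀ * (1 + ‖freq n‖) ^ m * ‖e‖) :=
      hb₂.trans (by gcongr; exact hb _ _)
    calc (1 + ‖freq n‖) ^ N * ‖c • PiTensorProduct.tprod ℂ p‖
        ≤ (1 + ‖freq n‖) ^ N * ((C₁ * η₁.toFun (latticePoint k) * snorm M₁ (coef w (freq n))) *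
          (C₂ * η₂.toFun (latticePoint k) * (C₀ * (1 + ‖freq n‖) ^ m * ‖e‖))) := by
          refine mul_le_mul_of_nonneg_left (h4.trans ?_) (by positivity)
          gcongr
      _ = C₁ * C₂ * C₀ * ((1 + ‖freq n‖) ^ (N + m) * snorm M₁ (coef w (freq n))) *
          (η₁.toFun (latticePoint k) * η₂.toFun (latticePoint k) * ‖e‖) := by
          rw [pow_add]; ring
      _ ≤ C₁ * C₂ * C₀ * C₃ *
          (η₁.toFun (latticePoint k) * η₂.toFun (latticePoint k) * ‖e‖) := by
          gcongr
          exact h₃ _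
  · rw [map_smul, tensorPairing_tprod, smul_eq_mul]
    congr 1
    change (A 0).incl a (θ 0) * (A 1).incl b (θ 1) = _
    rw [ha, hb₁, TemperedDistribution.fourier_apply, hM]
    congr 1
    change ιE e (schwartzModulate (freq n) _) = _
    rw [he, temperedMul_apply]

/-- The norms of the elementary tensors are bounded by a product of a summable sequence in `k`, the
weighted cells, and one in `n`, so the double series converges absolutely in the projective tensor
product. -/
theorem exists_modulationSpaceNorm_le_amalgam (hF : IsTMIB ιF)
    (hω : ∀ x : Space d, translationNorm ιF x ≤ 1)
    (hE : IsTMIB ιE) (η₁ η₂ : PolyWeight d) (G₁ G₂ : GlobalComponent) (g : 𝓢(Space d, ℂ)) :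
    ∃ C : ℝ≥0, ∀ f : Tempered d,
      modulationSpaceNorm g (projTensorNorm (temperedAmalgam ιF φ η₁ G₁)
        (fourierImage (temperedAmalgam ιE φ η₂ G₂))) f
        ≤ C * (amalgam ιE φ (η₁.mul η₂) (.lp 1 le_rfl)).toFun (restrict f) := by
  obtain ⟨N, S, hS, hN⟩ := exists_tsum_le_of_decay d
  set A : Fin 2 → ExtSeminorm (Tempered d) :=
    ![temperedAmalgam ιF φ η₁ G₁, fourierImage (temperedAmalgam ιE φ η₂ G₂)] with hA
  have hA₀ : ∀ f, (A 0).toFun f = (amalgam ιF φ η₁ G₁).toFun (restrict f) := fun _ => rfl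
  have hA₁ : ∀ f, (A 1).toFun f = (amalgam ιE φ η₂ G₂).toFun (restrict (𝓕⁻ f)) := fun _ => rfl
  obtain ⟨C₁, hC₁, h₁⟩ := exists_elementary_tensors φ hF hω hE η₁ η₂ G₁ G₂ (schwartzConj g)
    hA₀ hA₁ N
  obtain ⟨C₂, hC₂, h₂⟩ := exists_eLpNorm_cellNorm_le_amalgam ιE φ (η₁.mul η₂)
  obtain ⟨M, C₃, hC₃, h₃⟩ := exists_tensorPairing_le φ hF hE η₁ η₂ G₁ G₂ hA₀ hA₁
  -- The added one visibly keeps the constant nonzero, for the case of infinite amalgam norm.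
  refine ⟨(C₁ * S).toNNReal * C₂ + 1, fun f => ?_⟩
  by_cases htop : (amalgam ιE φ (η₁.mul η₂) (.lp 1 le_rfl)).toFun (restrict f) = ∞
  · rw [htop, ENNReal.mul_top]
    · exact le_top
    · simp
  have hfin := lt_top_iff_ne_top.2 htop
  choose e he using fun k => (amalgam_lt_top ιE φ (η₁.mul η₂) hfin).1.1
    (testTranslate (latticePoint k) φ.toTest)
  have he' : ∀ k, ιE (e k) = temperedMul (cell φ k) f := fun k =>
    (isProduct_cell_iff φ).1 (he k)
  set x : (Fin d → ℤ) → ℝ := fun k => (η₁.mul η₂).toFun (latticePoint k) * ‖e k‖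
  have hx0 : ∀ k, 0 ≤ x k := fun k => mul_nonneg ((η₁.mul η₂).pos _).le (norm_nonneg _)
  have hxsum : ∑' k, ENNReal.ofReal (x k)
      ≤ C₂ * (amalgam ιE φ (η₁.mul η₂) (.lp 1 le_rfl)).toFun (restrict f) := by
    refine le_trans (le_of_eq ?_) (h₂ (.lp 1 le_rfl) (restrict f) hfin)
    change _ = eLpNorm _ 1 _
    rw [eLpNorm_one_eq_lintegral_enorm, lintegral_count]
    refine tsum_congr fun k => ?_
    rw [enorm_eq_self, cellNorm_eq φ hE.injective _ he']
  have hxfin : ∑' k, ENNReal.ofReal (x k) ≠ ∞ :=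
    ne_top_of_le_ne_top (ENNReal.mul_ne_top ENNReal.coe_ne_top htop) hxsum
  have hx : Summable x := by
    have h4 := ENNReal.summable_toReal hxfin
    simpa only [ENNReal.toReal_ofReal (hx0 _)] using h4
  choose t ht htp using fun k n => h₁ f k (e k) (he' k) n
  set y : (Fin d → ℤ) → ℝ := fun n => ((1 + ‖freq n‖) ^ N)⁻¹
  obtain ⟨hy, hyS⟩ := hN y 1 (fun n => by positivity) fun n =>
    (mul_inv_cancel₀ (by positivity)).le
  have htle : ∀ i : (Fin d → ℤ) × (Fin d → ℤ), ‖t i.1 i.2‖ ≤ C₁ * (x i.1 * y i.2) := fun i => by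
    have h4 := ht i.1 i.2
    rw [mul_comm, ← le_div_iff₀ (by positivity), div_eq_mul_inv] at h4
    exact h4.trans (le_of_eq (mul_assoc _ _ _))
  have hxy : Summable fun i : (Fin d → ℤ) × (Fin d → ℤ) => x i.1 * y i.2 :=
    hx.mul_of_nonneg hy hx0 fun n => by positivity
  have htsum : Summable fun i : (Fin d → ℤ) × (Fin d → ℤ) => ‖t i.1 i.2‖ :=
    Summable.of_nonneg_of_le (fun _ => norm_nonneg _) htle (hxy.mul_left C₁)
  obtain ⟨v, hv⟩ := exists_isGivenBy_stft g f
  obtain ⟨u, hu, hu'⟩ := exists_represents_of_summable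
    (fun i : (Fin d → ℤ) × (Fin d → ℤ) => t i.1 i.2) htsum v fun θ => by
      have hθ : θ = ![θ 0, 𝓕⁻ (𝓕 (θ 1))] := by
        ext1 i
        fin_cases i
        · rfl
        · exact (FourierTransform.fourierInv_fourier_eq (θ 1)).symm
      have hps : Summable fun i : (Fin d → ℤ) × (Fin d → ℤ) => tensorPairing A θ (t i.1 i.2) := by
        refine Summable.of_norm_bounded
          (htsum.mul_left (C₃ * snorm M (θ 0) * snorm M (𝓕 (θ 1)))) fun i => ?_
        conv_lhs => rw [hθ]
        exact h₃ _ _ _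
      -- The inner sum over `n` is the Fourier expansion on one cell, the outer sum over `k` the
      -- partition of unity; absolute convergence identifies the iterated sum with the double one.
      have h5 := hps.hasSum.prod_fiberwise fun k => by
        simp only [htp]
        exact hasSum_window φ (schwartzConj g) (θ 0) (𝓕 (θ 1)) f k
      have h6 := hasSum_tempered_cell φ f
        (schwartzMul (sconv (schwartzConj g) (θ 0)) (𝓕 (θ 1)))
      rw [isGivenBy_stft_apply_tensor hv, h6.unique h5]
      exact hps.hasSum
  refine (iInf₂_le v hv).trans ((iInf₂_le u hu).trans ?_)
  have h7 : ‖u‖ ≤ C₁ * S * ∑' k, x k := by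
    refine hu'.trans ((htsum.tsum_le_tsum htle (hxy.mul_left C₁)).trans ?_)
    rw [tsum_mul_left, ← hx.tsum_mul_tsum hy hxy]
    have h8 : 0 ≤ ∑' k, x k := tsum_nonneg hx0
    calc C₁ * ((∑' k, x k) * ∑' n, y n) ≤ C₁ * ((∑' k, x k) * (S * 1)) := by gcongr
      _ = _ := by ring
  calc ‖u‖ₑ = ENNReal.ofReal ‖u‖ := (ofReal_norm u).symm
    _ ≤ ENNReal.ofReal (C₁ * S * ∑' k, x k) := ENNReal.ofReal_le_ofReal h7
    _ = ENNReal.ofReal (C₁ * S) * ∑' k, ENNReal.ofReal (x k) := by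
        rw [ENNReal.ofReal_mul (by positivity), ENNReal.ofReal_tsum_of_nonneg hx0 hx]
    _ ≤ ENNReal.ofReal (C₁ * S) *
        (C₂ * (amalgam ιE φ (η₁.mul η₂) (.lp 1 le_rfl)).toFun (restrict f)) := by gcongr
    _ ≤ _ := by
        rw [← mul_assoc]
        gcongr
        push_cast
        exact le_self_add

/-- The equality of the amalgam space and the modulation space, for all admissible pairs of global
components. -/
theorem equalWithEquivalentNorms_modulationSpace (hE : IsTMIB ιE) (hF : IsTMIB ιF)
    (hω : ∀ x : Space d, translationNorm ιF x ≤ 1) (η₁ η₂ : PolyWeight d)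
    (G₁ G₂ : GlobalComponent) (hG : 1 ≤ G₁.exponent⁻¹ + G₂.exponent⁻¹) {g : 𝓢(Space d, ℂ)}
    (hg : g ≠ 0) :
    EqualWithEquivalentNorms (amalgam ιE φ (η₁.mul η₂) (.lp 1 le_rfl))
      (modulationSpaceNorm g (projTensorNorm (temperedAmalgam ιF φ η₁ G₁)
        (fourierImage (temperedAmalgam ιE φ η₂ G₂)))) := by
  obtain ⟨C₁, hC₁, h₁⟩ := exists_amalgam_le_modulationSpaceNorm φ hF hω hE η₁ η₂ hG
    (.lp 1 le_rfl) hg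
  obtain ⟨C₂, h₂⟩ := exists_modulationSpaceNorm_le_amalgam φ hF hω hE η₁ η₂ G₁ G₂ g
  refine ⟨fun T => ⟨fun hT => ?_, ?_⟩, max C₁ C₂, lt_max_of_lt_left hC₁, fun f => ⟨?_, ?_⟩⟩
  · obtain ⟨f, rfl⟩ := exists_restrict_eq φ hE (η₁.mul η₂) _ hT
    exact ⟨f, rfl, (h₂ f).trans_lt (ENNReal.mul_lt_top ENNReal.coe_lt_top hT)⟩
  · rintro ⟨f, rfl, hf⟩
    exact (h₁ f).trans_lt (ENNReal.mul_lt_top ENNReal.coe_lt_top hf)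
  · refine (h₁ f).trans ?_
    gcongr
    exact le_max_left _ _
  · refine (h₂ f).trans ?_
    gcongr
    exact le_max_right _ _

end UpperBound

end

end AmalgamMod


theorem theorem1p21 {d : ℕ}
    {E : Type*} [NormedAddCommGroup E] [NormedSpace ℂ E] [CompleteSpace E]
    {F : Type*} [NormedAddCommGroup F] [NormedSpace ℂ F] [CompleteSpace F]
    (ιE : E →L[ℂ] Tempered d) (hE : IsTMIB ιE)
    (ιF : F →L[ℂ] Tempered d) (hF : IsTMIB ιF)
    (hω : ∀ x : Space d, translationNorm ιF x = 1)
    (η₁ η₂ : PolyWeight d) (φ : UnityGenerator d)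
    (g : 𝓢(Space d, ℂ)) (hg : g ≠ 0) :
    (∀ (p₁ p₂ : ℝ≥0∞) (h₁ : 1 ≤ p₁) (h₂ : 1 ≤ p₂), p₁ ≠ ∞ → p₂ ≠ ∞ → 1 ≤ p₁⁻¹ + p₂⁻¹ →
      EqualWithEquivalentNorms (amalgam ιE φ (η₁.mul η₂) (.lp 1 le_rfl))
        (modulationSpaceNorm g (projTensorNorm (temperedAmalgam ιF φ η₁ (.lp p₁ h₁))
          (fourierImage (temperedAmalgam ιE φ η₂ (.lp p₂ h₂)))))) ∧
    EqualWithEquivalentNorms (amalgam ιE φ (η₁.mul η₂) (.lp 1 le_rfl))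
      (modulationSpaceNorm g (projTensorNorm (temperedAmalgam ιF φ η₁ .linftyZero)
        (fourierImage (temperedAmalgam ιE φ η₂ (.lp 1 le_rfl))))) ∧
    EqualWithEquivalentNorms (amalgam ιE φ (η₁.mul η₂) (.lp 1 le_rfl))
      (modulationSpaceNorm g (projTensorNorm (temperedAmalgam ιF φ η₁ (.lp 1 le_rfl))
        (fourierImage (temperedAmalgam ιE φ η₂ .linftyZero)))) := by
  -- All three assertions are instances of one statement about pairs of global components; `L^∞_0`
  -- counts with exponent `∞`, whose reciprocal is zero.
  have h : ∀ G₁ G₂ : GlobalComponent, 1 ≤ G₁.exponent⁻¹ + G₂.exponent⁻¹ → _ := fun G₁ G₂ hG =>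
    equalWithEquivalentNorms_modulationSpace φ hE hF (fun x => (hω x).le) η₁ η₂ G₁ G₂ hG hg
  refine ⟨fun p₁ p₂ h₁ h₂ _ _ hp => h (.lp p₁ h₁) (.lp p₂ h₂) hp, h _ _ ?_, h _ _ ?_⟩
  · simp [GlobalComponent.exponent]
  · simp [GlobalComponent.exponent]
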